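/- Write $\mathbf e(z)=\exp(2\pi\imath z)$. Let $\mathfrak g$ be a simple finite-dimensional complex Lie algebra with Cartan subalgebra $\mathfrak h$ and Chevalley generators $e_i,f_i$. Let $\nu$ be a diagram automorphism, i.e. an automorphism of $\mathfrak g$ with $\nu(e_i)=e_{\sigma(i)}$, $\nu(f_i)=f_{\sigma(i)}$ for a permutation $\sigma$; let $r$ be its order ($r=1$ is allowed), $\omega=\mathbf e(1/r)$, and $\mathfrak h_0=\{h\in\mathfrak h:\nu h=h\}$. Let $\operatorname{Im}\tau>0$, $\tilde q=\mathbf e(\tau/r)$. Let $G^{ad}\subset GL(\mathfrak g)$ be the adjoint group, generated by the $\exp(\mathrm{ad}\,y)$, $y\in\mathfrak g$. Let $L_0(G^{ad},\nu)$ be the group of holomorphic maps $f:\mathbb C^*\to G^{ad}$ with $f(\omega t)=\nu f(t)\nu^{-1}$. It is the group of gauge transformations, and also the set of transition operators $R(t)$, on which $f$ acts by $R(t)\mapsto f(\tilde qt)R(t)f(t)^{-1}$. Its Lie algebra $\mathfrak L$ consists of the holomorphic $\mathfrak x:\mathbb C^*\to\mathfrak g$ with $\mathfrak x(\omega t)=\nu(\mathfrak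 x(t))$. For $\mathbf u\in\mathfrak h_0$ put $\mathbf x=\mathbf e(\mathbf u)=\exp(2\pi\imath\,\mathrm{ad}\,\mathbf u)$ and $$\mathfrak L_{\mathbf x}=\{Y\in\mathfrak L:\ Y(\tilde qt)=\mathbf x(Y(t))\ \text{for all } t\},$$ the infinitesimal gauge transformations fixing $\mathbf x$. A first-order deformation of the transition operator $\mathbf x$ is $R=\mathbf x+\varepsilon\,\delta R$, $\varepsilon^2=0$, with $\delta R:\mathbb C^*\to\mathrm{End}\,\mathfrak g$ holomorphic, $\delta R(\omega t)=\nu\,\delta R(t)\,\nu^{-1}$, and $R(t)$ preserving the Lie bracket modulo $\varepsilon^2$. Call $\mathbf u\in\mathfrak h_0$ regular if $X\in\mathfrak h$ whenever $X\in\mathfrak g$, $k\in\mathbb Z$, $\nu X=\omega^kX$ and $\mathbf x(X)=\tilde q^kX$. **Proposition.** 1. Let $\mathbf u\in\mathfrak h_0$. Then $\mathfrak L_{\mathbf x}$ is finite-dimensional, and for every first-order deformation $\mathbf x+\varepsilon\,\delta R$ there is exactly one $\delta R_0$ of the form $\delta R_0(t)=\mathbf x\,\mathrm{ad}\,Y(t)$,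 $Y\in\mathfrak L_{\mathbf x}$, such that for some $\mathfrak x\in\mathfrak L$ $$\mathbf x+\varepsilon(\delta R(t)-\delta R_0(t))=(1-\varepsilon\,\mathrm{ad}\,\mathfrak x(\tilde qt))\;\mathbf x\;(1+\varepsilon\,\mathrm{ad}\,\mathfrak x(t))\qquad(t\in\mathbb C^*).$$ Thus the $\delta R$ for which $\mathbf x+\varepsilon\,\delta R$ is an infinitesimal gauge transform of $\mathbf x$ form a subspace of finite codimension. 2. Let $\mathbf u\in\mathfrak h_0$ be regular. (a) For every first-order deformation $\mathbf x+\varepsilon\,\delta R$ there is exactly one $h\in\mathfrak h_0$ such that the formula of part 1 holds, for some $\mathfrak x\in\mathfrak L$, with the constant $\delta R_0=\mathbf x\,\mathrm{ad}\,h$. (b) Fix a norm on $\mathrm{End}\,\mathfrak g$ and let $A=\{|\tilde q|^{1/2}\le|t|\le|\tilde q|^{-1/2}\}$. For every $\delta>0$ there is $\eta>0$ such that for every $R\in L_0(G^{ad},\nu)$ with $\|R(t)-\mathbf x\|<\eta$ on $A$ there are $\mathbf u'\in\mathfrak h_0$ with $\|\mathrm{ad}(\mathbf u'-\mathbf u)\|<\delta$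 and $f\in L_0(G^{ad},\nu)$ with $\|f(t)-1\|<\delta$ on $A$, such that $$R(t)=f(\tilde qt)^{-1}\,\mathbf e(\mathbf u')\,f(t)\qquad(t\in\mathbb C^*).$$ 3. Almost every $\mathbf u\in\mathfrak h_0$ (for Lebesgue measure) is regular. -/

import Mathlib

open scoped Real

namespace TwistedBundle

noncomputable section

/-- `e(z) = exp (2πi z)`, as an element of `ℂ^*`. -/
def e (z : ℂ) : ℂˣ :=
  Units.mk0 (Complex.exp (2 * π * Complex.I * z)) (Complex.exp_ne_zero _)

section Linear

variable {V : Type*} [AddCommGroup V] [Module ℂ V]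

/-- A map `ℂ^* → V` into a finite-dimensional space is holomorphic: each of its coordinates is. -/
def IsHolomorphic (f : ℂˣ → V) : Prop :=
  ∀ φ : Module.Dual ℂ V, ∃ F : ℂ → ℂ, DifferentiableOn ℂ F {0}ᶜ ∧ ∀ t : ℂˣ, F t = φ (f t)

theorem IsHolomorphic.add {f g : ℂˣ → V} (hf : IsHolomorphic f) (hg : IsHolomorphic g) :
    IsHolomorphic (f + g) := by
  intro φ
  obtain ⟨F, hF, hF'⟩ := hf φ
  obtain ⟨G, hG, hG'⟩ := hg φ
  exact ⟨F + G, hF.add hG, fun t => by simp [hF', hG']⟩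

theorem IsHolomorphic.smul {f : ℂˣ → V} (c : ℂ) (hf : IsHolomorphic f) :
    IsHolomorphic (c • f) := by
  intro φ
  obtain ⟨F, hF, hF'⟩ := hf φ
  exact ⟨c • F, hF.const_smul c, fun t => by simp [hF']⟩

theorem IsHolomorphic.zero : IsHolomorphic (0 : ℂˣ → V) :=
  fun φ => ⟨0, differentiableOn_const 0, fun t => by simp⟩

variable [FiniteDimensional ℂ V]

/-- The exponential of an endomorphism of a finite-dimensional space, computed in a basis. -/
def expEnd (A : Module.End ℂ V) : Module.End ℂ V :=
  (LinearMap.toMatrixAlgEquiv (Module.finBasis ℂ V)).symm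
    (NormedSpace.exp (LinearMap.toMatrixAlgEquiv (Module.finBasis ℂ V) A))

theorem expEnd_mul_expEnd_neg (A : Module.End ℂ V) : expEnd A * expEnd (-A) = 1 := by
  have h : ∀ M : Matrix (Fin (Module.finrank ℂ V)) (Fin (Module.finrank ℂ V)) ℂ,
      NormedSpace.exp M * NormedSpace.exp (-M) = 1 := fun M => by
    rw [← Matrix.exp_add_of_commute M (-M) (Commute.neg_right (Commute.refl M)), add_neg_cancel,
      NormedSpace.exp_zero]
  rw [expEnd, expEnd, ← map_mul, map_neg, h, map_one]

/-- `exp A` as an invertible endomorphism, with inverse `exp (-A)`. -/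
def expUnit (A : Module.End ℂ V) : (Module.End ℂ V)ˣ where
  val := expEnd A
  inv := expEnd (-A)
  val_inv := expEnd_mul_expEnd_neg A
  inv_val := by simpa using expEnd_mul_expEnd_neg (-A)

/-- A norm on the endomorphisms of a finite-dimensional space: the sum of the absolute values of
the matrix entries. -/
def size (A : Module.End ℂ V) : ℝ :=
  ∑ i, ∑ j, ‖LinearMap.toMatrixAlgEquiv (Module.finBasis ℂ V) A i j‖

end Linear

section Lie

variable {𝔤 : Type*} [LieRing 𝔤] [LieAlgebra ℂ 𝔤]

/-- `ν` is a diagram automorphism: it permutes the chosen Chevalley generators. -/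
def IsDiagramAutomorphism {ι : Type*} [Finite ι] {H : LieSubalgebra ℂ 𝔤}
    (B : LieAlgebra.Basis ι H) (ν : 𝔤 ≃ₗ⁅ℂ⁆ 𝔤) : Prop :=
  ∃ σ : Equiv.Perm ι, ∀ i, ν (B.e i) = B.e (σ i) ∧ ν (B.f i) = B.f (σ i)

/-- The Cartan subalgebra `𝔥₀ = {h ∈ 𝔥 | ν h = h}` of the fixed algebra `𝔤₀` of `ν`. -/
def fixedCartan (H : LieSubalgebra ℂ 𝔤) (ν : 𝔤 ≃ₗ⁅ℂ⁆ 𝔤) : Submodule ℂ 𝔤 where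
  carrier := {h | h ∈ H ∧ ν h = h}
  add_mem' := fun ha hb => ⟨add_mem ha.1 hb.1, by rw [map_add, ha.2, hb.2]⟩
  zero_mem' := ⟨zero_mem _, map_zero _⟩
  smul_mem' := fun c _ ha => ⟨H.smul_mem c ha.1, by rw [map_smul, ha.2]⟩

/-- The Lie algebra of the gauge group: holomorphic maps `𝔵 : ℂ^* → 𝔤` with
`𝔵(ωt) = ν(𝔵(t))`, `ω = e(1/r)`. -/
def gaugeAlgebra (ν : 𝔤 ≃ₗ⁅ℂ⁆ 𝔤) (r : ℕ) : Submodule ℂ (ℂˣ → 𝔤) where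
  carrier := {X | IsHolomorphic X ∧ ∀ t, X (e (1 / r) * t) = ν (X t)}
  add_mem' := fun ha hb => ⟨ha.1.add hb.1, fun t => by
    rw [Pi.add_apply, Pi.add_apply, ha.2, hb.2, map_add]⟩
  zero_mem' := ⟨IsHolomorphic.zero, fun t => by simp⟩
  smul_mem' := fun c _ ha => ⟨ha.1.smul c, fun t => by
    rw [Pi.smul_apply, Pi.smul_apply, ha.2, map_smul]⟩

variable [FiniteDimensional ℂ 𝔤]

/-- The adjoint group `G^ad`, generated by the `exp (ad y)`, `y ∈ 𝔤`. -/
def adjointGroup (𝔤 : Type*) [LieRing 𝔤] [LieAlgebra ℂ 𝔤] [FiniteDimensional ℂ 𝔤] :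
    Subgroup (Module.End ℂ 𝔤)ˣ :=
  Subgroup.closure (Set.range fun y : 𝔤 => expUnit (LieAlgebra.ad ℂ 𝔤 y))

/-- `e(u) = exp (2πi ad u)`. -/
def eAd (u : 𝔤) : (Module.End ℂ 𝔤)ˣ :=
  expUnit ((2 * π * Complex.I) • LieAlgebra.ad ℂ 𝔤 u)

/-- The twisted loop group: holomorphic maps `f : ℂ^* → G^ad` with `f(ωt) = ν f(t) ν⁻¹`,
`ω = e(1/r)`. Both the transition operators and the gauge transformations are of this kind. -/
def IsTwistedLoop (ν : 𝔤 ≃ₗ⁅ℂ⁆ 𝔤) (r : ℕ) (f : ℂˣ → (Module.End ℂ 𝔤)ˣ) : Prop :=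
  IsHolomorphic (fun t => (f t : Module.End ℂ 𝔤)) ∧ (∀ t, f t ∈ adjointGroup 𝔤) ∧
    ∀ t y, (f (e (1 / r) * t) : Module.End ℂ 𝔤) (ν y) = ν ((f t : Module.End ℂ 𝔤) y)

/-- `x + ε δ(t)` (`ε² = 0`) is a first-order deformation of the constant transition operator `x`:
`δ` is holomorphic, `x + ε δ(t)` preserves the Lie bracket, and `δ(ωt) = ν δ(t) ν⁻¹`. -/
def IsDeformation (ν : 𝔤 ≃ₗ⁅ℂ⁆ 𝔤) (r : ℕ) (x : Module.End ℂ 𝔤)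
    (δ : ℂˣ → Module.End ℂ 𝔤) : Prop :=
  IsHolomorphic δ ∧ (∀ t a b, δ t ⁅a, b⁆ = ⁅δ t a, x b⁆ + ⁅x a, δ t b⁆) ∧
    ∀ t y, δ (e (1 / r) * t) (ν y) = ν (δ t y)

/-- To first order, `R = x + ε δ` is the gauge transform of `x` by `1 + ε 𝔵`:
`x + ε δ(t) = (1 - ε ad 𝔵(q̃t)) x (1 + ε ad 𝔵(t))` over the dual numbers. -/
def IsInfinitesimalGauge (q : ℂˣ) (x : Module.End ℂ 𝔤) (δ : ℂˣ → Module.End ℂ 𝔤)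
    (X : ℂˣ → 𝔤) : Prop :=
  ∀ t, (TrivSqZeroExt.inl x + TrivSqZeroExt.inr (δ t) : DualNumber (Module.End ℂ 𝔤)) =
    (1 - TrivSqZeroExt.inr (LieAlgebra.ad ℂ 𝔤 (X (q * t)))) * TrivSqZeroExt.inl x *
      (1 + TrivSqZeroExt.inr (LieAlgebra.ad ℂ 𝔤 (X t)))

/-- The infinitesimal gauge transformations fixing the transition operator `x`:
`Y(q̃t) = x (Y(t))`. -/
def stabilizer (ν : 𝔤 ≃ₗ⁅ℂ⁆ 𝔤) (r : ℕ) (q : ℂˣ) (x : Module.End ℂ 𝔤) :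
    Submodule ℂ (ℂˣ → 𝔤) where
  carrier := {Y | Y ∈ gaugeAlgebra ν r ∧ ∀ t, Y (q * t) = x (Y t)}
  add_mem' := fun ha hb => ⟨add_mem ha.1 hb.1, fun t => by simp [ha.2, hb.2]⟩
  zero_mem' := ⟨zero_mem _, fun t => by simp⟩
  smul_mem' := fun c _ ha => ⟨Submodule.smul_mem _ c ha.1, fun t => by simp [ha.2]⟩

/-- `u` is regular: if `ν X = ω^k X` and `e(ad u) X = q̃^k X` for some `k ∈ ℤ`, then `X ∈ 𝔥`. -/
def IsRegular (H : LieSubalgebra ℂ 𝔤) (ν : 𝔤 ≃ₗ⁅ℂ⁆ 𝔤) (r : ℕ) (q : ℂˣ) (u : 𝔤) : Prop :=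
  ∀ (k : ℤ) (X : 𝔤), ν X = ((e (1 / r) ^ k : ℂˣ) : ℂ) • X →
    (eAd u : Module.End ℂ 𝔤) X = ((q ^ k : ℂˣ) : ℂ) • X → X ∈ H

end Lie

end

end TwistedBundle

open scoped Real

namespace TwistedBundle

noncomputable section

open Complex Set Filter Topology MeasureTheory
open scoped BoundedContinuousFunction

/-! ### Laurent series on annuli, obtained from Fourier series on circles -/

section Laurent

/-! Write `q` for `q̃`. Since `ν` has finite order and `𝔥₀` acts semisimply, `𝔤` has a basis of
joint eigenvectors `b i` (`exists_eigenbasis`), on which `ν` acts by `w i` and `x = e(u)` by `l i`.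
Derivations of `𝔤` are inner, so a first-order deformation is `x ad Z` with `Z` in the gauge
algebra, and gauge equivalence becomes a linear equation in `𝔤`, which splits into scalar equations
`f(t) = ξ(t) - l⁻¹ ξ(qt)`. In Laurent coefficients this is `f_k = (1 - q^k l⁻¹) ξ_k`. As `|q| < 1`,
at most one `k` is resonant, `q^k = l`; there the coefficient of `f` survives as a monomial `c t^k`.
If `c ≠ 0`, the twist forces `ω^k = w`, so that `t^k b i` lies in the stabilizer of `x`. Conversely
a stabilizer element has only resonant coefficients, hence is never a nonzero difference. This gives
the finite-dimensional complement (`exists_gauge_solution`, `stabilizer_eq_zero_of_gauge`). For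
regular `u` a resonant `b i` lies in `𝔥`, where `x` acts trivially; so `l = 1`, `k = 0`, `w = 1`,
and only a constant in `𝔥₀` survives.

Near a regular `x` the nonlinear equation is solved in Banach spaces of bounded holomorphic
functions (`exists_gauge_near`). Its linearisation is the same difference operator plus constants.
Division by `1 - q^k l⁻¹` produces a solution on an annulus large enough to contain both `t` and
`qt`, so the derivative is surjective without loss of domain and the map is open. The unknowns are
`𝔤`-valued while the equation lives in the automorphisms; a linear projection `End 𝔤 → 𝔤` that is
injective on automorphisms near `1` (`exists_forall_preservesBracket_eq`) bridges the gap. The local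
solution `f = exp (ad Y)` covers a fundamental domain of `t ↦ qt`, and `f(t) = e(u')⁻¹ f(qt) R(t)`
extends it to `ℂ^*` (`exists_quasiperiodic_extension`).

Irregular `u` lie on countably many hyperplanes `m i (u) = kζ + p` with `q = e(ζ)`, `k, p ∈ ℤ` and
`m i ≠ 0` the weight of `b i`. Vectors of weight zero do no harm: they centralize `𝔥₀`, which
contains an element with all simple roots equal to `1`, so they lie in `𝔥`. -/

instance factTwoPiPos : Fact (0 < 2 * π) := ⟨Real.two_pi_pos⟩

/-- The restriction of `f` to the circle of radius `s`. -/
def onCircle (f : ℂ → ℂ) (s : ℝ) (x : AddCircle (2 * π)) : ℂ :=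
  f (s * (AddCircle.toCircle x : ℂ))

theorem norm_smul_toCircle {s : ℝ} (hs : 0 < s) (x : AddCircle (2 * π)) :
    ‖(s * (AddCircle.toCircle x : ℂ) : ℂ)‖ = s := by
  rw [norm_mul, Circle.norm_coe, mul_one, Complex.norm_real, Real.norm_of_nonneg hs.le]

theorem fourier_eq_toCircle_zpow (n : ℤ) (x : AddCircle (2 * π)) :
    fourier n x = (AddCircle.toCircle x : ℂ) ^ n := by
  rw [fourier_apply, AddCircle.toCircle_zsmul, Circle.coe_zpow]

/-- The `k`-th Laurent coefficient of `f`, computed on the circle of radius `s`. -/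
def laurentCoeff (f : ℂ → ℂ) (s : ℝ) (k : ℤ) : ℂ :=
  (s : ℂ) ^ (-k) * fourierCoeff (onCircle f s) k

theorem laurentCoeff_eq_circleIntegral (f : ℂ → ℂ) {s : ℝ} (hs : 0 < s) (k : ℤ) :
    laurentCoeff f s k =
      (2 * π * I)⁻¹ * ∮ z in C(0, s), (z - 0)⁻¹ • (z ^ (-k) * f z) := by
  have hs' : (s : ℂ) ≠ 0 := by exact_mod_cast hs.ne'
  rw [laurentCoeff, fourierCoeff_eq_intervalIntegral _ _ 0, circleIntegral, zero_add,
    ← intervalIntegral.integral_smul, ← intervalIntegral.integral_const_mul,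
    ← intervalIntegral.integral_const_mul]
  refine intervalIntegral.integral_congr fun θ _ => ?_
  have h1 : (fourier (-k) (θ : AddCircle (2 * π)) : ℂ) = exp (θ * I) ^ (-k) := by
    rw [fourier_eq_toCircle_zpow, AddCircle.toCircle_apply_mk, Circle.coe_exp]
    congr 2
    have : (π : ℂ) ≠ 0 := by exact_mod_cast Real.pi_ne_zero
    push_cast
    field_simp
  have h2 : onCircle f s (θ : AddCircle (2 * π)) = f (circleMap 0 s θ) := by
    rw [onCircle, AddCircle.toCircle_apply_mk, Circle.coe_exp, circleMap_zero]
    congr 3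
    have : (π : ℂ) ≠ 0 := by exact_mod_cast Real.pi_ne_zero
    push_cast
    field_simp
  have hpi : (π : ℂ) ≠ 0 := by exact_mod_cast Real.pi_ne_zero
  have he : exp (θ * I) ≠ 0 := exp_ne_zero _
  simp only [h1, h2, deriv_circleMap, sub_zero, smul_eq_mul, Complex.real_smul]
  rw [circleMap_zero, mul_zpow]
  push_cast
  field_simp

variable {J : Set ℝ}

/-- The integrand `z^(-k-1) f(z)` is holomorphic between the two circles, so Cauchy's theorem on the
annulus applies. Order-connectedness of `J` keeps the intermediate circles in the domain. -/
theorem laurentCoeff_eq (hJ : J.OrdConnected) (hJ0 : J ⊆ Ioi 0) {f : ℂ → ℂ}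
    (hJo : IsOpen J)
    (hf : DifferentiableOn ℂ f {t | ‖t‖ ∈ J}) {s s' : ℝ} (hs : s ∈ J) (hs' : s' ∈ J) (k : ℤ) :
    laurentCoeff f s k = laurentCoeff f s' k := by
  wlog hle : s ≤ s' generalizing s s'
  · exact (this hs' hs (le_of_not_ge hle)).symm
  have hopen : IsOpen {t : ℂ | ‖t‖ ∈ J} := hJo.preimage continuous_norm
  rw [laurentCoeff_eq_circleIntegral f (hJ0 hs), laurentCoeff_eq_circleIntegral f (hJ0 hs')]
  have hd : ∀ z : ℂ, s ≤ ‖z‖ → ‖z‖ ≤ s' →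
      DifferentiableAt ℂ (fun z => z ^ (-k) * f z) z := fun z h1 h2 => by
    have hz : ‖z‖ ∈ J := hJ.out hs hs' ⟨h1, h2⟩
    refine DifferentiableAt.mul ?_ ((hf z hz).differentiableAt (hopen.mem_nhds hz))
    exact differentiableAt_id.zpow (Or.inl (norm_pos_iff.1 (hJ0 hz)))
  congr 1
  refine (circleIntegral_sub_center_inv_smul_eq_of_differentiable_on_annulus_off_countable
    (hJ0 hs) hle countable_empty (fun z hz => ?_) fun z hz => ?_).symm
  · simp at hz
    exact (hd z hz.2 hz.1).continuousAt.continuousWithinAt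
  · simp at hz
    exact hd z hz.2.le hz.1.le

theorem continuous_onCircle {f : ℂ → ℂ} (hf : ContinuousOn f {t | ‖t‖ ∈ J}) {s : ℝ}
    (hs : s ∈ J) (h0 : 0 < s) : Continuous (onCircle f s) := by
  refine hf.comp_continuous (by fun_prop) fun x => ?_
  rw [mem_ofPred_eq, norm_smul_toCircle h0]
  exact hs

theorem exists_norm_fourierCoeff_le {g : AddCircle (2 * π) → ℂ} (hg : Continuous g) :
    ∃ M, ∀ k, ‖fourierCoeff g k‖ ≤ M := by
  obtain ⟨M, hM⟩ := (isCompact_range hg).isBounded.exists_norm_le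
  refine ⟨M, fun k => ?_⟩
  rw [fourierCoeff]
  refine (norm_integral_le_of_norm_le_const (C := M) (ae_of_all _ fun x => ?_)).trans ?_
  · rw [norm_smul, fourier_apply, Circle.norm_coe, one_mul]
    exact hM _ ⟨x, rfl⟩
  · simp

theorem summable_zpow_of_lt {a b : ℝ} (ha : 0 < a) (hab : a < 1) (hb : 1 < b) :
    Summable (fun k : ℤ => min (a ^ k) (b ^ k)) := by
  refine Summable.of_nat_of_neg ?_ ?_
  · refine Summable.of_nonneg_of_le (fun n => by positivity) (fun n => min_le_left _ _) ?_
    simpa using summable_geometric_of_lt_one ha.le hab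
  · refine Summable.of_nonneg_of_le (fun n => by positivity) (fun n => min_le_right _ _) ?_
    simpa using summable_geometric_of_lt_one (r := b⁻¹) (by positivity) (inv_lt_one_of_one_lt₀ hb)

/-- The coefficients do not depend on the radius, so they may be estimated on the neighbouring
circles `s ± d`. This bounds the terms by multiples of `(s / (s ± d))^k`; one ratio is below `1` and
the other above, which gives geometric decay in both directions. -/
theorem summable_laurentCoeff (hJ : J.OrdConnected) (hJ0 : J ⊆ Ioi 0) (hJo : IsOpen J)
    {f : ℂ → ℂ} (hf : DifferentiableOn ℂ f {t | ‖t‖ ∈ J}) {s₀ s : ℝ} (hs₀ : s₀ ∈ J)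
    (hs : s ∈ J) : Summable (fun k => ‖laurentCoeff f s₀ k‖ * s ^ k) := by
  have h0 : 0 < s := hJ0 hs
  obtain ⟨ε, hε, hεJ⟩ := Metric.isOpen_iff.1 hJo s hs
  set d := min (ε / 2) (s / 2) with hd
  have hd0 : 0 < d := by positivity
  have hds : d < s := (min_le_right _ _).trans_lt (by linarith)
  have h1 : s - d ∈ J := hεJ (by
    rw [Metric.mem_ball, Real.dist_eq, sub_sub_cancel_left, abs_neg, abs_of_pos hd0]
    exact (min_le_left _ _).trans_lt (by linarith))
  have h2 : s + d ∈ J := hεJ (by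
    rw [Metric.mem_ball, Real.dist_eq, add_sub_cancel_left, abs_of_pos hd0]
    exact (min_le_left _ _).trans_lt (by linarith))
  have key : ∀ s' ∈ J, ∃ M, 0 ≤ M ∧ ∀ k : ℤ, ‖laurentCoeff f s₀ k‖ * s ^ k ≤ M * (s / s') ^ k := by
    intro s' hs'
    obtain ⟨M, hM⟩ := exists_norm_fourierCoeff_le
      (continuous_onCircle hf.continuousOn hs' (hJ0 hs'))
    refine ⟨M, (norm_nonneg _).trans (hM 0), fun k => ?_⟩
    have hs0' : 0 < s' := hJ0 hs'
    rw [laurentCoeff_eq hJ hJ0 hJo hf hs₀ hs' k, laurentCoeff, norm_mul, norm_zpow,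
      Complex.norm_real, Real.norm_eq_abs, abs_of_pos hs0', div_zpow, zpow_neg]
    have := hM k
    have h3 : 0 < s' ^ k := zpow_pos hs0' _
    have h4 : 0 < s ^ k := zpow_pos h0 _
    rw [div_eq_mul_inv, mul_comm (s ^ k), ← mul_assoc, mul_comm _ (‖_‖)]
    gcongr
  obtain ⟨M₁, hM₁, hk₁⟩ := key _ h1
  obtain ⟨M₂, hM₂, hk₂⟩ := key _ h2
  refine Summable.of_nonneg_of_le (fun k => by positivity) (fun k => ?_)
    ((summable_zpow_of_lt (a := s / (s + d)) (b := s / (s - d)) (by positivity)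
      ((div_lt_one (by positivity)).2 (by linarith))
      ((one_lt_div (by linarith)).2 (by linarith))).mul_left (M₁ + M₂))
  have hp : 0 < s - d := by linarith
  have p1 : 0 < (s / (s - d)) ^ k := zpow_pos (by positivity) _
  have p2 : 0 < (s / (s + d)) ^ k := zpow_pos (by positivity) _
  rcases min_choice ((s / (s + d)) ^ k) ((s / (s - d)) ^ k) with h | h <;> rw [h, add_mul]
  · exact (hk₂ k).trans (le_add_of_nonneg_left (by positivity))
  · exact (hk₁ k).trans (le_add_of_nonneg_right (by positivity))

/-- A holomorphic function on an annulus is the sum of its Laurent series. -/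
theorem hasSum_laurentCoeff (hJ : J.OrdConnected) (hJ0 : J ⊆ Ioi 0) (hJo : IsOpen J)
    {f : ℂ → ℂ} (hf : DifferentiableOn ℂ f {t | ‖t‖ ∈ J}) {s₀ : ℝ} (hs₀ : s₀ ∈ J)
    {t : ℂ} (ht : ‖t‖ ∈ J) : HasSum (fun k : ℤ => laurentCoeff f s₀ k * t ^ k) (f t) := by
  have h0 : 0 < ‖t‖ := hJ0 ht
  have h0' : (‖t‖ : ℂ) ≠ 0 := by exact_mod_cast h0.ne'
  -- On the circle through `t` the Laurent series is the Fourier series of `g`, which converges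
  -- pointwise because its coefficients are summable.
  let g : C(AddCircle (2 * π), ℂ) :=
    ⟨onCircle f ‖t‖, continuous_onCircle hf.continuousOn ht h0⟩
  have hg : ∀ k, fourierCoeff g k = laurentCoeff f s₀ k * (‖t‖ : ℂ) ^ k := fun k => by
    rw [laurentCoeff_eq hJ hJ0 hJo hf hs₀ ht k, laurentCoeff, zpow_neg]
    have := zpow_ne_zero k h0'
    field_simp
    rfl
  have hsum : Summable (fourierCoeff g) := by
    refine Summable.of_norm ((summable_laurentCoeff hJ hJ0 hJo hf hs₀ ht).congr fun k => ?_)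
    rw [hg, norm_mul, norm_zpow]
    simp
  obtain ⟨θ, hθ⟩ : ∃ θ : ℝ, t = ‖t‖ * exp (θ * I) := ⟨t.arg, (norm_mul_exp_arg_mul_I t).symm⟩
  have hx : (AddCircle.toCircle (θ : AddCircle (2 * π)) : ℂ) = exp (θ * I) := by
    rw [AddCircle.toCircle_apply_mk, Circle.coe_exp]
    congr 2
    have : (π : ℂ) ≠ 0 := by exact_mod_cast Real.pi_ne_zero
    push_cast
    field_simp
  have := has_pointwise_sum_fourier_series_of_summable hsum (θ : AddCircle (2 * π))
  have hgt : g (θ : AddCircle (2 * π)) = f t := by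
    change f (‖t‖ * (AddCircle.toCircle _ : ℂ)) = f t
    rw [hx, ← hθ]
  rw [hgt] at this
  refine this.congr_fun fun k => ?_
  rw [hg, fourier_eq_toCircle_zpow, hx, smul_eq_mul, mul_assoc, ← mul_zpow, ← hθ]

/-- Convergence at `t = 1` already makes `c` absolutely summable, so the series may be integrated
termwise against a character, and orthogonality isolates `c m`. -/
theorem coeff_eq_fourierCoeff {c : ℤ → ℂ} {f : ℂ → ℂ}
    (h : ∀ t : ℂ, ‖t‖ = 1 → HasSum (fun k : ℤ => c k * t ^ k) (f t)) (m : ℤ) :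
    c m = fourierCoeff (fun x : AddCircle (2 * π) => f (AddCircle.toCircle x)) m := by
  have hc : Summable fun k => ‖c k‖ := by
    have := (h 1 (by simp)).summable.norm
    simpa using this
  have hint : ∀ k, ∫ x : AddCircle (2 * π), fourier (-m) x • (c k * fourier k x)
      ∂AddCircle.haarAddCircle = if k = m then c m else 0 := fun k => by
    have := congrFun (fourierCoeff_fourier (T := 2 * π) k) m
    rw [fourierCoeff] at this
    calc _ = c k * ∫ x : AddCircle (2 * π), fourier (-m) x • fourier k x
          ∂AddCircle.haarAddCircle := by
          rw [← integral_const_mul]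
          exact integral_congr_ae (ae_of_all _ fun x => by simp only [smul_eq_mul]; ring)
      _ = _ := by
          rw [this, Pi.single_apply]
          split_ifs with h1 h2 h2
          · rw [h1, mul_one]
          · exact absurd h1.symm h2
          · exact absurd h2.symm h1
          · rw [mul_zero]
  have hsum := hasSum_integral_of_summable_integral_norm
    (μ := AddCircle.haarAddCircle (T := 2 * π))
    (F := fun (k : ℤ) x => fourier (-m) x • (c k * fourier k x)) (fun k => by
      refine Continuous.integrable_of_hasCompactSupport (by fun_prop)
        (HasCompactSupport.of_compactSpace _)) (by
      refine hc.congr fun k => ?_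
      simp only [norm_smul, norm_mul, fourier_apply, Circle.norm_coe]
      simp)
  simp only [hint] at hsum
  have h1 := hsum.unique (hasSum_ite_eq m (c m))
  rw [← h1, fourierCoeff]
  refine integral_congr_ae (ae_of_all _ fun x => ?_)
  have h2 := (h (AddCircle.toCircle x) (Circle.norm_coe _)).mul_left (fourier (-m) x : ℂ)
  simp only [← fourier_eq_toCircle_zpow] at h2
  exact h2.tsum_eq

/-- For `s₁ < |t| < s₂` each `|t|^k` is at most `s₁^k + s₂^k`, whatever the sign of `k`, so the
series converges normally. -/
theorem differentiableAt_laurent {c : ℤ → ℂ} {t : ℂ} {s₁ s₂ : ℝ} (h0 : 0 < s₁)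
    (h1 : s₁ < ‖t‖) (h2 : ‖t‖ < s₂) (hs₁ : Summable fun k => ‖c k‖ * s₁ ^ k)
    (hs₂ : Summable fun k => ‖c k‖ * s₂ ^ k) :
    DifferentiableAt ℂ (fun t => ∑' k : ℤ, c k * t ^ k) t := by
  have hU : IsOpen {t : ℂ | ‖t‖ ∈ Ioo s₁ s₂} := isOpen_Ioo.preimage continuous_norm
  refine (differentiableOn_tsum_of_summable_norm (hs₁.add hs₂) (fun k z hz => ?_) hU
    fun k z hz => ?_ : DifferentiableOn ℂ _ {t : ℂ | ‖t‖ ∈ Ioo s₁ s₂}).differentiableAt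
      (hU.mem_nhds ⟨h1, h2⟩)
  · exact ((differentiableAt_id.zpow (Or.inl (norm_pos_iff.1 (h0.trans hz.1)))).const_mul
      _).differentiableWithinAt
  · have hz0 : 0 < ‖z‖ := h0.trans hz.1
    have hs2 : 0 < s₂ := hz0.trans hz.2
    rw [norm_mul, norm_zpow, ← mul_add]
    refine mul_le_mul_of_nonneg_left ?_ (norm_nonneg _)
    rcases le_total 0 k with hk | hk
    · exact (zpow_le_zpow_left₀ hk hz0.le hz.2.le).trans
        (le_add_of_nonneg_left (zpow_pos h0 _).le)
    · refine le_trans ?_ (le_add_of_nonneg_right (zpow_pos hs2 _).le)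
      rw [← inv_le_inv₀ (zpow_pos h0 _) (zpow_pos hz0 _), ← zpow_neg, ← zpow_neg]
      exact zpow_le_zpow_left₀ (by lia) h0.le hz.1.le

end Laurent

/-! ### The scalar equation `f(t) = ξ(t) - l⁻¹ ξ(qt)` -/

section DifferenceEquation

variable {J : Set ℝ} {q l : ℂ}

/-- The radii `s` with `‖q‖ s₂ ≤ s ≤ s₁` for some `s₁, s₂ ∈ J`. -/
def enlarge (q : ℂ) (J : Set ℝ) : Set ℝ :=
  {s | ∃ s₁ ∈ J, ∃ s₂ ∈ J, s ≤ s₁ ∧ ‖q‖ * s₂ ≤ s}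

/-- With `mul_mem_enlarge`: if `ξ` lives on the enlarged annulus, then `ξ(t)` and `ξ(qt)` both make
sense for `‖t‖ ∈ J`. -/
theorem subset_enlarge (hJ0 : J ⊆ Ioi 0) (hq1 : ‖q‖ < 1) : J ⊆ enlarge q J := fun s hs =>
  ⟨s, hs, s, hs, le_rfl, mul_le_of_le_one_left (le_of_lt (hJ0 hs)) hq1.le⟩

theorem mul_mem_enlarge (hJ0 : J ⊆ Ioi 0) (hq1 : ‖q‖ < 1) {t : ℂ} (ht : ‖t‖ ∈ J) :
    ‖q * t‖ ∈ enlarge q J := by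
  refine ⟨_, ht, _, ht, ?_, ?_⟩ <;> rw [norm_mul]
  exact mul_le_of_le_one_left (le_of_lt (hJ0 ht)) hq1.le

/-- The denominator tends to `1` as `k → ∞` and grows like `|q|^k` as `k → -∞`. A resonant index
needs no exception, since `0⁻¹ = 0`. -/
theorem exists_norm_inv_le (hq0 : q ≠ 0) (hq1 : ‖q‖ < 1) (hl : l ≠ 0) :
    ∃ C, 0 ≤ C ∧ (∀ k : ℤ, 0 ≤ k → ‖(1 - q ^ k * l⁻¹)⁻¹‖ ≤ C) ∧
      ∀ k : ℤ, k ≤ 0 → ‖(1 - q ^ k * l⁻¹)⁻¹‖ ≤ C * ‖q‖ ^ (-k) := by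
  have key : ∀ m : ℂ, ∃ C, ∀ n : ℕ, ‖(1 - q ^ n * m)⁻¹‖ ≤ C := fun m => by
    have h1 : Tendsto (fun n : ℕ => ‖(1 - q ^ n * m)⁻¹‖) atTop (𝓝 ‖(1 - 0 * m)⁻¹‖) :=
      (((tendsto_pow_atTop_nhds_zero_of_norm_lt_one hq1).mul_const m).const_sub 1
        |>.inv₀ (by simp)).norm
    obtain ⟨C, hC⟩ := h1.bddAbove_range
    exact ⟨C, fun n => hC ⟨n, rfl⟩⟩
  obtain ⟨C₁, h₁⟩ := key l⁻¹
  obtain ⟨C₂, h₂⟩ := key l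
  have hC1 : 0 ≤ C₁ := (norm_nonneg _).trans (h₁ 0)
  have hC2 : 0 ≤ C₂ := (norm_nonneg _).trans (h₂ 0)
  refine ⟨C₁ + C₂ * ‖l‖, by positivity, fun k hk => ?_, fun k hk => ?_⟩
  · lift k to ℕ using hk
    rw [zpow_natCast]
    exact (h₁ k).trans (le_add_of_nonneg_right (by positivity))
  · obtain ⟨n, rfl⟩ : ∃ n : ℕ, k = -n := ⟨k.natAbs, by omega⟩
    have hqn : q ^ n ≠ 0 := pow_ne_zero _ hq0
    have : (1 - q ^ (-(n : ℤ)) * l⁻¹)⁻¹ = -(1 - q ^ n * l)⁻¹ * l * q ^ n := by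
      rw [zpow_neg, zpow_natCast]
      have : 1 - (q ^ n)⁻¹ * l⁻¹ = -((1 - q ^ n * l) * (l⁻¹ * (q ^ n)⁻¹)) := by
        field_simp
        ring
      rw [this, inv_neg, mul_inv, mul_inv, inv_inv, inv_inv]
      ring
    rw [this, neg_neg, zpow_natCast, norm_mul, norm_mul, norm_neg, norm_pow]
    gcongr
    refine le_trans ?_ (le_add_of_nonneg_left hC1)
    gcongr
    exact h₂ n

/-- For `k ≥ 0` the division costs a constant, and `s ≤ s₁` suffices. For `k ≤ 0` it gains
`|q|^(-k)`, which compensates for `s` being as small as `|q| s₂`. -/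
theorem summable_enlarge (hq0 : q ≠ 0) (hq1 : ‖q‖ < 1) (hl : l ≠ 0) (hJ0 : J ⊆ Ioi 0)
    {c : ℤ → ℂ} (hc : ∀ s ∈ J, Summable fun k => ‖c k‖ * s ^ k) {s : ℝ}
    (hs : s ∈ enlarge q J) :
    Summable fun k : ℤ => ‖c k * (1 - q ^ k * l⁻¹)⁻¹‖ * s ^ k := by
  obtain ⟨s₁, h₁, s₂, h₂, hle₁, hle₂⟩ := hs
  obtain ⟨C, hC, hpos, hneg⟩ := exists_norm_inv_le hq0 hq1 hl
  have hqp : 0 < ‖q‖ := norm_pos_iff.2 hq0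
  have hs1 : 0 < s₁ := hJ0 h₁
  have hs2 : 0 < s₂ := hJ0 h₂
  have hs : 0 < s := lt_of_lt_of_le (by positivity) hle₂
  refine Summable.of_nonneg_of_le (fun k => by positivity) (fun k => ?_)
    (((hc s₁ h₁).add (hc s₂ h₂)).mul_left C)
  rw [norm_mul]
  have e1 : 0 < s₁ ^ k := zpow_pos hs1 _
  have e2 : 0 < s₂ ^ k := zpow_pos hs2 _
  have e0 : 0 < s ^ k := zpow_pos hs _
  rcases le_total 0 k with hk | hk
  · have : s ^ k ≤ s₁ ^ k := zpow_le_zpow_left₀ hk hs.le hle₁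
    calc _ ≤ ‖c k‖ * C * s₁ ^ k := by gcongr; exact hpos k hk
      _ ≤ _ := by
        rw [mul_add, mul_comm ‖c k‖, mul_assoc]
        exact le_add_of_nonneg_right (by positivity)
  · have : ‖q‖ ^ (-k) * s ^ k ≤ s₂ ^ k := by
      rw [zpow_neg, ← inv_zpow, ← mul_zpow, ← inv_le_inv₀ e2 (zpow_pos (by positivity) _),
        ← zpow_neg, ← zpow_neg]
      refine zpow_le_zpow_left₀ (by lia) hs2.le ?_
      rwa [le_inv_mul_iff₀ hqp]
    calc _ ≤ ‖c k‖ * (C * ‖q‖ ^ (-k)) * s ^ k := by gcongr; exact hneg k hk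
      _ = C * (‖c k‖ * (‖q‖ ^ (-k) * s ^ k)) := by ring
      _ ≤ C * (‖c k‖ * s₂ ^ k) := by gcongr
      _ ≤ _ := by
        rw [mul_add]
        exact le_add_of_nonneg_left (by positivity)

theorem coeff_unique {c d : ℤ → ℂ} {f : ℂ → ℂ}
    (hc : ∀ t : ℂ, ‖t‖ = 1 → HasSum (fun k : ℤ => c k * t ^ k) (f t))
    (hd : ∀ t : ℂ, ‖t‖ = 1 → HasSum (fun k : ℤ => d k * t ^ k) (f t)) : c = d :=
  funext fun k => (coeff_eq_fourierCoeff hc k).trans (coeff_eq_fourierCoeff hd k).symm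

theorem zpow_right_injective_of_norm_lt_one (hq0 : q ≠ 0) (hq1 : ‖q‖ < 1) {k m : ℤ}
    (h : q ^ k = q ^ m) : k = m := by
  have := congrArg norm h
  rw [norm_zpow, norm_zpow] at this
  exact zpow_right_injective₀ (norm_pos_iff.2 hq0) hq1.ne this

/-- If `f(ωt) = w f(t)`, its Laurent coefficients are supported on the `k` with `ω^k = w`. -/
theorem laurentCoeff_mul_zpow (hJ : J.OrdConnected) (hJ0 : J ⊆ Ioi 0) (hJo : IsOpen J)
    (h1 : (1 : ℝ) ∈ J) {f : ℂ → ℂ} (hf : DifferentiableOn ℂ f {t | ‖t‖ ∈ J}) {a w : ℂ}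
    (ha : ‖a‖ = 1) (hfa : ∀ t : ℂ, ‖t‖ ∈ J → f (a * t) = w * f t) (k : ℤ) :
    laurentCoeff f 1 k * a ^ k = w * laurentCoeff f 1 k := by
  refine congrFun (coeff_unique (c := fun k => laurentCoeff f 1 k * a ^ k)
    (d := fun k => w * laurentCoeff f 1 k) (f := fun t => f (a * t)) (fun t ht => ?_)
    fun t ht => ?_) k
  · have := hasSum_laurentCoeff hJ hJ0 hJo hf h1 (t := a * t)
      (by rw [norm_mul, ha, ht, mul_one]; exact h1)
    refine this.congr_fun fun k => ?_
    rw [mul_zpow, mul_assoc]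
  · rw [hfa t (ht ▸ h1)]
    refine ((hasSum_laurentCoeff hJ hJ0 hJo hf h1 (t := t) (ht ▸ h1)).mul_left w).congr_fun
      fun k => ?_
    rw [mul_assoc]

/-- The twisted difference equation `f(t) = ξ(t) - l⁻¹ ξ(qt)` is solvable up to a resonant
monomial. -/
theorem exists_difference_solution (hq0 : q ≠ 0) (hq1 : ‖q‖ < 1) (hl : l ≠ 0)
    (hJ : J.OrdConnected) (hJ0 : J ⊆ Ioi 0) (hJo : IsOpen J) (h1 : (1 : ℝ) ∈ J)
    {f : ℂ → ℂ} (hf : DifferentiableOn ℂ f {t | ‖t‖ ∈ J}) {a w : ℂ} (ha : ‖a‖ = 1)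
    (hfa : ∀ t : ℂ, ‖t‖ ∈ J → f (a * t) = w * f t) :
    ∃ (ξ : ℂ → ℂ) (c : ℂ) (k : ℤ), (c = 0 ∨ q ^ k = l ∧ a ^ k = w) ∧
      DifferentiableOn ℂ ξ {t | ‖t‖ ∈ enlarge q J} ∧
      (∀ t, ξ (a * t) = w * ξ t) ∧
      ∀ t, ‖t‖ ∈ J → f t = ξ t - l⁻¹ * ξ (q * t) + c * t ^ k := by
  set c := laurentCoeff f 1
  have hca : ∀ k, c k * a ^ k = w * c k := laurentCoeff_mul_zpow hJ hJ0 hJo h1 hf ha hfa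
  have hc : ∀ s ∈ J, Summable fun k => ‖c k‖ * s ^ k := fun s hs =>
    summable_laurentCoeff hJ hJ0 hJo hf h1 hs
  -- Comparison of coefficients forces this choice away from resonance. At a resonant index `0⁻¹ =
  -- 0` gives `d k = 0`, and `c k` is left over.
  set d : ℤ → ℂ := fun k => c k * (1 - q ^ k * l⁻¹)⁻¹ with hd
  have hds : ∀ s ∈ enlarge q J, Summable fun k => ‖d k‖ * s ^ k := fun s hs =>
    summable_enlarge hq0 hq1 hl hJ0 hc hs
  have hdt : ∀ t : ℂ, ‖t‖ ∈ enlarge q J → Summable fun k => d k * t ^ k := fun t ht => by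
    refine Summable.of_norm ((hds _ ht).congr fun k => ?_)
    rw [norm_mul (d k), norm_zpow]
  obtain ⟨k₀, hk₀⟩ : ∃ k₀ : ℤ, ∀ k, q ^ k = l → k = k₀ := by
    by_cases h : ∃ k₀ : ℤ, q ^ k₀ = l
    · obtain ⟨k₀, hk₀⟩ := h
      exact ⟨k₀, fun k hk => zpow_right_injective_of_norm_lt_one hq0 hq1 (hk.trans hk₀.symm)⟩
    · exact ⟨0, fun k hk => absurd ⟨k, hk⟩ h⟩
  refine ⟨fun t => ∑' k : ℤ, d k * t ^ k, if q ^ k₀ = l then c k₀ else 0, k₀, ?_, ?_, ?_, ?_⟩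
  · by_cases h : q ^ k₀ = l
    · rw [if_pos h]
      by_cases h0 : c k₀ = 0
      · exact Or.inl h0
      · refine Or.inr ⟨h, mul_left_cancel₀ h0 ?_⟩
        rw [hca, mul_comm]
    · exact Or.inl (if_neg h)
  · rintro t ⟨s₁, h₁, s₂, h₂, hle₁, hle₂⟩
    have hqp : 0 < ‖q‖ := norm_pos_iff.2 hq0
    -- Openness of `J` leaves room for radii strictly on either side of `‖t‖`.
    obtain ⟨ε, hε, hεJ⟩ := Metric.isOpen_iff.1 hJo s₁ h₁
    obtain ⟨ε', hε', hεJ'⟩ := Metric.isOpen_iff.1 hJo s₂ h₂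
    have m1 : s₁ + ε / 2 ∈ J := hεJ (by
      rw [Metric.mem_ball, Real.dist_eq, add_sub_cancel_left, abs_of_pos] <;> linarith)
    have m2 : s₂ - ε' / 2 ∈ J := hεJ' (by
      rw [Metric.mem_ball, Real.dist_eq, sub_sub_cancel_left, abs_neg, abs_of_pos] <;> linarith)
    have p2 : 0 < s₂ - ε' / 2 := hJ0 m2
    have lt2 : ‖q‖ * (s₂ - ε' / 2) < ‖t‖ :=
      lt_of_lt_of_le (mul_lt_mul_of_pos_left (by linarith) hqp) hle₂
    have lt1 : ‖t‖ < s₁ + ε / 2 := by linarith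
    exact (differentiableAt_laurent (by positivity) lt2 lt1
      (hds _ ⟨_, m1, _, m2, lt2.le.trans lt1.le, le_rfl⟩)
      (hds _ ⟨_, m1, _, m2, le_rfl, lt2.le.trans lt1.le⟩)).differentiableWithinAt
  · intro t
    dsimp only
    rw [← tsum_mul_left]
    refine tsum_congr fun k => ?_
    rw [mul_zpow, hd]
    linear_combination (1 - q ^ k * l⁻¹)⁻¹ * t ^ k * hca k
  · intro t ht
    have s1 := hasSum_laurentCoeff hJ hJ0 hJo hf h1 ht
    have s2 := (hdt t (subset_enlarge hJ0 hq1 ht)).hasSum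
    have s3 := (hdt (q * t) (mul_mem_enlarge hJ0 hq1 ht)).hasSum
    have s4 := hasSum_ite_eq k₀ ((if q ^ k₀ = l then c k₀ else 0) * t ^ k₀)
    refine s1.unique (((s2.sub (s3.mul_left l⁻¹)).add s4).congr_fun fun k => ?_)
    change c k * t ^ k = _
    by_cases h : q ^ k = l
    · obtain rfl := hk₀ k h
      simp [hd, h, hl]
    · have hne : 1 - q ^ k * l⁻¹ ≠ 0 := fun h' => h (by
        rw [sub_eq_zero, eq_comm, mul_inv_eq_one₀ hl] at h'
        exact h')
      have h5 : (if k = k₀ then (if q ^ k₀ = l then c k₀ else 0) * t ^ k₀ else 0) = 0 := by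
        split_ifs with e1 e2
        · exact absurd (e1 ▸ e2) h
        · rw [zero_mul]
        · rfl
      rw [h5, add_zero, mul_zpow]
      calc c k * t ^ k = c k * ((1 - q ^ k * l⁻¹) * (1 - q ^ k * l⁻¹)⁻¹) * t ^ k := by
            rw [mul_inv_cancel₀ hne, mul_one]
        _ = _ := by simp only [hd]; ring

/-- Uniqueness of the resonant part. -/
theorem eq_zero_of_difference {f ξ : ℂ → ℂ} (hq0 : q ≠ 0) (hl : l ≠ 0)
    (hf : DifferentiableOn ℂ f {0}ᶜ) (hξ : DifferentiableOn ℂ ξ {0}ᶜ)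
    (hfq : ∀ t, t ≠ 0 → f (q * t) = l * f t)
    (h : ∀ t, t ≠ 0 → f t = ξ t - l⁻¹ * ξ (q * t)) : ∀ t, t ≠ 0 → f t = 0 := by
  have hset : {t : ℂ | ‖t‖ ∈ Ioi (0 : ℝ)} = {0}ᶜ := by ext t; simp
  have F : ∀ g : ℂ → ℂ, DifferentiableOn ℂ g {0}ᶜ → ∀ t : ℂ, t ≠ 0 →
      HasSum (fun k : ℤ => laurentCoeff g 1 k * t ^ k) (g t) := fun g hg t ht =>
    hasSum_laurentCoeff ordConnected_Ioi subset_rfl isOpen_Ioi (hset ▸ hg)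
      (mem_Ioi.2 one_pos) (by simpa using ht)
  have ne : ∀ t : ℂ, ‖t‖ = 1 → t ≠ 0 := fun t ht h0 => by simp [h0] at ht
  have e1 := coeff_unique (c := fun k => laurentCoeff f 1 k * q ^ k)
    (d := fun k => l * laurentCoeff f 1 k) (f := fun t => f (q * t)) (fun t ht => by
      refine (F f hf (q * t) (mul_ne_zero hq0 (ne t ht))).congr_fun fun k => ?_
      rw [mul_zpow, mul_assoc]) (fun t ht => by
      rw [hfq t (ne t ht)]
      refine ((F f hf t (ne t ht)).mul_left l).congr_fun fun k => ?_
      rw [mul_assoc])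
  have e2 := coeff_unique (c := laurentCoeff f 1)
    (d := fun k => laurentCoeff ξ 1 k - l⁻¹ * (laurentCoeff ξ 1 k * q ^ k)) (f := f)
    (fun t ht => F f hf t (ne t ht)) (fun t ht => by
      rw [h t (ne t ht)]
      refine ((F ξ hξ t (ne t ht)).sub
        ((F ξ hξ (q * t) (mul_ne_zero hq0 (ne t ht))).mul_left l⁻¹)).congr_fun fun k => ?_
      rw [mul_zpow]
      ring)
  -- A nonzero coefficient forces `q^k = l` by quasi-periodicity; but then the `k`-th coefficient of
  -- the difference is `(1 - l⁻¹ q^k) ξ_k = 0`.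
  have e3 : ∀ k, laurentCoeff f 1 k = 0 := fun k => by
    by_contra hne
    have h1 : q ^ k = l := mul_left_cancel₀ hne ((congrFun e1 k).trans (mul_comm _ _))
    have h2 := congrFun e2 k
    rw [h1] at h2
    exact hne (h2.trans (by field_simp; ring))
  intro t ht
  have := F f hf t ht
  simp only [e3, zero_mul] at this
  exact this.unique hasSum_zero

/-- The functions `f` on `ℂ^*` with `f(qt) = l f(t)` form at most a line. -/
theorem eq_zero_of_quasiperiodic {f : ℂ → ℂ} (hq0 : q ≠ 0) (hq1 : ‖q‖ < 1)
    (hf : DifferentiableOn ℂ f {0}ᶜ) (hfq : ∀ t, t ≠ 0 → f (q * t) = l * f t)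
    (h1 : f 1 = 0) : ∀ t, t ≠ 0 → f t = 0 := by
  have hset : {t : ℂ | ‖t‖ ∈ Ioi (0 : ℝ)} = {0}ᶜ := by ext t; simp
  have F : ∀ t : ℂ, t ≠ 0 →
      HasSum (fun k : ℤ => laurentCoeff f 1 k * t ^ k) (f t) := fun t ht =>
    hasSum_laurentCoeff ordConnected_Ioi subset_rfl isOpen_Ioi (hset ▸ hf)
      (mem_Ioi.2 one_pos) (by simpa using ht)
  have ne : ∀ t : ℂ, ‖t‖ = 1 → t ≠ 0 := fun t ht h0 => by simp [h0] at ht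
  have e1 := coeff_unique (c := fun k => laurentCoeff f 1 k * q ^ k)
    (d := fun k => l * laurentCoeff f 1 k) (f := fun t => f (q * t)) (fun t ht => by
      refine (F (q * t) (mul_ne_zero hq0 (ne t ht))).congr_fun fun k => ?_
      rw [mul_zpow, mul_assoc]) (fun t ht => by
      rw [hfq t (ne t ht)]
      refine ((F t (ne t ht)).mul_left l).congr_fun fun k => ?_
      rw [mul_assoc])
  have e2 : ∀ k, laurentCoeff f 1 k ≠ 0 → q ^ k = l := fun k hne =>
    mul_left_cancel₀ hne ((congrFun e1 k).trans (mul_comm _ _))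
  -- Only one exponent can occur, so `f` is a monomial and `f 1` is its coefficient.
  have e3 : ∀ k, laurentCoeff f 1 k = 0 := fun k => by
    by_contra hne
    have h2 : ∀ m, m ≠ k → laurentCoeff f 1 m * (1 : ℂ) ^ m = 0 := fun m hm => by
      by_contra h3
      exact hm (zpow_right_injective_of_norm_lt_one hq0 hq1
        ((e2 m (left_ne_zero_of_mul h3)).trans (e2 k hne).symm))
    have h4 := (hasSum_single k h2).unique (F 1 one_ne_zero)
    rw [h1, one_zpow, mul_one] at h4
    exact hne h4
  intro t ht
  have := F t ht
  simp only [e3, zero_mul] at this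
  exact this.unique hasSum_zero

end DifferenceEquation

theorem exists_bilinear_bound {E F G : Type*} [NormedAddCommGroup E] [NormedSpace ℂ E]
    [FiniteDimensional ℂ E] [NormedAddCommGroup F] [NormedSpace ℂ F] [FiniteDimensional ℂ F]
    [NormedAddCommGroup G] [NormedSpace ℂ G] (β : E →ₗ[ℂ] F →ₗ[ℂ] G) :
    ∃ K, 0 ≤ K ∧ ∀ x y, ‖β x y‖ ≤ K * ‖x‖ * ‖y‖ :=
  ⟨‖β.toContinuousBilinearMap‖, ContinuousLinearMap.opNorm_nonneg _,
    fun x y => β.toContinuousBilinearMap.le_opNorm₂ x y⟩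

/-! ### `End V` as a Banach algebra, and its exponential -/

section ExpEnd

variable {V W : Type*} [AddCommGroup V] [Module ℂ V] [FiniteDimensional ℂ V]
  [AddCommGroup W] [Module ℂ W] [FiniteDimensional ℂ W]

/-- The matrices of endomorphisms in the basis used for `expEnd` and `size`. -/
def endMatrix (V : Type*) [AddCommGroup V] [Module ℂ V] [FiniteDimensional ℂ V] :
    Module.End ℂ V ≃ₐ[ℂ]
      Matrix (Fin (Module.finrank ℂ V)) (Fin (Module.finrank ℂ V)) ℂ :=
  LinearMap.toMatrixAlgEquiv (Module.finBasis ℂ V)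

attribute [local instance] Matrix.linftyOpNormedRing Matrix.linftyOpNormedAlgebra

/-- The maximal row sum norm is submultiplicative, which `size` need not be; `norm_le_size` and
`size_le_norm` compare the two. -/
instance endNormedRing : NormedRing (Module.End ℂ V) :=
  NormedRing.induced _ _ (endMatrix V) (endMatrix V).injective

instance endNormedAlgebra : NormedAlgebra ℂ (Module.End ℂ V) :=
  NormedAlgebra.induced ℂ _ _ (endMatrix V)

instance endNormedAlgebraRat : NormedAlgebra ℚ (Module.End ℂ V) := .restrictScalars ℚ ℂ _

instance endCompleteSpace : CompleteSpace (Module.End ℂ V) := FiniteDimensional.complete ℂ _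

theorem norm_end_def (A : Module.End ℂ V) : ‖A‖ = ‖endMatrix V A‖ := rfl

theorem norm_le_size (A : Module.End ℂ V) : ‖A‖ ≤ size A := by
  rw [norm_end_def, Matrix.linfty_opNorm_def]
  have h : ((Finset.univ.sup fun i => ∑ j, ‖endMatrix V A i j‖₊ : NNReal) : ℝ) ≤
      ((∑ i, ∑ j, ‖endMatrix V A i j‖₊ : NNReal) : ℝ) := by
    refine NNReal.coe_le_coe.2 (Finset.sup_le fun i _ => ?_)
    exact Finset.single_le_sum (f := fun i => ∑ j, ‖endMatrix V A i j‖₊)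
      (fun _ _ => zero_le) (Finset.mem_univ i)
  refine h.trans (le_of_eq ?_)
  push_cast
  rfl

theorem size_le_norm (A : Module.End ℂ V) : size A ≤ Module.finrank ℂ V * ‖A‖ := by
  have h : ∀ i, ∑ j, ‖endMatrix V A i j‖ ≤ ‖A‖ := fun i => by
    rw [norm_end_def, Matrix.linfty_opNorm_def]
    have := Finset.le_sup (f := fun i => ∑ j, ‖endMatrix V A i j‖₊) (Finset.mem_univ i)
    have h2 := NNReal.coe_le_coe.2 this
    push_cast at h2
    exact h2
  calc size A ≤ ∑ _i : Fin (Module.finrank ℂ V), ‖A‖ := Finset.sum_le_sum fun i _ => h i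
    _ = _ := by simp

theorem expEnd_eq (A : Module.End ℂ V) : expEnd A = NormedSpace.exp A := by
  have hc : Continuous (endMatrix V).symm :=
    LinearMap.continuous_of_finiteDimensional (endMatrix V).symm.toLinearMap
  have := NormedSpace.map_exp (endMatrix V).symm hc (endMatrix V A)
  rw [AlgEquiv.symm_apply_apply] at this
  exact this

theorem expEnd_add {A B : Module.End ℂ V} (h : Commute A B) :
    expEnd (A + B) = expEnd A * expEnd B := by
  simp only [expEnd_eq]
  exact NormedSpace.exp_add_of_commute h

theorem coe_expUnit (A : Module.End ℂ V) : (expUnit A : Module.End ℂ V) = expEnd A := rfl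

theorem coe_expUnit_inv (A : Module.End ℂ V) :
    ((expUnit A)⁻¹ : (Module.End ℂ V)ˣ) = expUnit (-A) := by
  ext1
  rfl

theorem hasSum_expEnd (A : Module.End ℂ V) (φ : Module.End ℂ V →ₗ[ℂ] ℂ) :
    HasSum (fun n : ℕ => ((n.factorial : ℂ)⁻¹) * φ (A ^ n)) (φ (expEnd A)) := by
  rw [expEnd_eq]
  have := (NormedSpace.exp_series_hasSum_exp' (𝕂 := ℂ) A).mapL φ.toContinuousLinearMap
  simpa using this

/-- Exponentials of intertwined endomorphisms are intertwined. -/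
theorem expEnd_intertwine {A : Module.End ℂ V} {B : Module.End ℂ W} (T : V →ₗ[ℂ] W)
    (h : ∀ v, T (A v) = B (T v)) (v : V) : T (expEnd A v) = expEnd B (T v) := by
  refine (Module.forall_dual_apply_eq_zero_iff ℂ _).1 (fun φ => ?_) |> sub_eq_zero.1
  rw [map_sub, sub_eq_zero]
  have hn : ∀ n : ℕ, T ((A ^ n) v) = (B ^ n) (T v) := fun n => by
    induction n with
    | zero => simp
    | succ n ih => rw [pow_succ', pow_succ', Module.End.mul_apply, Module.End.mul_apply, h, ih]
  have h1 := hasSum_expEnd A ((φ ∘ₗ T) ∘ₗ LinearMap.applyₗ v)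
  have h2 := hasSum_expEnd B (φ ∘ₗ LinearMap.applyₗ (T v))
  refine h1.unique (h2.congr_fun fun n => ?_)
  simp [hn]

theorem expEnd_eigenvector {A : Module.End ℂ V} {v : V} {m : ℂ} (h : A v = m • v) :
    expEnd A v = Complex.exp m • v := by
  refine (Module.forall_dual_apply_eq_zero_iff ℂ _).1 (fun φ => ?_) |> sub_eq_zero.1
  rw [map_sub, sub_eq_zero]
  have hn : ∀ n : ℕ, (A ^ n) v = m ^ n • v := fun n => by
    induction n with
    | zero => simp
    | succ n ih => rw [pow_succ', Module.End.mul_apply, ih, map_smul, h, smul_smul, pow_succ]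
  have h1 := hasSum_expEnd A (φ ∘ₗ LinearMap.applyₗ v)
  have h2 := (NormedSpace.exp_series_hasSum_exp' (𝕂 := ℂ) m).mul_right (φ v)
  rw [← Complex.exp_eq_exp_ℂ] at h2
  refine h1.unique ?_
  rw [map_smul, smul_eq_mul]
  refine h2.congr_fun fun n => ?_
  simp [hn, mul_assoc]

end ExpEnd

/-! ### Automorphisms of `𝔤` and the projection `End 𝔤 → 𝔤` -/

section LieExp

variable {𝔤 : Type*} [LieRing 𝔤] [LieAlgebra ℂ 𝔤]

open scoped TensorProduct

/-- An endomorphism preserving the bracket. -/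
def PreservesBracket (φ : Module.End ℂ 𝔤) : Prop := ∀ a b, φ ⁅a, b⁆ = ⁅φ a, φ b⁆

theorem PreservesBracket.mul {φ ψ : Module.End ℂ 𝔤} (h : PreservesBracket φ)
    (h' : PreservesBracket ψ) : PreservesBracket (φ * ψ) := fun a b => by
  rw [Module.End.mul_apply, Module.End.mul_apply, Module.End.mul_apply, h', h]

theorem PreservesBracket.inv {φ : (Module.End ℂ 𝔤)ˣ} (h : PreservesBracket (φ : Module.End ℂ 𝔤)) :
    PreservesBracket ((φ⁻¹ : (Module.End ℂ 𝔤)ˣ) : Module.End ℂ 𝔤) := fun a b => by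
  have e : ∀ c, (φ : Module.End ℂ 𝔤) (((φ⁻¹ : (Module.End ℂ 𝔤)ˣ) : Module.End ℂ 𝔤) c) = c := fun c => by
    rw [← Module.End.mul_apply, Units.mul_inv, Module.End.one_apply]
  have e' : ∀ c, ((φ⁻¹ : (Module.End ℂ 𝔤)ˣ) : Module.End ℂ 𝔤) ((φ : Module.End ℂ 𝔤) c) = c :=
    fun c => by rw [← Module.End.mul_apply, Units.inv_mul, Module.End.one_apply]
  conv_lhs => rw [← e a, ← e b]
  rw [← h, e']

variable [FiniteDimensional ℂ 𝔤]

/-- The Leibniz rule says that the bracket `𝔤 ⊗ 𝔤 → 𝔤` intertwines `D ⊗ 1 + 1 ⊗ D` with `D`.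
Intertwining passes to exponentials, and the two commuting summands exponentiate to `exp D ⊗ exp D`.
-/
theorem expEnd_preservesBracket {D : Module.End ℂ 𝔤} (hD : ∀ a b, D ⁅a, b⁆ = ⁅D a, b⁆ + ⁅a, D b⁆) :
    PreservesBracket (expEnd D) := fun a b => by
  let m : 𝔤 ⊗[ℂ] 𝔤 →ₗ[ℂ] 𝔤 := TensorProduct.lift (LieModule.toEnd ℂ 𝔤 𝔤 : 𝔤 →ₗ[ℂ] 𝔤 →ₗ[ℂ] 𝔤)
  have hm : ∀ a b, m (a ⊗ₜ b) = ⁅a, b⁆ := fun a b => rfl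
  let D₁ : Module.End ℂ (𝔤 ⊗[ℂ] 𝔤) := D.rTensor 𝔤
  let D₂ : Module.End ℂ (𝔤 ⊗[ℂ] 𝔤) := D.lTensor 𝔤
  have hcomm : Commute D₁ D₂ := by
    refine TensorProduct.ext' fun a b => ?_
    simp [D₁, D₂]
  have h1 := expEnd_intertwine (A := D₁ + D₂) (B := D) m (fun v => by
    induction v with
    | zero => simp
    | tmul a b => simp [D₁, D₂, hm, hD]
    | add x y hx hy => rw [map_add, map_add, hx, hy, map_add, map_add]) (a ⊗ₜ b)
  have h2 := expEnd_intertwine (A := D) (B := D₁) ((TensorProduct.mk ℂ 𝔤 𝔤).flip (expEnd D b))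
    (fun v => by simp [D₁]) a
  have h3 := expEnd_intertwine (A := D) (B := D₂) (TensorProduct.mk ℂ 𝔤 𝔤 a)
    (fun v => by simp [D₂]) b
  simp only [LinearMap.flip_apply, TensorProduct.mk_apply] at h2 h3
  rw [hm, expEnd_add hcomm, Module.End.mul_apply, ← h3, ← h2, hm] at h1
  exact h1.symm

theorem expEnd_ad_preservesBracket (y : 𝔤) :
    PreservesBracket (expEnd (LieAlgebra.ad ℂ 𝔤 y)) :=
  expEnd_preservesBracket fun a b => by simp [LieAlgebra.ad_apply]

theorem PreservesBracket.of_mem_adjointGroup {φ : (Module.End ℂ 𝔤)ˣ} (h : φ ∈ adjointGroup 𝔤) :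
    PreservesBracket (φ : Module.End ℂ 𝔤) := by
  induction h using Subgroup.closure_induction with
  | mem x hx =>
    obtain ⟨y, rfl⟩ := hx
    exact expEnd_ad_preservesBracket y
  | one => exact fun a b => rfl
  | mul x y _ _ hx hy => exact hx.mul hy
  | inv x _ hx => exact hx.inv

theorem eAd_eq (u : 𝔤) :
    eAd u = expUnit (LieAlgebra.ad ℂ 𝔤 ((2 * π * I) • u)) := by
  rw [eAd, map_smul]

theorem expUnit_ad_mem_adjointGroup (y : 𝔤) :
    expUnit (LieAlgebra.ad ℂ 𝔤 y) ∈ adjointGroup 𝔤 :=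
  Subgroup.subset_closure ⟨y, rfl⟩

theorem eAd_mem_adjointGroup (u : 𝔤) : eAd u ∈ adjointGroup 𝔤 := by
  rw [eAd_eq]
  exact expUnit_ad_mem_adjointGroup _

/-- Conjugation of `exp (ad y)` by an endomorphism preserving the bracket. -/
theorem expEnd_ad_conj {φ : Module.End ℂ 𝔤} (h : PreservesBracket φ) (y z : 𝔤) :
    φ (expEnd (LieAlgebra.ad ℂ 𝔤 y) z) = expEnd (LieAlgebra.ad ℂ 𝔤 (φ y)) (φ z) :=
  expEnd_intertwine φ (fun v => h y v) z

theorem eAd_add_of_lie_eq_zero {u v : 𝔤} (h : ⁅u, v⁆ = 0) :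
    (eAd (u + v) : Module.End ℂ 𝔤) =
      (eAd u : Module.End ℂ 𝔤) * (eAd v : Module.End ℂ 𝔤) := by
  rw [eAd, eAd, eAd, coe_expUnit, coe_expUnit, coe_expUnit, map_add, smul_add, expEnd_add]
  refine Commute.smul_left (Commute.smul_right ?_ _) _
  refine LinearMap.ext fun a => ?_
  simp only [Module.End.mul_apply, LieAlgebra.ad_apply]
  rw [leibniz_lie, h, zero_lie, zero_add]

/-- The adjoint representation as a linear map. -/
def adLin (𝔤 : Type*) [LieRing 𝔤] [LieAlgebra ℂ 𝔤] : 𝔤 →ₗ[ℂ] Module.End ℂ 𝔤 :=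
  (LieAlgebra.ad ℂ 𝔤 : 𝔤 →ₗ[ℂ] Module.End ℂ 𝔤)

variable [LieAlgebra.IsKilling ℂ 𝔤]

theorem ad_injective : Function.Injective (LieAlgebra.ad ℂ 𝔤) := fun x y hxy => by
  refine sub_eq_zero.1 ?_
  have h : x - y ∈ LieAlgebra.center ℂ 𝔤 := (LieModule.mem_maxTrivSubmodule ℂ 𝔤 𝔤 _).2 fun z => by
    rw [← lie_skew, sub_lie, neg_eq_zero, sub_eq_zero]
    exact LinearMap.congr_fun hxy z
  simpa using h

theorem exists_ad_eq {D : Module.End ℂ 𝔤} (hD : ∀ a b, D ⁅a, b⁆ = ⁅D a, b⁆ + ⁅a, D b⁆) :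
    ∃ y, LieAlgebra.ad ℂ 𝔤 y = D := by
  obtain ⟨y, hy⟩ := LieDerivation.IsKilling.exists_eq_ad
    ({ toLinearMap := D
       leibniz' := fun a b => by
        rw [hD, ← lie_skew b, sub_neg_eq_add, add_comm] } : LieDerivation ℂ 𝔤 𝔤)
  refine ⟨y, LinearMap.ext fun a => ?_⟩
  have := congrArg (fun E : LieDerivation ℂ 𝔤 𝔤 => E a) hy
  simpa using this

/-- The projection of `End 𝔤` onto `𝔤 ≅ ad 𝔤` which is orthogonal for the trace form. -/
def adProj (𝔤 : Type*) [LieRing 𝔤] [LieAlgebra ℂ 𝔤] [FiniteDimensional ℂ 𝔤]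
    [LieAlgebra.IsKilling ℂ 𝔤] : Module.End ℂ 𝔤 →ₗ[ℂ] 𝔤 :=
  ((killingForm ℂ 𝔤).toDual
    (LieAlgebra.IsKilling.killingForm_nondegenerate ℂ 𝔤)).symm.toLinearMap ∘ₗ
    ((LinearMap.mul ℂ (Module.End ℂ 𝔤)).compr₂ (LinearMap.trace ℂ 𝔤)).compl₂
      (adLin 𝔤)

theorem killingForm_adProj (φ : Module.End ℂ 𝔤) (y : 𝔤) :
    killingForm ℂ 𝔤 (adProj 𝔤 φ) y = LinearMap.trace ℂ 𝔤 (φ * LieAlgebra.ad ℂ 𝔤 y) := by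
  rw [adProj]
  exact LinearMap.BilinForm.apply_toDual_symm_apply
    (hB := LieAlgebra.IsKilling.killingForm_nondegenerate ℂ 𝔤) _ _

theorem adProj_eq_iff {φ : Module.End ℂ 𝔤} {x : 𝔤} :
    adProj 𝔤 φ = x ↔
      ∀ y, killingForm ℂ 𝔤 x y = LinearMap.trace ℂ 𝔤 (φ * LieAlgebra.ad ℂ 𝔤 y) := by
  refine ⟨?_, fun h => ?_⟩
  · rintro rfl y
    exact killingForm_adProj φ y
  · have := (LieAlgebra.IsKilling.killingForm_nondegenerate ℂ 𝔤).1 (adProj 𝔤 φ - x) fun y => by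
      rw [map_sub, LinearMap.sub_apply, killingForm_adProj, h, sub_self]
    exact sub_eq_zero.1 this

theorem adProj_ad (x : 𝔤) : adProj 𝔤 (LieAlgebra.ad ℂ 𝔤 x) = x :=
  adProj_eq_iff.2 fun y => by rw [killingForm_apply_apply]; rfl

/-- Both the trace form and the Killing form are invariant under automorphisms. -/
theorem adProj_conj (T : 𝔤 ≃ₗ⁅ℂ⁆ 𝔤) {φ ψ : Module.End ℂ 𝔤} (h : ∀ y, ψ (T y) = T (φ y)) :
    adProj 𝔤 ψ = T (adProj 𝔤 φ) := by
  refine adProj_eq_iff.2 fun y => ?_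
  obtain ⟨z, rfl⟩ := T.surjective y
  have e := LieAlgebra.killingForm_of_equiv_apply T (adProj 𝔤 φ) z
  rw [killingForm_adProj] at e
  refine e.trans ?_
  have : ψ * LieAlgebra.ad ℂ 𝔤 (T.toLieHom z) = T.toLinearEquiv.conj (φ * LieAlgebra.ad ℂ 𝔤 z) := by
    refine LinearMap.ext fun a => ?_
    obtain ⟨b, rfl⟩ := T.surjective a
    have e : T.toLinearEquiv.symm (T b) = b := T.toLinearEquiv.symm_apply_apply b
    rw [LinearEquiv.conj_apply_apply]
    change ψ ⁅T z, T b⁆ = T (φ ⁅z, T.toLinearEquiv.symm (T b)⁆)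
    rw [e, ← LieEquiv.map_lie, h]
  rw [this, LinearMap.trace_conj']

/-- Automorphisms near the identity are determined by their trace projection to `𝔤`. -/
theorem exists_forall_preservesBracket_eq (𝔤 : Type*) [LieRing 𝔤] [LieAlgebra ℂ 𝔤]
    [FiniteDimensional ℂ 𝔤] [LieAlgebra.IsKilling ℂ 𝔤] :
    ∃ ρ > 0, ∀ φ ψ : Module.End ℂ 𝔤, PreservesBracket φ → PreservesBracket ψ → ‖φ - 1‖ < ρ →
      ‖ψ - 1‖ < ρ → adProj 𝔤 φ = adProj 𝔤 ψ → φ = ψ := by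
  let br : 𝔤 →ₗ[ℂ] 𝔤 →ₗ[ℂ] 𝔤 := (LieModule.toEnd ℂ 𝔤 𝔤 : 𝔤 →ₗ[ℂ] Module.End ℂ 𝔤)
  have hbr : ∀ a b, br a b = ⁅a, b⁆ := fun _ _ => rfl
  let d : Module.End ℂ 𝔤 →ₗ[ℂ] 𝔤 →ₗ[ℂ] 𝔤 →ₗ[ℂ] 𝔤 :=
    LinearMap.mk₂' ℂ ℂ (fun A a => A ∘ₗ br a - br (A a) - br a ∘ₗ A)
      (fun A B a => by ext b; simp [hbr]; abel)
      (fun c A a => by ext b; simp [hbr, smul_sub])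
      (fun A a b => by ext c; simp [hbr]; abel)
      (fun c A a => by ext b; simp [hbr, smul_sub])
  have hd : ∀ A a b, d A a b = A ⁅a, b⁆ - ⁅A a, b⁆ - ⁅a, A b⁆ := fun _ _ _ => rfl
  -- `d A` measures the failure of `A` to be a derivation. If it vanishes then `A` is inner, and an
  -- inner derivation is determined by its projection.
  have hinj : LinearMap.ker ((adProj 𝔤).prod d) = ⊥ := by
    refine LinearMap.ker_eq_bot'.2 fun A hA => ?_
    obtain ⟨h1, h2⟩ := Prod.ext_iff.1 hA
    change adProj 𝔤 A = 0 at h1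
    change d A = 0 at h2
    obtain ⟨y, rfl⟩ := exists_ad_eq (D := A) fun a b => by
      have := congrArg (fun f => f a b) h2
      simp only [hd, LinearMap.zero_apply] at this
      rw [sub_sub, sub_eq_zero] at this
      exact this
    rw [adProj_ad] at h1
    rw [h1, map_zero]
  obtain ⟨T, hT⟩ := LinearMap.exists_leftInverse_of_injective _ hinj
  let Q : Module.End ℂ 𝔤 →ₗ[ℂ] Module.End ℂ 𝔤 →ₗ[ℂ] 𝔤 →ₗ[ℂ] 𝔤 →ₗ[ℂ] 𝔤 :=
    LinearMap.mk₂ ℂ (fun A B => br.compl₁₂ A B)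
      (fun A A' B => by ext a b; simp) (fun c A B => by ext a b; simp)
      (fun A B B' => by ext a b; simp) (fun c A B => by ext a b; simp)
  have hQ : ∀ A B a b, Q A B a b = ⁅A a, B b⁆ := fun _ _ _ _ => rfl
  let β₀ : Module.End ℂ 𝔤 →ₗ[ℂ] Module.End ℂ 𝔤 →ₗ[ℂ] Module.End ℂ 𝔤 :=
    Q.compr₂ (T ∘ₗ LinearMap.inr ℂ 𝔤 _)
  have hβ₀ : ∀ A B, β₀ A B = T (0, Q A B) := fun _ _ => rfl
  obtain ⟨K, hK, hβ⟩ := exists_bilinear_bound β₀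
  -- This radius makes `(K + 1)(‖φ - 1‖ + ‖ψ - 1‖) < 1`; `K + 1` replaces `K` because `K` may
  -- vanish.
  refine ⟨(2 * (K + 1))⁻¹, by positivity, fun φ ψ hφ hψ h1 h2 hP => ?_⟩
  -- For `φ = 1 + A`, multiplicativity says that `A` is a derivation up to the quadratic error `⁅A
  -- a, A b⁆`.
  have hdφ : ∀ φ : Module.End ℂ 𝔤, PreservesBracket φ → d (φ - 1) = Q (φ - 1) (φ - 1) :=
    fun φ hφ => by
      ext a b
      simp only [hd, hQ, LinearMap.sub_apply, Module.End.one_apply, hφ a b, sub_lie, lie_sub]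
      abel
  -- With equal projections, the left inverse `T` recovers `φ - ψ` from the difference of the
  -- quadratic errors, which is small compared with `φ - ψ` itself.
  have key : φ - ψ = β₀ (φ - ψ) (φ - 1) + β₀ (ψ - 1) (φ - ψ) := by
    have e1 : T (adProj 𝔤 (φ - ψ), d (φ - ψ)) = φ - ψ := LinearMap.congr_fun hT (φ - ψ)
    have e2 : d (φ - ψ) = Q (φ - ψ) (φ - 1) + Q (ψ - 1) (φ - ψ) := by
      have h0 : φ - ψ = (φ - 1) - (ψ - 1) := by abel
      rw [h0, map_sub, hdφ φ hφ, hdφ ψ hψ]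
      generalize φ - 1 = A
      generalize ψ - 1 = B
      rw [map_sub Q, LinearMap.sub_apply, map_sub (Q B)]
      abel
    rw [map_sub, hP, sub_self, e2] at e1
    rw [hβ₀, hβ₀, ← map_add, Prod.mk_add_mk, add_zero, e1]
  have h3 : ‖φ - ψ‖ ≤ K * ‖φ - ψ‖ * ‖φ - 1‖ + K * ‖ψ - 1‖ * ‖φ - ψ‖ := by
    conv_lhs => rw [key]
    exact (norm_add_le _ _).trans (add_le_add (hβ _ _) (hβ _ _))
  have h4 : (K + 1) * (‖φ - 1‖ + ‖ψ - 1‖) < 1 := by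
    rw [mul_inv] at h1 h2
    have : (K + 1) * (‖φ - 1‖ + ‖ψ - 1‖) <
        (K + 1) * (2⁻¹ * (K + 1)⁻¹ + 2⁻¹ * (K + 1)⁻¹) :=
      mul_lt_mul_of_pos_left (add_lt_add h1 h2) (by positivity)
    refine this.trans_eq ?_
    field_simp
    norm_num
  have h5 : ‖φ - ψ‖ = 0 := by
    by_contra hne
    have hpos : 0 < ‖φ - ψ‖ := lt_of_le_of_ne (norm_nonneg _) (Ne.symm hne)
    have h6 : 0 ≤ ‖φ - 1‖ + ‖ψ - 1‖ := by positivity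
    nlinarith [mul_lt_mul_of_pos_left h4 hpos, mul_nonneg hpos.le h6]
  exact sub_eq_zero.1 (norm_eq_zero.1 h5)

end LieExp

/-! ### Diagram automorphisms, the fixed Cartan subalgebra and its eigenbasis -/

section Diagram

variable {𝔤 ι : Type*} [LieRing 𝔤] [LieAlgebra ℂ 𝔤] [Finite ι] {H : LieSubalgebra ℂ 𝔤}
  {B : LieAlgebra.Basis ι H} {ν : 𝔤 ≃ₗ⁅ℂ⁆ 𝔤}

theorem lie_eq_zero_of_mem_cartan (B : LieAlgebra.Basis ι H) {a b : 𝔤} (ha : a ∈ H)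
    (hb : b ∈ H) : ⁅a, b⁆ = 0 := by
  have := B.isLieAbelian_cartan
  have h : ⁅(⟨a, ha⟩ : H), (⟨b, hb⟩ : H)⁆ = 0 := this.trivial _ _
  exact congrArg Subtype.val h

/-- A property of elements which is closed under the Lie algebra operations and holds for the
generators holds everywhere. -/
theorem eq_top_of_generators (B : LieAlgebra.Basis ι H) {K : LieSubalgebra ℂ 𝔤}
    (he : ∀ i, B.e i ∈ K) (hf : ∀ i, B.f i ∈ K) (x : 𝔤) : x ∈ K := by
  have h : LieSubalgebra.lieSpan ℂ 𝔤 (range B.e ∪ range B.f) ≤ K := by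
    refine LieSubalgebra.lieSpan_le.2 ?_
    rintro _ (⟨i, rfl⟩ | ⟨i, rfl⟩)
    exacts [he i, hf i]
  rw [B.span_ef] at h
  exact h (LieSubalgebra.mem_top x)

/-- If `σ^n = 1` then `ν^n` fixes the generators, and its fixed points form a subalgebra. Finite
order gives `r > 0` and the semisimplicity of `ν`. -/
theorem IsDiagramAutomorphism.isOfFinOrder (hν : IsDiagramAutomorphism B ν) :
    IsOfFinOrder ν.toLinearEquiv := by
  obtain ⟨σ, hσ⟩ := hν
  obtain ⟨n, hn, hσn⟩ := isOfFinOrder_iff_pow_eq_one.1 (isOfFinOrder_of_finite σ)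
  refine isOfFinOrder_iff_pow_eq_one.2 ⟨n, hn, ?_⟩
  have hcoe : ∀ x, (ν.toLinearEquiv ^ n) x = ν^[n] x := fun x => by
    rw [LinearEquiv.coe_pow]
    rfl
  have hlie : ∀ (n : ℕ) (x y : 𝔤), ν^[n] ⁅x, y⁆ = ⁅ν^[n] x, ν^[n] y⁆ := fun n => by
    induction n with
    | zero => exact fun x y => rfl
    | succ n ih =>
      intro x y
      rw [Function.iterate_succ_apply, LieEquiv.map_lie, ih]
      rfl
  have hgen : ∀ (n : ℕ) i, ν^[n] (B.e i) = B.e ((σ ^ n) i) ∧ ν^[n] (B.f i) = B.f ((σ ^ n) i) :=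
    fun n => by
      induction n with
      | zero => exact fun i => ⟨rfl, rfl⟩
      | succ n ih =>
        intro i
        rw [Function.iterate_succ_apply, Function.iterate_succ_apply, (hσ i).1, (hσ i).2,
          (ih _).1, (ih _).2, pow_succ, Equiv.Perm.mul_apply]
        exact ⟨rfl, rfl⟩
  let K : LieSubalgebra ℂ 𝔤 :=
    { carrier := {x | (ν.toLinearEquiv ^ n) x = x}
      add_mem' := fun {a b} ha hb => by
        rw [mem_ofPred_eq] at *
        rw [map_add, ha, hb]
      zero_mem' := map_zero _
      smul_mem' := fun c x hx => by
        rw [mem_ofPred_eq] at *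
        rw [map_smul, hx]
      lie_mem' := fun {a b} ha hb => by
        change (ν.toLinearEquiv ^ n) _ = _
        rw [hcoe, hlie, ← hcoe, ← hcoe]
        exact congrArg₂ _ ha hb }
  refine LinearEquiv.ext fun x => eq_top_of_generators B (K := K) (fun i => ?_) (fun i => ?_) x
  · change (ν.toLinearEquiv ^ n) _ = _
    rw [hcoe, (hgen n i).1, hσn, Equiv.Perm.one_apply]
  · change (ν.toLinearEquiv ^ n) _ = _
    rw [hcoe, (hgen n i).2, hσn, Equiv.Perm.one_apply]

variable [FiniteDimensional ℂ 𝔤] [LieAlgebra.IsKilling ℂ 𝔤]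

/-- The fixed Cartan subalgebra contains an element on which all simple roots equal `1`. -/
theorem IsDiagramAutomorphism.exists_principal (hν : IsDiagramAutomorphism B ν) :
    ∃ h ∈ fixedCartan H ν, ∀ i, ⁅h, B.e i⁆ = B.e i ∧ ⁅h, B.f i⁆ = -B.f i := by
  have := Fintype.ofFinite ι
  have hcard : Module.finrank ℂ H = Fintype.card ι := by
    have h1 := finrank_span_eq_card B.linInd
    rw [← B.coe_cartan_eq_span] at h1
    exact h1
  have hfd : Module.finrank ℂ (Module.Dual ℂ H) = Fintype.card ι := by
    rw [Subspace.dual_finrank_eq, hcard]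
  have hspan : ⊤ ≤ Submodule.span ℂ (range B.baseSupp) :=
    (B.linearIndependent_baseSupp.span_eq_top_of_card_eq_finrank' hfd.symm).ge
  let b := Module.Basis.mk B.linearIndependent_baseSupp hspan
  -- The simple roots form a basis of the dual of `H`, so their values can be prescribed.
  obtain ⟨h, hh⟩ : ∃ h : H, ∀ i, B.baseSupp i h = 1 := by
    obtain ⟨h, hh⟩ := (Module.evalEquiv ℂ H).surjective (b.constr ℂ fun _ => (1 : ℂ))
    refine ⟨h, fun i => ?_⟩
    have := congrArg (fun f => f (b i)) hh
    simp only [Module.evalEquiv_apply, Module.Basis.constr_basis] at this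
    rw [← this, Module.Basis.mk_apply]
    rfl
  have he : ∀ i, ⁅(h : 𝔤), B.e i⁆ = B.e i := fun i => by
    have := B.baseSupp_apply_smul_e i h
    rw [hh, one_smul] at this
    exact this.symm
  have hf : ∀ i, ⁅(h : 𝔤), B.f i⁆ = -B.f i := fun i => by
    have := B.baseSupp_apply_smul_f i h
    rw [hh, one_smul] at this
    exact (neg_eq_iff_eq_neg.2 this).symm
  refine ⟨h, ⟨h.2, ?_⟩, fun i => ⟨he i, hf i⟩⟩
  obtain ⟨σ, hσ⟩ := hν
  -- `σ` permutes generators of equal weight, so `ν h` and `h` act alike on the generators, hence on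
  -- `𝔤`; injectivity of `ad` then gives `ν h = h`.
  have key : ∀ x, ⁅ν h, x⁆ = ⁅(h : 𝔤), x⁆ := fun x => by
    let K : LieSubalgebra ℂ 𝔤 :=
      { carrier := {x | ⁅ν h, x⁆ = ⁅(h : 𝔤), x⁆}
        add_mem' := fun {a b} ha hb => by
          rw [mem_ofPred_eq] at *
          rw [lie_add, lie_add, ha, hb]
        zero_mem' := by simp
        smul_mem' := fun c x hx => by
          rw [mem_ofPred_eq] at *
          rw [lie_smul, lie_smul, hx]
        lie_mem' := fun {a b} ha hb => by
          change ⁅ν h, _⁆ = ⁅(h : 𝔤), _⁆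
          have ha' : ⁅ν h, a⁆ = ⁅(h : 𝔤), a⁆ := ha
          have hb' : ⁅ν h, b⁆ = ⁅(h : 𝔤), b⁆ := hb
          rw [leibniz_lie, ha', hb', ← leibniz_lie] }
    refine eq_top_of_generators B (K := K) (fun i => ?_) (fun i => ?_) x
    · change ⁅ν h, _⁆ = ⁅(h : 𝔤), _⁆
      obtain ⟨j, rfl⟩ := σ.surjective i
      rw [← (hσ j).1, ← LieEquiv.map_lie, he, (hσ j).1, he]
    · change ⁅ν h, _⁆ = ⁅(h : 𝔤), _⁆
      obtain ⟨j, rfl⟩ := σ.surjective i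
      rw [← (hσ j).2, ← LieEquiv.map_lie, hf, map_neg, (hσ j).2, hf]
  exact ad_injective (LinearMap.ext key)

/-- The centralizer of the fixed Cartan subalgebra is the Cartan subalgebra. -/
theorem IsDiagramAutomorphism.mem_cartan_of_centralizes (hν : IsDiagramAutomorphism B ν) {x : 𝔤}
    (hx : ∀ h ∈ fixedCartan H ν, ⁅h, x⁆ = 0) : x ∈ H := by
  obtain ⟨h, hh, hef⟩ := hν.exists_principal
  set D : Module.End ℂ 𝔤 := LieAlgebra.ad ℂ 𝔤 h
  have hD : ∀ y, D y = ⁅h, y⁆ := fun _ => rfl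
  set N : Submodule ℂ 𝔤 := ⨆ m : ℂ, ⨆ (_ : m ≠ 0), D.eigenspace m with hN
  -- Brackets add eigenvalues, so the algebra generated by eigenvectors for `c ≠ 0` has only the
  -- eigenvalues `c, 2c, 3c, …`, none of them zero. The index `n` stands for `(n + 1)c`, hence `n +
  -- m + 1` for a bracket.
  have hgrad : ∀ (s : Set 𝔤) (c : ℂ), c ≠ 0 → (∀ y ∈ s, D y = c • y) →
      ∀ y ∈ LieSubalgebra.lieSpan ℂ 𝔤 s, y ∈ N := by
    intro s c hc hs y hy
    suffices h' : y ∈ ⨆ n : ℕ, D.eigenspace ((n + 1 : ℕ) * c) by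
      refine (iSup_le fun n => ?_ : (⨆ n : ℕ, D.eigenspace ((n + 1 : ℕ) * c)) ≤ N) h'
      exact le_iSup₂ (f := fun (m : ℂ) (_ : m ≠ 0) => D.eigenspace m) _
        (mul_ne_zero (Nat.cast_ne_zero.2 n.succ_ne_zero) hc)
    induction hy using LieSubalgebra.lieSpan_induction with
    | mem u hu =>
      refine Submodule.mem_iSup_of_mem 0 (Module.End.mem_eigenspace_iff.2 ?_)
      rw [hs u hu]
      simp
    | zero => exact zero_mem _
    | add u v _ _ hu hv => exact add_mem hu hv
    | smul t u _ hu => exact Submodule.smul_mem _ t hu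
    | lie u v hu' hv' hu hv =>
      clear hu' hv'
      induction hu using Submodule.iSup_induction' with
      | zero => rw [zero_lie]; exact zero_mem _
      | add a b _ _ ha hb => rw [add_lie]; exact add_mem ha hb
      | mem n a ha =>
        induction hv using Submodule.iSup_induction' with
        | zero => rw [lie_zero]; exact zero_mem _
        | add b b' _ _ hb hb' => rw [lie_add]; exact add_mem hb hb'
        | mem m b hb =>
          refine Submodule.mem_iSup_of_mem (n + m + 1) (Module.End.mem_eigenspace_iff.2 ?_)
          rw [Module.End.mem_eigenspace_iff, hD] at ha hb
          rw [hD, leibniz_lie, ha, hb, smul_lie, lie_smul, ← add_smul]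
          push_cast
          ring_nf
  have hU := hgrad (range B.e) 1 one_ne_zero (by
    rintro _ ⟨i, rfl⟩
    rw [hD, (hef i).1, one_smul])
  have hL := hgrad (range B.f) (-1) (neg_ne_zero.2 one_ne_zero) (by
    rintro _ ⟨i, rfl⟩
    rw [hD, (hef i).2, neg_smul, one_smul])
  have htop := B.iSup_cartan_borelLower_borelUpper_eq_top
  have hx' : x ∈ iSup ![H.toLieSubmodule, B.borelLower, B.borelUpper] := by
    rw [htop]
    exact LieSubmodule.mem_top x
  -- Triangular decomposition: `h` kills `x` and the Cartan part `c`, hence also `l + u`, which lies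
  -- in the sum of the nonzero eigenspaces and so vanishes.
  obtain ⟨c, hc, l, hl, u, hu, rfl⟩ :
      ∃ᵉ (yc ∈ H) (yl ∈ LieSubalgebra.lieSpan ℂ 𝔤 (range B.f))
        (yu ∈ LieSubalgebra.lieSpan ℂ 𝔤 (range B.e)), yc + yl + yu = x := by
    simpa [LieSubmodule.mem_sup] using! hx'
  have h0 : l + u ∈ D.eigenspace 0 := by
    rw [Module.End.mem_eigenspace_iff, hD, zero_smul]
    have e1 := hx h hh
    rw [add_assoc, lie_add, lie_eq_zero_of_mem_cartan B hh.1 hc, zero_add] at e1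
    exact e1
  have h1 : l + u ∈ N := add_mem (hL l hl) (hU u hu)
  have h2 := Submodule.disjoint_def.1 (D.eigenspaces_iSupIndep 0) _ h0 h1
  rw [add_assoc, h2, add_zero]
  exact hc

/-- A joint eigenbasis of `𝔤` for `ν` and the fixed Cartan subalgebra. -/
theorem IsDiagramAutomorphism.exists_eigenbasis (hν : IsDiagramAutomorphism B ν) :
    ∃ (b : Module.Basis (Fin (Module.finrank ℂ 𝔤)) ℂ 𝔤) (w : Fin (Module.finrank ℂ 𝔤) → ℂ)
      (m : Fin (Module.finrank ℂ 𝔤) → fixedCartan H ν →ₗ[ℂ] ℂ),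
      (∀ i, ν (b i) = w i • b i) ∧ ∀ i (h : fixedCartan H ν), ⁅(h : 𝔤), b i⁆ = m i h • b i := by
  have := Fintype.ofFinite ι
  have := B.isCartanSubalgebra
  let f : Option (fixedCartan H ν) → Module.End ℂ 𝔤 := fun o =>
    o.elim ν.toLinearEquiv.toLinearMap fun h => LieAlgebra.ad ℂ 𝔤 (h : 𝔤)
  have hss : ∀ o, (f o).IsSemisimple := by
    rintro (_ | h)
    · obtain ⟨n, hn, h1⟩ := isOfFinOrder_iff_pow_eq_one.1 hν.isOfFinOrder
      refine Module.End.isSemisimple_of_squarefree_aeval_eq_zero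
        (Polynomial.separable_X_pow_sub_C (n := n) (1 : ℂ) (by exact_mod_cast hn.ne')
          one_ne_zero).squarefree ?_
      rw [map_sub, map_pow, Polynomial.aeval_X, Polynomial.aeval_C, map_one, sub_eq_zero]
      refine LinearMap.ext fun x => ?_
      have e := LinearEquiv.congr_fun h1 x
      rw [LinearEquiv.coe_pow] at e
      rw [Module.End.pow_apply]
      exact e
    · exact LieAlgebra.IsKilling.isSemisimple_ad_of_mem_isCartanSubalgebra h.2.1
  have hcomm : Pairwise fun i j => Commute (f i) (f j) := by
    rintro (_ | h) (_ | h') -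
    · exact Commute.refl _
    · refine LinearMap.ext fun x => ?_
      change ν ⁅(h' : 𝔤), x⁆ = ⁅(h' : 𝔤), ν x⁆
      rw [LieEquiv.map_lie, h'.2.2]
    · refine LinearMap.ext fun x => ?_
      change ⁅(h : 𝔤), ν x⁆ = ν ⁅(h : 𝔤), x⁆
      rw [LieEquiv.map_lie, h.2.2]
    · refine LinearMap.ext fun x => ?_
      change ⁅(h : 𝔤), ⁅(h' : 𝔤), x⁆⁆ = ⁅(h' : 𝔤), ⁅(h : 𝔤), x⁆⁆
      rw [leibniz_lie, lie_eq_zero_of_mem_cartan B h.2.1 h'.2.1, zero_lie, zero_add]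
  have hgen : ∀ o μ, (f o).maxGenEigenspace μ = (f o).eigenspace μ := fun o μ =>
    (hss o).isFinitelySemisimple.maxGenEigenspace_eq_eigenspace μ
  have htop := Module.End.iSup_iInf_maxGenEigenspace_eq_top_of_iSup_maxGenEigenspace_eq_top_of_commute
    f hcomm fun o => by
      simp only [hgen]
      exact (hss o).iSup_eigenspace_eq_top
  simp only [hgen] at htop
  -- The commuting semisimple family is simultaneously diagonalizable, so its joint eigenvectors
  -- span and a basis can be extracted from them.
  let s : Set 𝔤 := {x | ∀ o, ∃ μ : ℂ, f o x = μ • x}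
  have hs : ⊤ ≤ Submodule.span ℂ s := by
    rw [← htop]
    refine iSup_le fun χ x hx => Submodule.subset_span fun o => ⟨χ o, ?_⟩
    exact Module.End.mem_eigenspace_iff.1 (Submodule.mem_iInf _ |>.1 hx o)
  let b₀ := Module.Basis.ofSpan hs
  let b := b₀.reindex (b₀.indexEquiv (Module.finBasis ℂ 𝔤))
  have hb : ∀ i, b i ∈ s := fun i => Module.Basis.ofSpan_subset hs (by
    rw [Module.Basis.reindex_apply]
    exact mem_range_self _)
  have hb2 : ∀ i (h : fixedCartan H ν), ∃ μ : ℂ, ⁅(h : 𝔤), b i⁆ = μ • b i := fun i h => hb i (some h)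
  choose w hw using fun i => hb i none
  -- Taking the weight to be the `i`-th coordinate of `⁅h, b i⁆` makes it linear in `h` by
  -- construction.
  refine ⟨b, w, fun i => b.coord i ∘ₗ (adLin 𝔤).flip (b i) ∘ₗ (fixedCartan H ν).subtype,
    hw, fun i h => ?_⟩
  obtain ⟨μ, hμ⟩ := hb2 i h
  have : (b.coord i ∘ₗ (adLin 𝔤).flip (b i) ∘ₗ (fixedCartan H ν).subtype) h =
      b.repr ⁅(h : 𝔤), b i⁆ i := rfl
  rw [this, hμ]
  simp

end Diagram

/-! ### The moduli of `ω` and `q̃` -/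

section Parameters

theorem coe_e (z : ℂ) : (e z : ℂ) = Complex.exp (2 * π * I * z) := rfl

theorem norm_e_one_div (r : ℕ) : ‖(e (1 / r) : ℂ)‖ = 1 := by
  rw [coe_e, Complex.norm_exp]
  have : (2 * π * I * (1 / r) : ℂ) = ((2 * π * (1 / r) : ℝ) : ℂ) * I := by
    push_cast
    ring
  rw [this, Complex.re_ofReal_mul, Complex.I_re, mul_zero, Real.exp_zero]

theorem norm_e_div_lt_one {τ : ℂ} (hτ : 0 < τ.im) {r : ℕ} (hr : 0 < r) :
    ‖(e (τ / r) : ℂ)‖ < 1 := by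
  rw [coe_e, Complex.norm_exp, Real.exp_lt_one_iff]
  have : (2 * π * I * (τ / r) : ℂ) = ((2 * π / r : ℝ) : ℂ) * (I * τ) := by
    push_cast
    ring
  have hr' : (0 : ℝ) < r := by exact_mod_cast hr
  rw [this, Complex.re_ofReal_mul, Complex.I_mul_re, mul_neg, neg_lt_zero]
  positivity

end Parameters

/-! ### Holomorphic maps on `ℂ^*` in coordinates -/

section Holomorphic

variable {V W κ : Type*} [AddCommGroup V] [Module ℂ V] [AddCommGroup W] [Module ℂ W]

theorem IsHolomorphic.map {f : ℂˣ → V} (hf : IsHolomorphic f) (T : V →ₗ[ℂ] W) :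
    IsHolomorphic fun t => T (f t) := fun φ => hf (φ ∘ₗ T)

theorem isHolomorphic_sum [Fintype κ] (v : κ → V) {ξ : κ → ℂ → ℂ}
    (hξ : ∀ i, DifferentiableOn ℂ (ξ i) {0}ᶜ) :
    IsHolomorphic fun t : ℂˣ => ∑ i, ξ i t • v i := fun φ =>
  ⟨fun t => ∑ i, ξ i t * φ (v i), DifferentiableOn.fun_sum fun i _ => (hξ i).mul_const _,
    fun t => by simp⟩

theorem enlarge_Ioi {q : ℂ} (hq : q ≠ 0) : {t : ℂ | ‖t‖ ∈ enlarge q (Ioi 0)} = {0}ᶜ := by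
  have hq' : 0 < ‖q‖ := norm_pos_iff.2 hq
  ext t
  simp only [mem_ofPred_eq, mem_compl_iff, mem_singleton_iff]
  refine ⟨?_, fun ht => ?_⟩
  · rintro ⟨s₁, h₁, s₂, h₂, -, h⟩ rfl
    rw [norm_zero] at h
    exact absurd h (not_le.2 (mul_pos hq' h₂))
  · have ht' : 0 < ‖t‖ := norm_pos_iff.2 ht
    exact ⟨‖t‖, ht', ‖t‖ / ‖q‖, div_pos ht' hq', le_rfl, (mul_div_cancel₀ _ hq'.ne').le⟩

end Holomorphic

/-! ### The linearised gauge equation -/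

section FirstOrder

variable {𝔤 κ : Type*} [LieRing 𝔤] [LieAlgebra ℂ 𝔤]
  {ν : 𝔤 ≃ₗ⁅ℂ⁆ 𝔤} {r : ℕ} {q : ℂˣ} {x : Module.End ℂ 𝔤}
  {b : Module.Basis κ ℂ 𝔤} {w l : κ → ℂ}

theorem repr_map_of_eigen {T : 𝔤 →ₗ[ℂ] 𝔤} (h : ∀ i, T (b i) = w i • b i) (y : 𝔤) (i : κ) :
    b.repr (T y) i = w i * b.repr y i := by
  have : b.coord i ∘ₗ T = w i • b.coord i := b.ext fun j => by
    simp only [LinearMap.comp_apply, h, map_smul, LinearMap.smul_apply, Module.Basis.coord_apply,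
      Module.Basis.repr_self, smul_eq_mul]
    rcases eq_or_ne j i with rfl | h'
    · rfl
    · rw [Finsupp.single_eq_of_ne' h', mul_zero, mul_zero]
  exact LinearMap.congr_fun this y

/-- Coordinates of a gauge algebra element. -/
theorem exists_coordinates (hw : ∀ i, ν (b i) = w i • b i) {X : ℂˣ → 𝔤}
    (hX : X ∈ gaugeAlgebra ν r) : ∃ F : κ → ℂ → ℂ, (∀ i, DifferentiableOn ℂ (F i) {0}ᶜ) ∧
      (∀ i (t : ℂˣ), F i t = b.repr (X t) i) ∧
      ∀ i (t : ℂ), t ≠ 0 → F i (e (1 / r) * t) = w i * F i t := by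
  choose F hF hFX using fun i => hX.1 (b.coord i)
  refine ⟨F, hF, hFX, fun i t ht => ?_⟩
  have h1 := hFX i (e (1 / r) * Units.mk0 t ht)
  have h2 := hFX i (Units.mk0 t ht)
  rw [Units.val_mul, Units.val_mk0] at h1
  rw [Units.val_mk0] at h2
  rw [h1, h2, hX.2]
  exact repr_map_of_eigen (T := ν.toLinearEquiv.toLinearMap) hw _ i

/-- Uniqueness in first order: coordinatewise, a resonant function that is a difference vanishes
(`eq_zero_of_difference`). -/
theorem stabilizer_eq_zero_of_gauge (hw : ∀ i, ν (b i) = w i • b i)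
    (hl : ∀ i, x (b i) = l i • b i) (hl0 : ∀ i, l i ≠ 0) {Y X : ℂˣ → 𝔤}
    (hY : Y ∈ stabilizer ν r q x) (hX : X ∈ gaugeAlgebra ν r)
    (h : ∀ t, x (Y t) = x (X t) - X (q * t)) : Y = 0 := by
  obtain ⟨F, hF, hFY, -⟩ := exists_coordinates hw hY.1
  obtain ⟨G, hG, hGX, -⟩ := exists_coordinates hw hX
  have hq : ∀ t (ht : t ≠ 0), (q : ℂ) * t = ((q * Units.mk0 t ht : ℂˣ) : ℂ) := fun t ht => rfl
  have key : ∀ i t, t ≠ 0 → F i t = 0 := fun i => by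
    refine eq_zero_of_difference (q := q) (ξ := G i) q.ne_zero (hl0 i) (hF i) (hG i)
      (fun t ht => ?_) fun t ht => ?_
    · rw [hq t ht, hFY, hY.2, repr_map_of_eigen hl, ← hFY, Units.val_mk0]
    · have := congrArg (fun y => b.repr y i) (h (Units.mk0 t ht))
      simp only [map_sub, Finsupp.sub_apply, repr_map_of_eigen hl] at this
      rw [← hFY, ← hGX, ← hGX, ← hq t ht, Units.val_mk0] at this
      have h0 := hl0 i
      field_simp
      linear_combination this
  funext t
  refine b.ext_elem fun i => ?_
  rw [← hFY, key i t t.ne_zero]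
  simp

variable [Fintype κ]

theorem map_sum_of_eigen {T : 𝔤 →ₗ[ℂ] 𝔤} (h : ∀ i, T (b i) = w i • b i) (c : κ → ℂ) :
    T (∑ i, c i • b i) = ∑ i, (w i * c i) • b i := by
  rw [map_sum]
  refine Finset.sum_congr rfl fun i _ => ?_
  rw [map_smul, h, smul_smul, mul_comm]

/-- Existence in first order: the equation decouples in the eigenbasis. The conditions under which a
monomial survives are exactly those that put `t^k b i` into the stabilizer. -/
theorem exists_gauge_solution (hw : ∀ i, ν (b i) = w i • b i) (hl : ∀ i, x (b i) = l i • b i)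
    (hl0 : ∀ i, l i ≠ 0) (hq1 : ‖(q : ℂ)‖ < 1) {Z : ℂˣ → 𝔤} (hZ : Z ∈ gaugeAlgebra ν r) :
    ∃ (c : κ → ℂ) (k : κ → ℤ),
      (∀ i, c i = 0 ∨ (q : ℂ) ^ k i = l i ∧ (e (1 / r) : ℂ) ^ k i = w i) ∧
      (fun t : ℂˣ => ∑ i, (c i * (t : ℂ) ^ k i) • b i) ∈ stabilizer ν r q x ∧
      ∃ X ∈ gaugeAlgebra ν r, ∀ t,
        x (Z t - ∑ i, (c i * (t : ℂ) ^ k i) • b i) = x (X t) - X (q * t) := by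
  obtain ⟨F, hF, hFZ, hFe⟩ := exists_coordinates hw hZ
  have hset : {t : ℂ | ‖t‖ ∈ Ioi (0 : ℝ)} = {0}ᶜ := by ext t; simp
  have hsol := fun i => exists_difference_solution (q := q) (l := l i) (J := Ioi 0)
    q.ne_zero hq1 (hl0 i) ordConnected_Ioi subset_rfl isOpen_Ioi (mem_Ioi.2 one_pos)
    (f := F i) (hset ▸ hF i) (norm_e_one_div r) (fun t ht => hFe i t (by simpa using ht))
  choose ξ c k hck hξ hξe hsol using hsol
  refine ⟨c, k, hck, ⟨⟨isHolomorphic_sum b (ξ := fun i t => c i * t ^ k i) fun i => ?_,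
      fun t => ?_⟩, fun t => ?_⟩,
    fun t => ∑ i, ξ i t • b i, ⟨isHolomorphic_sum b fun i => ?_, fun t => ?_⟩, fun t => ?_⟩
  · exact fun t ht => ((differentiableAt_fun_id.zpow
      (Or.inl (show t ≠ 0 from ht))).const_mul _).differentiableWithinAt
  · refine Eq.trans ?_ (map_sum_of_eigen (T := ν.toLinearEquiv.toLinearMap) hw _).symm
    refine Finset.sum_congr rfl fun i _ => ?_
    rcases hck i with h | h
    · simp [h]
    · rw [Units.val_mul, mul_zpow, h.2]
      congr 1
      ring
  · refine Eq.trans ?_ (map_sum_of_eigen hl _).symm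
    refine Finset.sum_congr rfl fun i _ => ?_
    rcases hck i with h | h
    · simp [h]
    · rw [Units.val_mul, mul_zpow, h.1]
      congr 1
      ring
  · rw [← enlarge_Ioi q.ne_zero]
    exact hξ i
  · refine Eq.trans ?_ (map_sum_of_eigen (T := ν.toLinearEquiv.toLinearMap) hw _).symm
    refine Finset.sum_congr rfl fun i _ => ?_
    rw [Units.val_mul, hξe]
  · have hZt : Z t = ∑ i, F i t • b i := by
      simp only [hFZ]
      exact (b.sum_repr _).symm
    rw [hZt, ← Finset.sum_sub_distrib]
    simp only [← sub_smul]
    rw [map_sum_of_eigen hl, map_sum_of_eigen hl, ← Finset.sum_sub_distrib]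
    refine Finset.sum_congr rfl fun i _ => ?_
    rw [← sub_smul, hsol i t (by simp), Units.val_mul]
    congr 1
    have := hl0 i
    field_simp
    ring

/-- Evaluation at `1` embeds the stabilizer into `𝔤`, because each coordinate is quasi-periodic
(`eq_zero_of_quasiperiodic`). -/
theorem finiteDimensional_stabilizer (hw : ∀ i, ν (b i) = w i • b i)
    (hl : ∀ i, x (b i) = l i • b i) (hq1 : ‖(q : ℂ)‖ < 1) :
    FiniteDimensional ℂ (stabilizer ν r q x) := by
  have := Module.Finite.of_basis b
  let ev : stabilizer ν r q x →ₗ[ℂ] 𝔤 := LinearMap.proj 1 ∘ₗ (stabilizer ν r q x).subtype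
  refine FiniteDimensional.of_injective ev ((injective_iff_map_eq_zero ev).2 fun Y hY1 => ?_)
  obtain ⟨Y, hY⟩ := Y
  change Y 1 = 0 at hY1
  obtain ⟨F, hF, hFY, -⟩ := exists_coordinates hw hY.1
  refine Subtype.ext (funext fun t => b.ext_elem fun i => ?_)
  have key := eq_zero_of_quasiperiodic (q := q) (l := l i) (f := F i) q.ne_zero hq1 (hF i)
    (fun t ht => by
      have hq : (q : ℂ) * t = ((q * Units.mk0 t ht : ℂˣ) : ℂ) := rfl
      rw [hq, hFY, hY.2, repr_map_of_eigen hl, ← hFY, Units.val_mk0])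
    (by
      have := hFY i 1
      rw [Units.val_one] at this
      rw [this, hY1]
      simp) t t.ne_zero
  rw [hFY] at key
  rw [key]
  simp

theorem isInfinitesimalGauge_iff {δ : ℂˣ → Module.End ℂ 𝔤} {X : ℂˣ → 𝔤} :
    IsInfinitesimalGauge q x δ X ↔
      ∀ t, δ t = x * LieAlgebra.ad ℂ 𝔤 (X t) - LieAlgebra.ad ℂ 𝔤 (X (q * t)) * x := by
  refine forall_congr' fun t => ?_
  rw [TrivSqZeroExt.ext_iff]
  simp only [TrivSqZeroExt.fst_add, TrivSqZeroExt.fst_inl, TrivSqZeroExt.fst_inr, add_zero,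
    TrivSqZeroExt.fst_mul, TrivSqZeroExt.fst_sub, TrivSqZeroExt.fst_one, sub_zero, one_mul, mul_one,
    TrivSqZeroExt.snd_add, TrivSqZeroExt.snd_inl, TrivSqZeroExt.snd_inr, zero_add,
    TrivSqZeroExt.snd_mul, TrivSqZeroExt.snd_sub, TrivSqZeroExt.snd_one, zero_sub,
    MulOpposite.op_one, one_smul, true_and, smul_eq_mul, MulOpposite.smul_eq_mul_unop,
    MulOpposite.unop_op, smul_neg, ← sub_eq_add_neg]

theorem ad_sub_mul (y z : 𝔤) : x * LieAlgebra.ad ℂ 𝔤 y - x * LieAlgebra.ad ℂ 𝔤 z =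
    x * LieAlgebra.ad ℂ 𝔤 (y - z) := by rw [map_sub, mul_sub]

variable [FiniteDimensional ℂ 𝔤]

/-- Since `x` is an automorphism, `x ad y = ad (x y) x`; cancelling `x` and then `ad` turns an
equation in `End 𝔤` into one in `𝔤`. -/
theorem isInfinitesimalGauge_ad_iff [LieAlgebra.IsKilling ℂ 𝔤] (hx : PreservesBracket x)
    (hxu : IsUnit x) {V X : ℂˣ → 𝔤} :
    IsInfinitesimalGauge q x (fun t => x * LieAlgebra.ad ℂ 𝔤 (V t)) X ↔
      ∀ t, x (V t) = x (X t) - X (q * t) := by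
  have hconj : ∀ y, x * LieAlgebra.ad ℂ 𝔤 y = LieAlgebra.ad ℂ 𝔤 (x y) * x := fun y =>
    LinearMap.ext fun z => hx y z
  rw [isInfinitesimalGauge_iff]
  refine forall_congr' fun t => ?_
  rw [hconj, hconj, ← sub_mul, ← map_sub, hxu.mul_left_inj]
  exact ad_injective.eq_iff

/-- A first-order deformation of `x` is `x ad Z` for an element `Z` of the gauge algebra. -/
theorem IsDeformation.exists_eq [LieAlgebra.IsKilling ℂ 𝔤] {x : (Module.End ℂ 𝔤)ˣ}
    (hx : PreservesBracket (x : Module.End ℂ 𝔤))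
    (hxν : ∀ y, (x : Module.End ℂ 𝔤) (ν y) = ν ((x : Module.End ℂ 𝔤) y))
    {δ : ℂˣ → Module.End ℂ 𝔤} (hδ : IsDeformation ν r (x : Module.End ℂ 𝔤) δ) :
    ∃ Z ∈ gaugeAlgebra ν r, δ = fun t => (x : Module.End ℂ 𝔤) * LieAlgebra.ad ℂ 𝔤 (Z t) := by
  have hinv : ∀ y, ((x⁻¹ : (Module.End ℂ 𝔤)ˣ) : Module.End ℂ 𝔤) ((x : Module.End ℂ 𝔤) y) = y :=
    fun y => by rw [← Module.End.mul_apply, Units.inv_mul, Module.End.one_apply]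
  have hinv' : ∀ y, (x : Module.End ℂ 𝔤) (((x⁻¹ : (Module.End ℂ 𝔤)ˣ) : Module.End ℂ 𝔤) y) = y :=
    fun y => by rw [← Module.End.mul_apply, Units.mul_inv, Module.End.one_apply]
  have hinvν : ∀ y, ((x⁻¹ : (Module.End ℂ 𝔤)ˣ) : Module.End ℂ 𝔤) (ν y) =
      ν (((x⁻¹ : (Module.End ℂ 𝔤)ˣ) : Module.End ℂ 𝔤) y) := fun y => by
    conv_lhs => rw [← hinv' y, ← hxν, hinv]
  have hder : ∀ t, ∃ z, LieAlgebra.ad ℂ 𝔤 z =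
      ((x⁻¹ : (Module.End ℂ 𝔤)ˣ) : Module.End ℂ 𝔤) * δ t := fun t => by
    refine exists_ad_eq fun a c => ?_
    simp only [Module.End.mul_apply]
    rw [hδ.2.1, map_add, hx.inv, hx.inv, hinv, hinv]
  -- Pointwise, `x⁻¹ δ(t)` is an inner derivation. Reading it off by a linear map compatible with
  -- `ν` transfers holomorphy and the twist to `Z`.
  let T : Module.End ℂ 𝔤 →ₗ[ℂ] 𝔤 :=
    adProj 𝔤 ∘ₗ LinearMap.mulLeft ℂ ((x⁻¹ : (Module.End ℂ 𝔤)ˣ) : Module.End ℂ 𝔤)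
  have hT : ∀ φ, T φ = adProj 𝔤 (((x⁻¹ : (Module.End ℂ 𝔤)ˣ) : Module.End ℂ 𝔤) * φ) :=
    fun _ => rfl
  refine ⟨fun t => T (δ t), ⟨hδ.1.map T, fun t => ?_⟩, funext fun t => ?_⟩
  · change T _ = ν (T _)
    rw [hT, hT]
    refine adProj_conj ν fun y => ?_
    rw [Module.End.mul_apply, Module.End.mul_apply, hδ.2.2, hinvν]
  · obtain ⟨z, hz⟩ := hder t
    change _ = _ * LieAlgebra.ad ℂ 𝔤 (T (δ t))
    rw [hT, ← hz, adProj_ad, hz, ← mul_assoc, Units.mul_inv, one_mul]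

end FirstOrder

/-! ### Regular elements and the null set of irregular ones -/

section Regular

variable {𝔤 ι : Type*} [LieRing 𝔤] [LieAlgebra ℂ 𝔤] [Finite ι] {H : LieSubalgebra ℂ 𝔤}
  {B : LieAlgebra.Basis ι H} {ν : 𝔤 ≃ₗ⁅ℂ⁆ 𝔤} [FiniteDimensional ℂ 𝔤] {q : ℂˣ} {r : ℕ}

theorem eAd_eigenvector {u y : 𝔤} {m : ℂ} (h : ⁅u, y⁆ = m • y) :
    (eAd u : Module.End ℂ 𝔤) y = Complex.exp (2 * π * I * m) • y := by
  rw [eAd, coe_expUnit]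
  refine expEnd_eigenvector ?_
  rw [LinearMap.smul_apply, LieAlgebra.ad_apply, h, smul_smul]

theorem eAd_preservesBracket (u : 𝔤) : PreservesBracket (eAd u : Module.End ℂ 𝔤) :=
  .of_mem_adjointGroup (eAd_mem_adjointGroup u)

theorem eAd_comm {u : 𝔤} (hu : ν u = u) (y : 𝔤) :
    (eAd u : Module.End ℂ 𝔤) (ν y) = ν ((eAd u : Module.End ℂ 𝔤) y) := by
  rw [eAd_eq, coe_expUnit]
  have h := expEnd_ad_conj (φ := ν.toLinearEquiv.toLinearMap) (fun a b => LieEquiv.map_lie ν a b)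
    ((2 * π * I) • u) y
  have h2 : ν.toLinearEquiv.toLinearMap ((2 * π * I) • u) = (2 * π * I) • u := by
    rw [map_smul]
    exact congrArg _ hu
  rw [h2] at h
  exact h.symm

theorem eAd_eq_self_of_mem_cartan (B : LieAlgebra.Basis ι H) {u y : 𝔤} (hu : u ∈ H) (hy : y ∈ H) :
    (eAd u : Module.End ℂ 𝔤) y = y := by
  rw [eAd_eigenvector (m := 0) (by rw [lie_eq_zero_of_mem_cartan B hu hy, zero_smul])]
  simp

/-- For regular `u`, a resonant basis vector lies in `𝔥₀` and its exponent vanishes. -/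
theorem IsRegular.resonant (B : LieAlgebra.Basis ι H) {u : 𝔤} (hu : u ∈ fixedCartan H ν)
    (hreg : IsRegular H ν r q u) (hq1 : ‖(q : ℂ)‖ < 1) {y : 𝔤} (hy : y ≠ 0) {w l : ℂ} {k : ℤ}
    (hw : ν y = w • y) (hl : (eAd u : Module.End ℂ 𝔤) y = l • y) (hk : (q : ℂ) ^ k = l)
    (hk' : (e (1 / r) : ℂ) ^ k = w) : k = 0 ∧ y ∈ fixedCartan H ν := by
  have hyH : y ∈ H := hreg k y (by rw [hw, ← hk', Units.val_zpow_eq_zpow_val])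
    (by rw [hl, ← hk, Units.val_zpow_eq_zpow_val])
  have h1 := eAd_eq_self_of_mem_cartan B hu.1 hyH
  rw [hl] at h1
  have hl1 : l = 1 := by
    refine smul_left_injective ℂ hy ?_
    simpa using h1
  have hk0 : k = 0 := zpow_right_injective_of_norm_lt_one q.ne_zero hq1 (by rw [hk, hl1, zpow_zero])
  refine ⟨hk0, hyH, ?_⟩
  rw [hw, ← hk', hk0, zpow_zero, one_smul]

theorem volume_hyperplane_eq_zero {n : ℕ} (L : (Fin n → ℂ) →ₗ[ℂ] ℂ) (hL : L ≠ 0) (z : ℂ) :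
    volume {c : Fin n → ℂ | L c = z} = 0 := by
  obtain ⟨v, hv⟩ : ∃ v, L v ≠ 0 := by
    by_contra! h
    exact hL (LinearMap.ext h)
  let A : AffineSubspace ℝ (Fin n → ℂ) :=
    { carrier := {c | L c = z}
      smul_vsub_vadd_mem' := fun c p₁ p₂ p₃ h₁ h₂ h₃ => by
        change L (c • (p₁ - p₂) + p₃) = z
        have : (c • (p₁ - p₂) : Fin n → ℂ) = (c : ℂ) • (p₁ - p₂) := rfl
        rw [this, map_add, map_smul, map_sub, h₁, h₂, h₃, sub_self, smul_zero, zero_add] }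
  refine Measure.addHaar_affineSubspace volume A fun htop => ?_
  have hmem : ∀ c, L c = z := fun c => by
    have : c ∈ A := htop ▸ AffineSubspace.mem_top ℝ _ c
    exact this
  have h0 := hmem 0
  rw [map_zero] at h0
  exact hv ((hmem v).trans h0.symm)

/-- If `X` has a nonzero component along `b i`, then `e(m i (u)) = q^k = e(kζ)`, that is, `m i (u) =
kζ + p`. This is a hyperplane when `m i ≠ 0`; when `m i = 0`, `b i` centralizes `𝔥₀` and lies in `𝔥`
anyway. -/
theorem volume_not_isRegular [LieAlgebra.IsKilling ℂ 𝔤] (hν : IsDiagramAutomorphism B ν) {n : ℕ}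
    (φ : (Fin n → ℂ) ≃ₗ[ℂ] fixedCartan H ν) :
    volume {c : Fin n → ℂ | ¬ IsRegular H ν r q (φ c : 𝔤)} = 0 := by
  obtain ⟨b, w, m, hw, hm⟩ := hν.exists_eigenbasis
  obtain ⟨ζ, hζ⟩ : ∃ ζ : ℂ, Complex.exp (2 * π * I * ζ) = q := by
    refine ⟨Complex.log q / (2 * π * I), ?_⟩
    rw [mul_div_cancel₀ _ Complex.two_pi_I_ne_zero, Complex.exp_log q.ne_zero]
  have hsub : {c : Fin n → ℂ | ¬ IsRegular H ν r q (φ c : 𝔤)} ⊆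
      ⋃ (i : Fin (Module.finrank ℂ 𝔤)) (p : ℤ × ℤ) (_ : m i ≠ 0),
        {c | (m i ∘ₗ φ.toLinearMap) c = p.1 * ζ + p.2} := by
    intro c hc
    by_contra hnot
    simp only [mem_iUnion, not_exists] at hnot
    refine hc fun k X hX hX' => ?_
    rw [← b.sum_repr X]
    refine sum_mem fun i _ => ?_
    by_cases hXi : b.repr X i = 0
    · rw [hXi, zero_smul]
      exact zero_mem _
    refine H.smul_mem _ (hν.mem_cartan_of_centralizes fun h hh => ?_)
    have hx : ∀ i, (eAd (φ c : 𝔤) : Module.End ℂ 𝔤) (b i) =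
        Complex.exp (2 * π * I * m i (φ c)) • b i := fun i => eAd_eigenvector (hm i _)
    have h1 := congrArg (fun y => b.repr y i) hX'
    simp only [repr_map_of_eigen hx, map_smul, Finsupp.smul_apply, smul_eq_mul] at h1
    have h2 := mul_right_cancel₀ hXi h1
    rw [Units.val_zpow_eq_zpow_val, ← hζ, ← Complex.exp_int_mul, Complex.exp_eq_exp_iff_exists_int]
      at h2
    obtain ⟨p, hp⟩ := h2
    have hmi : m i = 0 := by
      by_contra hne
      refine hnot i (k, p) hne ?_
      change m i (φ c) = k * ζ + p
      refine mul_left_cancel₀ Complex.two_pi_I_ne_zero ?_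
      rw [hp]
      ring
    rw [hm i ⟨h, hh⟩, hmi, LinearMap.zero_apply, zero_smul]
  refine measure_mono_null hsub ?_
  refine measure_iUnion_null fun i => measure_iUnion_null fun p => measure_iUnion_null fun hi => ?_
  refine volume_hyperplane_eq_zero _ (fun h0 => hi (LinearMap.ext fun y => ?_)) _
  have := LinearMap.congr_fun h0 (φ.symm y)
  simpa using this

end Regular

/-! ### First-order deformations modulo gauge -/

section FirstOrderTheorems

variable {𝔤 ι : Type*} [LieRing 𝔤] [LieAlgebra ℂ 𝔤] [FiniteDimensional ℂ 𝔤]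
  [LieAlgebra.IsKilling ℂ 𝔤] [Finite ι] {H : LieSubalgebra ℂ 𝔤} {B : LieAlgebra.Basis ι H}
  {ν : 𝔤 ≃ₗ⁅ℂ⁆ 𝔤} {q : ℂˣ} {r : ℕ}

theorem finiteDimensional_stabilizer_eAd (hν : IsDiagramAutomorphism B ν)
    (hq1 : ‖(q : ℂ)‖ < 1) {u : 𝔤} (hu : u ∈ fixedCartan H ν) :
    FiniteDimensional ℂ (stabilizer ν r q (eAd u : Module.End ℂ 𝔤)) := by
  obtain ⟨b, w, m, hw, hm⟩ := hν.exists_eigenbasis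
  exact finiteDimensional_stabilizer hw
    (fun i => eAd_eigenvector (hm i ⟨u, hu⟩)) hq1

theorem existsUnique_deformation_part (hν : IsDiagramAutomorphism B ν) (hq1 : ‖(q : ℂ)‖ < 1)
    {u : 𝔤} (hu : u ∈ fixedCartan H ν) {δR : ℂˣ → Module.End ℂ 𝔤}
    (hδ : IsDeformation ν r (eAd u : Module.End ℂ 𝔤) δR) :
    ∃! δR₀ : ℂˣ → Module.End ℂ 𝔤,
      (∃ Y ∈ stabilizer ν r q (eAd u : Module.End ℂ 𝔤),
        ∀ t, δR₀ t = (eAd u : Module.End ℂ 𝔤) * LieAlgebra.ad ℂ 𝔤 (Y t)) ∧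
      ∃ X ∈ gaugeAlgebra ν r,
        IsInfinitesimalGauge q (eAd u : Module.End ℂ 𝔤) (fun t => δR t - δR₀ t) X := by
  obtain ⟨b, w, m, hw, hm⟩ := hν.exists_eigenbasis
  have hl := fun i => eAd_eigenvector (hm i ⟨u, hu⟩)
  have hl0 : ∀ i, Complex.exp (2 * π * I * m i ⟨u, hu⟩) ≠ 0 := fun i => exp_ne_zero _
  have hx := eAd_preservesBracket u
  have hxu : IsUnit (eAd u : Module.End ℂ 𝔤) := Units.isUnit _
  obtain ⟨Z, hZ, rfl⟩ := hδ.exists_eq hx (eAd_comm hu.2)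
  obtain ⟨c, k, -, hY, X, hX, hZX⟩ := exists_gauge_solution hw hl hl0 hq1 hZ
  refine ⟨_, ⟨⟨_, hY, fun t => rfl⟩, X, hX, ?_⟩, ?_⟩
  · simp only [ad_sub_mul]
    exact (isInfinitesimalGauge_ad_iff hx hxu).2 hZX
  · rintro δR₁ ⟨⟨Y', hY', h1⟩, X', hX', h2⟩
    obtain rfl : δR₁ = fun t => (eAd u : Module.End ℂ 𝔤) * LieAlgebra.ad ℂ 𝔤 (Y' t) := funext h1
    simp only [ad_sub_mul] at h2
    rw [isInfinitesimalGauge_ad_iff hx hxu] at h2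
    -- Subtracting the two gauge equations exhibits `Y' - Y` as a difference, with gauge element `X
    -- - X'`.
    have h3 := stabilizer_eq_zero_of_gauge hw hl hl0 (sub_mem hY' hY) (sub_mem hX hX') fun t => by
      have e1 := hZX t
      have e2 := h2 t
      simp only [Pi.sub_apply, map_sub] at e1 e2 ⊢
      have : (eAd u : Module.End ℂ 𝔤) (X t) - (eAd u : Module.End ℂ 𝔤) (X' t) -
          (X (q * t) - X' (q * t)) =
          ((eAd u : Module.End ℂ 𝔤) (X t) - X (q * t)) -
            ((eAd u : Module.End ℂ 𝔤) (X' t) - X' (q * t)) := by abel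
      rw [this, ← e1, ← e2]
      abel
    rw [sub_eq_zero] at h3
    rw [h3]

/-- Regularity makes every surviving monomial a constant in `𝔥₀`. Conversely such constants lie in
the stabilizer, so uniqueness is inherited from the general case. -/
theorem existsUnique_cartan_part (hν : IsDiagramAutomorphism B ν) (hq1 : ‖(q : ℂ)‖ < 1)
    {u : 𝔤} (hu : u ∈ fixedCartan H ν) (hreg : IsRegular H ν r q u)
    {δR : ℂˣ → Module.End ℂ 𝔤} (hδ : IsDeformation ν r (eAd u : Module.End ℂ 𝔤) δR) :
    ∃! h : 𝔤, h ∈ fixedCartan H ν ∧ ∃ X ∈ gaugeAlgebra ν r,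
      IsInfinitesimalGauge q (eAd u : Module.End ℂ 𝔤)
        (fun t => δR t - (eAd u : Module.End ℂ 𝔤) * LieAlgebra.ad ℂ 𝔤 h) X := by
  have hx := eAd_preservesBracket u
  have hxu : IsUnit (eAd u : Module.End ℂ 𝔤) := Units.isUnit _
  have huniq := existsUnique_deformation_part (q := q) hν hq1 hu hδ
  obtain ⟨b, w, m, hw, hm⟩ := hν.exists_eigenbasis
  have hl := fun i => eAd_eigenvector (hm i ⟨u, hu⟩)
  have hl0 : ∀ i, Complex.exp (2 * π * I * m i ⟨u, hu⟩) ≠ 0 := fun i => exp_ne_zero _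
  obtain ⟨Z, hZ, hZδ⟩ := hδ.exists_eq hx (eAd_comm hu.2)
  obtain ⟨c, k, hck, hY, X, hX, hZX⟩ := exists_gauge_solution hw hl hl0 hq1 hZ
  have hres : ∀ i, c i ≠ 0 → k i = 0 ∧ b i ∈ fixedCartan H ν := fun i hi => by
    obtain ⟨h1, h2⟩ := (hck i).resolve_left hi
    exact hreg.resonant B hu hq1 (b.ne_zero i) (hw i) (hl i) h1 h2
  have hconst : ∀ t : ℂˣ, ∑ i, (c i * (t : ℂ) ^ k i) • b i = ∑ i, c i • b i := fun t =>
    Finset.sum_congr rfl fun i _ => by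
      by_cases hi : c i = 0
      · rw [hi, zero_mul]
      · rw [(hres i hi).1, zpow_zero, mul_one]
  refine ⟨∑ i, c i • b i, ⟨sum_mem fun i _ => ?_, X, hX, ?_⟩, ?_⟩
  · by_cases hi : c i = 0
    · rw [hi, zero_smul]
      exact zero_mem _
    · exact Submodule.smul_mem _ _ (hres i hi).2
  · subst hZδ
    simp only [ad_sub_mul]
    refine (isInfinitesimalGauge_ad_iff hx hxu).2 fun t => ?_
    rw [← hconst t, hZX t]
  · rintro h ⟨hh, X', hX', hG⟩
    have hmem : (fun _ : ℂˣ => h) ∈ stabilizer ν r q (eAd u : Module.End ℂ 𝔤) :=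
      ⟨⟨fun φ => ⟨fun _ => φ h, differentiableOn_const _, fun _ => rfl⟩, fun _ => hh.2.symm⟩,
        fun _ => (eAd_eq_self_of_mem_cartan B hu.1 hh.1).symm⟩
    have e := huniq.unique ⟨⟨_, hmem, fun t => rfl⟩, X', hX', hG⟩
      ⟨⟨_, hY, fun t => rfl⟩, X, hX, by
        subst hZδ
        simp only [ad_sub_mul]
        exact (isInfinitesimalGauge_ad_iff hx hxu).2 hZX⟩
    have e1 := congrFun e 1
    rw [hconst] at e1
    exact ad_injective (hxu.mul_left_cancel e1)

end FirstOrderTheorems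

/-! ### Banach spaces of bounded holomorphic functions -/

section HoloSub

variable {W : Type*} [NormedAddCommGroup W]

/-- A function on a subset of `ℂ`, extended by zero. -/
def extendZero {U : Set ℂ} (f : U → W) : ℂ → W := Function.extend Subtype.val f 0

theorem extendZero_apply {U : Set ℂ} (f : U → W) (t : U) : extendZero f t = f t :=
  Subtype.val_injective.extend_apply f 0 t

theorem extendZero_eqOn {U : Set ℂ} {f : U → W} {F : ℂ → W} (h : ∀ t : U, f t = F t) :
    EqOn (extendZero f) F U := fun t ht => by
  rw [← h ⟨t, ht⟩, ← extendZero_apply f ⟨t, ht⟩]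

variable [NormedSpace ℂ W]

/-- The bounded holomorphic `W`-valued functions on `U` with `f(at) = T f(t)`. -/
def holoSub (U : Set ℂ) (a : ℂ) (T : W →L[ℂ] W) : Submodule ℂ (U →ᵇ W) where
  carrier := {f | DifferentiableOn ℂ (extendZero f) U ∧
    ∀ s t : U, (t : ℂ) = a * s → f t = T (f s)}
  add_mem' := fun {f g} hf hg => ⟨(hf.1.add hg.1).congr
      (extendZero_eqOn fun t => by simp [extendZero_apply]), fun s t h => by
      simp [hf.2 s t h, hg.2 s t h]⟩
  zero_mem' := ⟨(differentiableOn_const (0 : W)).congr (extendZero_eqOn fun t => rfl),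
    fun s t h => by simp⟩
  smul_mem' := fun c f hf => ⟨(hf.1.const_smul c).congr
      (extendZero_eqOn fun t => by simp [extendZero_apply]), fun s t h => by
      simp [hf.2 s t h]⟩

variable {U : Set ℂ} {a : ℂ} {T : W →L[ℂ] W}

theorem mem_holoSub_of_eq {f : U →ᵇ W} {F : ℂ → W} (hF : DifferentiableOn ℂ F U)
    (hFa : ∀ t ∈ U, F (a * t) = T (F t)) (h : ∀ t : U, f t = F t) : f ∈ holoSub U a T :=
  ⟨hF.congr (extendZero_eqOn h), fun s t hst => by rw [h, h, hst, hFa s s.2]⟩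

/-- Uniform limits preserve holomorphy and the twist. Closedness yields the completeness that the
inverse function theorem requires. -/
theorem isClosed_holoSub [CompleteSpace W] (hU : IsOpen U) :
    IsClosed (holoSub U a T : Set (U →ᵇ W)) := by
  refine IsSeqClosed.isClosed fun f g hf hfg => ?_
  have hu := BoundedContinuousFunction.tendsto_iff_tendstoUniformly.1 hfg
  refine ⟨?_, fun s t hst => ?_⟩
  · refine TendstoLocallyUniformlyOn.differentiableOn (φ := atTop)
      (F := fun n => extendZero (f n)) ?_ (Eventually.of_forall fun n => (hf n).1) hU
    refine TendstoUniformlyOn.tendstoLocallyUniformlyOn ?_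
    rw [Metric.tendstoUniformlyOn_iff]
    intro ε hε
    filter_upwards [Metric.tendstoUniformly_iff.1 hu ε hε] with n hn t ht
    have := hn ⟨t, ht⟩
    rwa [← extendZero_apply g, ← extendZero_apply (f n)] at this
  · have h1 := (hu.tendsto_at t)
    have h2 := (T.continuous.tendsto _).comp (hu.tendsto_at s)
    exact tendsto_nhds_unique h1 (h2.congr fun n => ((hf n).2 s t hst).symm)

/-- Composition with a continuous map, as a continuous linear map on bounded functions. -/
def pullbackL {S S' : Type*} [TopologicalSpace S] [TopologicalSpace S'] (W : Type*)
    [NormedAddCommGroup W] [NormedSpace ℂ W] (g : C(S, S')) : (S' →ᵇ W) →L[ℂ] (S →ᵇ W) :=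
  LinearMap.mkContinuous
    { toFun := fun f => f.compContinuous g
      map_add' := fun _ _ => rfl
      map_smul' := fun _ _ => rfl } 1 fun f => by
    rw [one_mul]
    exact (BoundedContinuousFunction.norm_le (norm_nonneg _)).2 fun t => f.norm_coe_le_norm _

/-- Constant functions, as a continuous linear map. -/
def constL (S : Type*) [TopologicalSpace S] (W : Type*)
    [NormedAddCommGroup W] [NormedSpace ℂ W] : W →L[ℂ] (S →ᵇ W) :=
  LinearMap.mkContinuous
    { toFun := BoundedContinuousFunction.const S
      map_add' := fun _ _ => rfl
      map_smul' := fun _ _ => rfl } 1 fun f => by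
    rw [one_mul]
    exact (BoundedContinuousFunction.norm_le (norm_nonneg _)).2 fun t => le_rfl

theorem exp_apply {S M : Type*} [TopologicalSpace S] [NormedRing M] [NormedAlgebra ℂ M]
    [NormedAlgebra ℚ M] [CompleteSpace M] (f : S →ᵇ M) (t : S) :
    (NormedSpace.exp f) t = NormedSpace.exp (f t) := by
  let ev : (S →ᵇ M) →+* M :=
    { toFun := fun f => f t
      map_one' := rfl
      map_mul' := fun _ _ => rfl
      map_zero' := rfl
      map_add' := fun _ _ => rfl }
  exact NormedSpace.map_exp ev (BoundedContinuousFunction.evalCLM ℂ t).continuous f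

theorem _root_.HasStrictFDerivAt.codRestrict_submodule {E F : Type*} [NormedAddCommGroup E]
    [NormedSpace ℂ E] [NormedAddCommGroup F] [NormedSpace ℂ F] {f : E → F} {f' : E →L[ℂ] F}
    {x : E} (h : HasStrictFDerivAt f f' x) (S : Submodule ℂ F) (hf : ∀ y, f y ∈ S)
    (hf' : ∀ y, f' y ∈ S) :
    HasStrictFDerivAt (fun y => (⟨f y, hf y⟩ : S)) (f'.codRestrict S hf') x := by
  refine .of_isLittleO ?_
  refine (Asymptotics.IsLittleO.of_norm_left ?_ )
  exact h.isLittleO.norm_left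

end HoloSub

/-! ### Bounded solutions of the difference equation -/

section Bounded

variable {q a : ℂ} {J : Set ℝ}

theorem isOpen_norm_mem {J : Set ℝ} (hJ : IsOpen J) : IsOpen {t : ℂ | ‖t‖ ∈ J} :=
  hJ.preimage continuous_norm

theorem isOpen_enlarge (hq0 : q ≠ 0) (hJo : IsOpen J) : IsOpen (enlarge q J) := by
  have hqp : 0 < ‖q‖ := norm_pos_iff.2 hq0
  refine Metric.isOpen_iff.2 fun s ⟨s₁, h₁, s₂, h₂, hle₁, hle₂⟩ => ?_
  obtain ⟨r₁, hr₁, hb₁⟩ := Metric.isOpen_iff.1 hJo s₁ h₁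
  obtain ⟨r₂, hr₂, hb₂⟩ := Metric.isOpen_iff.1 hJo s₂ h₂
  refine ⟨min (r₁ / 2) (‖q‖ * (r₂ / 2)), by positivity, fun s' hs' => ?_⟩
  rw [Metric.mem_ball, Real.dist_eq, abs_lt] at hs'
  have m1 := min_le_left (r₁ / 2) (‖q‖ * (r₂ / 2))
  have m2 := min_le_right (r₁ / 2) (‖q‖ * (r₂ / 2))
  refine ⟨s₁ + r₁ / 2, hb₁ ?_, s₂ - r₂ / 2, hb₂ ?_, by linarith, by
    rw [mul_sub]; linarith⟩
  · rw [Metric.mem_ball, Real.dist_eq, add_sub_cancel_left, abs_of_pos] <;> linarith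
  · rw [Metric.mem_ball, Real.dist_eq, sub_sub_cancel_left, abs_neg, abs_of_pos] <;> linarith

/-- On the compact annulus `|q| ≤ |t| ≤ 1` the solution is bounded by continuity. From elsewhere in
the enlarged annulus one step of the equation, towards `qt` if `|t| > 1` and towards `q⁻¹t` if `|t|
< |q|`, leads there by `hJq`. -/
theorem exists_bounded_difference_solution (hq0 : q ≠ 0) (hq1 : ‖q‖ < 1) {l w : ℂ} (hl : l ≠ 0)
    (hJ : J.OrdConnected) (hJ0 : J ⊆ Ioi 0) (hJo : IsOpen J) (h1 : (1 : ℝ) ∈ J)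
    (hJq : ∀ s ∈ J, ‖q‖ * s ≤ 1 ∧ ‖q‖ ≤ s) (ha : ‖a‖ = 1)
    (hreg : ∀ k : ℤ, q ^ k = l → a ^ k = w → k = 0) {f : ℂ → ℂ} {C : ℝ}
    (hf : DifferentiableOn ℂ f {t | ‖t‖ ∈ J})
    (hfa : ∀ t : ℂ, ‖t‖ ∈ J → f (a * t) = w * f t) (hC : ∀ t : ℂ, ‖t‖ ∈ J → ‖f t‖ ≤ C) :
    ∃ (ξ : ℂ → ℂ) (c : ℂ) (C' : ℝ), (c = 0 ∨ l = 1 ∧ w = 1) ∧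
      DifferentiableOn ℂ ξ {t | ‖t‖ ∈ enlarge q J} ∧ (∀ t, ξ (a * t) = w * ξ t) ∧
      (∀ t : ℂ, ‖t‖ ∈ enlarge q J → ‖ξ t‖ ≤ C') ∧
      ∀ t, ‖t‖ ∈ J → f t = ξ t - l⁻¹ * ξ (q * t) + c := by
  have hqp : 0 < ‖q‖ := norm_pos_iff.2 hq0
  obtain ⟨ξ, c, k, hc, hξ, hξa, hfξ⟩ := exists_difference_solution hq0 hq1 hl hJ hJ0 hJo h1 hf ha hfa
  have hc' : (c = 0 ∨ l = 1 ∧ w = 1) ∧ ∀ t, ‖t‖ ∈ J → f t = ξ t - l⁻¹ * ξ (q * t) + c := by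
    rcases hc with rfl | ⟨h2, h3⟩
    · exact ⟨.inl rfl, fun t ht => by rw [hfξ t ht, zero_mul]⟩
    · have hk := hreg k h2 h3
      subst hk
      exact ⟨.inr ⟨by rw [← h2, zpow_zero], by rw [← h3, zpow_zero]⟩, fun t ht => by
        rw [hfξ t ht, zpow_zero, mul_one]⟩
  have hK : IsCompact {t : ℂ | ‖t‖ ∈ Icc ‖q‖ 1} := by
    refine (isCompact_closedBall (0 : ℂ) 1).of_isClosed_subset
      (isClosed_Icc.preimage continuous_norm) fun t ht => ?_
    rw [mem_closedBall_zero_iff]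
    exact ht.2
  obtain ⟨D, hD⟩ := hK.exists_bound_of_continuousOn (f := ξ) (hξ.continuousOn.mono fun t ht =>
    ⟨1, h1, 1, h1, ht.2, by rw [mul_one]; exact ht.1⟩)
  have hD0 : 0 ≤ D := (norm_nonneg _).trans (hD 1 (by simp [hq1.le]))
  have hC0 : 0 ≤ C := (norm_nonneg _).trans (hC 1 (by simpa using h1))
  refine ⟨ξ, c, D + (C + ‖l⁻¹‖ * D + ‖c‖) + ‖l‖ * (D + C + ‖c‖), hc'.1, hξ, hξa,
    fun t ht => ?_, hc'.2⟩
  have p1 : 0 ≤ C + ‖l⁻¹‖ * D + ‖c‖ := by positivity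
  have p2 : 0 ≤ ‖l‖ * (D + C + ‖c‖) := by positivity
  obtain ⟨s₁, h₁, s₂, h₂, hle₁, hle₂⟩ := ht
  by_cases hu : ‖t‖ ≤ 1
  · by_cases hd : ‖q‖ ≤ ‖t‖
    · linarith [hD t ⟨hd, hu⟩]
    · push Not at hd
      have htq : ‖q⁻¹ * t‖ = ‖t‖ / ‖q‖ := by rw [norm_mul, norm_inv, div_eq_inv_mul]
      have hlt : ‖t‖ / ‖q‖ < 1 := (div_lt_one hqp).2 hd
      have hm : ‖q⁻¹ * t‖ ∈ J := by
        rw [htq]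
        exact hJ.out h₂ h1 ⟨(le_div_iff₀ hqp).2 (by rwa [mul_comm]), hlt.le⟩
      have e1 := hc'.2 _ hm
      rw [mul_inv_cancel_left₀ hq0] at e1
      have e2 : ξ t = l * (ξ (q⁻¹ * t) + c - f (q⁻¹ * t)) := by
        rw [e1]
        field_simp
        ring
      have b1 := hD (q⁻¹ * t) ⟨(hJq _ hm).2, by rw [htq]; exact hlt.le⟩
      have b2 := hC _ hm
      rw [e2, norm_mul]
      have : ‖ξ (q⁻¹ * t) + c - f (q⁻¹ * t)‖ ≤ D + C + ‖c‖ :=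
        (norm_sub_le _ _).trans (by linarith [norm_add_le (ξ (q⁻¹ * t)) c])
      have := mul_le_mul_of_nonneg_left this (norm_nonneg l)
      linarith
  · push Not at hu
    have hm : ‖t‖ ∈ J := hJ.out h1 h₁ ⟨hu.le, hle₁⟩
    have e1 := hc'.2 _ hm
    have e2 : ξ t = f t + l⁻¹ * ξ (q * t) - c := by rw [e1]; ring
    have b1 := hD (q * t) (by
      rw [mem_ofPred_eq, norm_mul]
      exact ⟨le_mul_of_one_le_right hqp.le hu.le, (hJq _ hm).1⟩)
    have b2 := hC _ hm
    rw [e2]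
    have b3 : ‖l⁻¹ * ξ (q * t)‖ ≤ ‖l⁻¹‖ * D := by
      rw [norm_mul]
      exact mul_le_mul_of_nonneg_left b1 (norm_nonneg _)
    have := norm_sub_le (f t + l⁻¹ * ξ (q * t)) c
    have := norm_add_le (f t) (l⁻¹ * ξ (q * t))
    linarith

end Bounded

/-! ### The nonlinear gauge equation near a regular point -/

section GaugeMap

variable {M : Type*} [NormedRing M] [NormedAlgebra ℂ M] [CompleteSpace M]

theorem hasStrictFDerivAt_exp_mul_exp_mul_exp {E : Type*} [NormedAddCommGroup E] [NormedSpace ℂ E]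
    (a₁ a₂ a₃ : E →L[ℂ] M) :
    HasStrictFDerivAt (fun z => NormedSpace.exp (a₁ z) * NormedSpace.exp (a₂ z) *
      NormedSpace.exp (a₃ z)) (a₁ + a₂ + a₃) 0 := by
  have key : ∀ a : E →L[ℂ] M, HasStrictFDerivAt (fun z => NormedSpace.exp (a z)) a 0 := fun a => by
    have h : HasStrictFDerivAt (NormedSpace.exp : M → M) (1 : M →L[ℂ] M) (a 0) := by
      rw [map_zero]
      exact hasStrictFDerivAt_exp_zero
    exact (h.comp 0 a.hasStrictFDerivAt).congr_fderiv (ContinuousLinearMap.ext fun _ => rfl)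
  refine (((key a₁).mul' (key a₂)).mul' (key a₃)).congr_fderiv ?_
  ext z
  simp [add_comm, add_left_comm]

theorem DifferentiableOn.nexp {f : ℂ → M} {U : Set ℂ} (hf : DifferentiableOn ℂ f U) :
    DifferentiableOn ℂ (fun t => NormedSpace.exp (f t)) U := fun t ht =>
  ((NormedSpace.exp_analytic (𝕂 := ℂ) (f t)).differentiableAt).comp_differentiableWithinAt t (hf t ht)

variable [NormedAlgebra ℚ M] {κ : Type*} [Fintype κ] {J : Set ℝ} {q a : ℂ} {w l : κ → ℂ}

theorem exists_bounded_difference_solution_pi (hq0 : q ≠ 0) (hq1 : ‖q‖ < 1) (hl : ∀ i, l i ≠ 0)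
    (hJ : J.OrdConnected) (hJ0 : J ⊆ Ioi 0) (hJo : IsOpen J) (h1 : (1 : ℝ) ∈ J)
    (hJq : ∀ s ∈ J, ‖q‖ * s ≤ 1 ∧ ‖q‖ ≤ s) (ha : ‖a‖ = 1)
    (hreg : ∀ i, ∀ k : ℤ, q ^ k = l i → a ^ k = w i → k = 0)
    {f : {t : ℂ | ‖t‖ ∈ J} →ᵇ (κ → ℂ)}
    (hf : f ∈ holoSub {t : ℂ | ‖t‖ ∈ J} a (ContinuousLinearMap.mul ℂ (κ → ℂ) w)) :
    ∃ c : κ → ℂ, ∃ ξ ∈ holoSub {t : ℂ | ‖t‖ ∈ enlarge q J} a (ContinuousLinearMap.mul ℂ (κ → ℂ) w),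
      (∀ i, c i = 0 ∨ l i = 1 ∧ w i = 1) ∧
      ∀ (t : {t : ℂ | ‖t‖ ∈ J}) (t₁ t₂ : {t : ℂ | ‖t‖ ∈ enlarge q J}), (t₁ : ℂ) = t →
        (t₂ : ℂ) = q * t → f t = ξ t₁ - l⁻¹ * ξ t₂ + c := by
  have hm : ∀ t : ℂ, ‖t‖ ∈ J → ‖a * t‖ ∈ J := fun t ht => by rwa [norm_mul, ha, one_mul]
  have H := fun i => exists_bounded_difference_solution (f := fun t => extendZero f t i)
    (C := ‖f‖) hq0 hq1 (hl i) hJ hJ0 hJo h1 hJq ha (hreg i)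
    (fun t ht => differentiableWithinAt_pi.1 (hf.1 t ht) i)
    (fun t ht => by
      have := hf.2 ⟨t, ht⟩ ⟨a * t, hm t ht⟩ rfl
      rw [extendZero_apply f ⟨t, ht⟩, extendZero_apply f ⟨a * t, hm t ht⟩, this]
      rfl)
    (fun t ht => by
      rw [extendZero_apply f ⟨t, ht⟩]
      exact (norm_le_pi_norm _ i).trans (f.norm_coe_le_norm _))
  choose ξ c C hc hξ hξa hC hfξ using H
  have hξ' : DifferentiableOn ℂ (fun t i => ξ i t) {t : ℂ | ‖t‖ ∈ enlarge q J} :=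
    differentiableOn_pi.2 hξ
  refine ⟨c, BoundedContinuousFunction.ofNormedAddCommGroup
    (fun t : {t : ℂ | ‖t‖ ∈ enlarge q J} => fun i => ξ i t)
    (continuousOn_iff_continuous_domRestrict.1 hξ'.continuousOn) (∑ i, |C i|) fun t => ?_, ?_, hc, ?_⟩
  · refine (pi_norm_le_iff_of_nonneg (Finset.sum_nonneg fun i _ => abs_nonneg _)).2 fun i => ?_
    exact ((hC i t t.2).trans (le_abs_self _)).trans
      (Finset.single_le_sum (f := fun i => |C i|) (fun i _ => abs_nonneg _) (Finset.mem_univ i))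
  · exact mem_holoSub_of_eq hξ' (fun t _ => funext fun i => hξa i t) fun t => rfl
  · intro t t₁ t₂ h₁ h₂
    funext i
    have := hfξ i t t.2
    rw [extendZero_apply] at this
    rw [this]
    change _ = ξ i t₁ - (l i)⁻¹ * ξ i t₂ + c i
    rw [h₁, h₂]

/-- The left side, as a map of `(h, X)` between Banach spaces, has strict derivative `h + X(t) - l⁻¹
X(qt)` at `0`. This is onto by the bounded difference equation, with `X` on the enlarged annulus and
the target on the original one, so the map is open at `0`. -/
theorem exists_gauge_near (hq0 : q ≠ 0) (hq1 : ‖q‖ < 1) (hl : ∀ i, l i ≠ 0)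
    (hJ : J.OrdConnected) (hJ0 : J ⊆ Ioi 0) (hJo : IsOpen J) (h1 : (1 : ℝ) ∈ J)
    (hJq : ∀ s ∈ J, ‖q‖ * s ≤ 1 ∧ ‖q‖ ≤ s) (ha : ‖a‖ = 1)
    (hreg : ∀ i, ∀ k : ℤ, q ^ k = l i → a ^ k = w i → k = 0)
    (A : (κ → ℂ) →L[ℂ] M) (P : M →L[ℂ] (κ → ℂ)) (hPA : ∀ v, P (A v) = v)
    (N : M →ₐ[ℂ] M) (hN : Continuous N) (hNA : ∀ v, N (A v) = A (w * v))
    (hPN : ∀ m, P (N m) = w * P m) {ε : ℝ} (hε : 0 < ε) :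
    ∃ η > 0, ∀ y : ℂ → κ → ℂ, DifferentiableOn ℂ y {t | ‖t‖ ∈ J} →
      (∀ t, ‖t‖ ∈ J → y (a * t) = w * y t) → (∀ t, ‖t‖ ∈ J → ‖y t‖ ≤ η) →
      ∃ h : κ → ℂ, (∀ i, h i ≠ 0 → l i = 1 ∧ w i = 1) ∧ ‖h‖ < ε ∧ ∃ X : ℂ → κ → ℂ,
        DifferentiableOn ℂ X {t | ‖t‖ ∈ enlarge q J} ∧
        (∀ t, ‖t‖ ∈ enlarge q J → X (a * t) = w * X t) ∧
        (∀ t, ‖t‖ ∈ enlarge q J → ‖X t‖ < ε) ∧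
        ∀ t, ‖t‖ ∈ J → P (NormedSpace.exp (-A (l⁻¹ * X (q * t))) * NormedSpace.exp (A h) *
          NormedSpace.exp (A (X t)) - 1) = y t := by
  classical
  set U₁ : Set ℂ := {t | ‖t‖ ∈ J} with hU₁
  set U₂ : Set ℂ := {t | ‖t‖ ∈ enlarge q J} with hU₂
  have hmJ : ∀ t : ℂ, ‖t‖ ∈ J → ‖a * t‖ ∈ J := fun t ht => by rwa [norm_mul, ha, one_mul]
  have hmE : ∀ t : ℂ, ‖t‖ ∈ enlarge q J → ‖a * t‖ ∈ enlarge q J := fun t ht => by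
    rwa [norm_mul, ha, one_mul]
  let T : (κ → ℂ) →L[ℂ] (κ → ℂ) := ContinuousLinearMap.mul ℂ (κ → ℂ) w
  -- The mask lets `h` range over all of `κ → ℂ` while only its components with `l i = w i = 1`
  -- enter the equation.
  let mask : κ → ℂ := fun i => if l i = 1 ∧ w i = 1 then 1 else 0
  have hmask : w * mask = mask := funext fun i => by
    by_cases h : l i = 1 ∧ w i = 1 <;> simp [mask, h]
  let inc : C(U₁, U₂) := ⟨fun t => ⟨t, subset_enlarge hJ0 hq1 t.2⟩, by fun_prop⟩
  let mu : C(U₁, U₂) := ⟨fun t => ⟨q * t, mul_mem_enlarge hJ0 hq1 t.2⟩, by fun_prop⟩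
  have : CompleteSpace (holoSub U₂ a T) :=
    (isClosed_holoSub (isOpen_norm_mem (isOpen_enlarge hq0 hJo))).completeSpace_coe
  have : CompleteSpace (holoSub U₁ a T) :=
    (isClosed_holoSub (isOpen_norm_mem hJo)).completeSpace_coe
  let E := (κ → ℂ) × holoSub U₂ a T
  let As : (U₁ →ᵇ (κ → ℂ)) →L[ℂ] (U₁ →ᵇ M) := A.compLeftContinuousBounded U₁
  let Ps : (U₁ →ᵇ M) →L[ℂ] (U₁ →ᵇ (κ → ℂ)) := P.compLeftContinuousBounded U₁
  let b₁ : E →L[ℂ] (U₁ →ᵇ (κ → ℂ)) := -((ContinuousLinearMap.mul ℂ (κ → ℂ) l⁻¹).compLeftContinuousBounded U₁ ∘L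
    pullbackL (κ → ℂ) mu ∘L (holoSub U₂ a T).subtypeL ∘L ContinuousLinearMap.snd ℂ _ _)
  let b₂ : E →L[ℂ] (U₁ →ᵇ (κ → ℂ)) := constL U₁ (κ → ℂ) ∘L ContinuousLinearMap.mul ℂ (κ → ℂ) mask ∘L
    ContinuousLinearMap.fst ℂ _ _
  let b₃ : E →L[ℂ] (U₁ →ᵇ (κ → ℂ)) := pullbackL (κ → ℂ) inc ∘L (holoSub U₂ a T).subtypeL ∘L
    ContinuousLinearMap.snd ℂ _ _
  let Φ : E → (U₁ →ᵇ (κ → ℂ)) := fun z => Ps (NormedSpace.exp (As (b₁ z)) * NormedSpace.exp (As (b₂ z)) *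
    NormedSpace.exp (As (b₃ z)) - 1)
  have hb₁ : ∀ z t, b₁ z t = -(l⁻¹ * extendZero z.2.1 (q * t)) := fun z t => by
    rw [show q * (t : ℂ) = (mu t : ℂ) from rfl, extendZero_apply]
    rfl
  have hb₂ : ∀ z t, b₂ z t = mask * z.1 := fun z t => rfl
  have hb₃ : ∀ z t, b₃ z t = extendZero z.2.1 t := fun z t => by
    rw [show (t : ℂ) = (inc t : ℂ) from rfl, extendZero_apply]
    rfl
  have hΦ : ∀ z (t : U₁), Φ z t = P (NormedSpace.exp (-A (l⁻¹ * extendZero z.2.1 (q * t))) *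
      NormedSpace.exp (A (mask * z.1)) * NormedSpace.exp (A (extendZero z.2.1 t)) - 1) :=
    fun z t => by
    rw [← hb₂ z t, ← hb₃ z t, ← map_neg, ← hb₁ z t]
    change P ((NormedSpace.exp (As (b₁ z))) t * (NormedSpace.exp (As (b₂ z))) t *
      (NormedSpace.exp (As (b₃ z))) t - 1) = _
    rw [exp_apply, exp_apply, exp_apply]
    rfl
  have hmul : MapsTo (fun t => q * t) U₁ U₂ := fun t ht => mul_mem_enlarge hJ0 hq1 ht
  have hsub : U₁ ⊆ U₂ := fun t ht => subset_enlarge hJ0 hq1 ht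
  have htw : ∀ (X : holoSub U₂ a T) t, t ∈ U₂ → extendZero X.1 (a * t) = w * extendZero X.1 t :=
    fun X t ht => by
      have := X.2.2 ⟨t, ht⟩ ⟨a * t, hmE t ht⟩ rfl
      rw [extendZero_apply X.1 ⟨t, ht⟩, extendZero_apply X.1 ⟨a * t, hmE t ht⟩, this]
      rfl
  have hd₁ : ∀ X : holoSub U₂ a T, DifferentiableOn ℂ (fun t => extendZero X.1 (q * t)) U₁ :=
    fun X => X.2.1.comp (differentiableOn_id.const_mul q) hmul
  have hΦm : ∀ z, Φ z ∈ holoSub U₁ a T := fun z => by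
    refine mem_holoSub_of_eq (F := fun t => P (NormedSpace.exp
      (-A (l⁻¹ * extendZero z.2.1 (q * t))) * NormedSpace.exp (A (mask * z.1)) *
      NormedSpace.exp (A (extendZero z.2.1 t)) - 1)) ?_ ?_ (hΦ z)
    · refine P.differentiable.comp_differentiableOn (DifferentiableOn.sub_const ?_ _)
      refine ((DifferentiableOn.nexp ?_).mul (differentiableOn_const _)).mul (DifferentiableOn.nexp ?_)
      · exact (A.differentiable.comp_differentiableOn ((hd₁ z.2).const_mul _)).neg
      · exact A.differentiable.comp_differentiableOn (z.2.2.1.mono hsub)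
    · intro t ht
      -- The algebra map `N` realises multiplication by `w` under `A` and `P` and commutes with
      -- `exp`, so the map preserves the twist.
      have hNe : ∀ m, NormedSpace.exp (N m) = N (NormedSpace.exp m) := fun m =>
        (NormedSpace.map_exp N hN m).symm
      change _ = w * _
      rw [← hPN, map_sub N, map_one N, map_mul N, map_mul N, ← hNe, ← hNe, ← hNe, map_neg N, hNA,
        hNA, hNA,
        ← mul_assoc w mask, hmask, mul_left_comm q a, htw _ _ (hmul ht), htw _ _ (hsub ht),
        mul_left_comm w]
  have hstrict : HasStrictFDerivAt Φ (b₁ + b₂ + b₃) 0 := by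
    have h := ((Ps.hasStrictFDerivAt).comp (0 : E) ((hasStrictFDerivAt_exp_mul_exp_mul_exp
      (As ∘L b₁) (As ∘L b₂) (As ∘L b₃)).sub_const 1))
    refine h.congr_fderiv ?_
    refine ContinuousLinearMap.ext fun z => BoundedContinuousFunction.ext fun t => ?_
    change P (A (b₁ z t) + A (b₂ z t) + A (b₃ z t)) = b₁ z t + b₂ z t + b₃ z t
    rw [← map_add, ← map_add, hPA]
  have hlin : ∀ z, (b₁ + b₂ + b₃) z ∈ holoSub U₁ a T := fun z => by
    refine mem_holoSub_of_eq (F := fun t => -(l⁻¹ * extendZero z.2.1 (q * t)) + mask * z.1 +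
      extendZero z.2.1 t) ?_ ?_ fun t => ?_
    · exact ((((hd₁ z.2).const_mul _).neg.add (differentiableOn_const _))).add (z.2.2.1.mono hsub)
    · intro t ht
      rw [mul_left_comm q a, htw _ _ (hmul ht), htw _ _ (hsub ht)]
      change _ = w * _
      rw [mul_add, mul_add, ← mul_assoc w mask, hmask]
      ring
    · rw [← hb₁, ← hb₂ z t, ← hb₃]
      rfl
  have hst := hstrict.codRestrict_submodule _ hΦm hlin
  have hsurj : ((b₁ + b₂ + b₃).codRestrict _ hlin).range = ⊤ := by
    rw [LinearMap.range_eq_top]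
    rintro ⟨f, hf⟩
    obtain ⟨c, ξ, hξ, hc, hfξ⟩ := exists_bounded_difference_solution_pi hq0 hq1 hl hJ hJ0 hJo h1 hJq
      ha hreg hf
    refine ⟨(c, ⟨ξ, hξ⟩), Subtype.ext (BoundedContinuousFunction.ext fun t => ?_)⟩
    have hmc : mask * c = c := funext fun i => by
      rcases hc i with h | h <;> simp [mask, h]
    rw [hfξ t (inc t) (mu t) rfl rfl]
    change -(l⁻¹ * ξ (mu t)) + mask * c + ξ (inc t) = _
    rw [hmc]
    ring
  -- A strict derivative onto a Banach space makes the map open at the point; no injectivity is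
  -- needed.
  have hnhds := hst.map_nhds_eq_of_surj hsurj
  have hball : {z : E | ‖z‖ < ε} ∈ 𝓝 (0 : E) := by
    simpa [Metric.ball, dist_zero_right] using Metric.ball_mem_nhds (0 : E) hε
  have himg := (hnhds ▸ image_mem_map hball :)
  have h0 : Φ 0 = 0 := by
    simp [Φ]
  obtain ⟨η, hη, hηb⟩ := Metric.mem_nhds_iff.1 himg
  refine ⟨η / 2, by positivity, fun y hy hya hyη => ?_⟩
  let yb : U₁ →ᵇ (κ → ℂ) := BoundedContinuousFunction.ofNormedAddCommGroup (fun t : U₁ => y t)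
    (continuousOn_iff_continuous_domRestrict.1 hy.continuousOn) (η / 2) fun t => hyη t t.2
  have hyb : yb ∈ holoSub U₁ a T := mem_holoSub_of_eq hy hya fun t => rfl
  obtain ⟨z, hz, hzy⟩ := hηb (show (⟨yb, hyb⟩ : holoSub U₁ a T) ∈ _ by
    rw [Metric.mem_ball, Subtype.dist_eq]
    change dist yb (Φ 0) < η
    rw [h0, dist_zero_right]
    refine lt_of_le_of_lt ?_ (half_lt_self hη)
    exact BoundedContinuousFunction.norm_ofNormedAddCommGroup_le _ (by positivity) _)
  have hz1 : ‖z.1‖ < ε := (norm_fst_le z).trans_lt hz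
  have hz2 : ‖z.2‖ < ε := (norm_snd_le z).trans_lt hz
  refine ⟨mask * z.1, fun i hi => ?_, lt_of_le_of_lt ?_ hz1, extendZero z.2.1, z.2.2.1, htw z.2,
    fun t ht => ?_, fun t ht => ?_⟩
  · by_contra h
    exact hi (by simp [mask, h])
  · refine (pi_norm_le_iff_of_nonneg (norm_nonneg _)).2 fun i => ?_
    refine le_trans ?_ (norm_le_pi_norm z.1 i)
    by_cases h : l i = 1 ∧ w i = 1 <;> simp [mask, h]
  · rw [extendZero_apply z.2.1 ⟨t, ht⟩]
    exact (z.2.1.norm_coe_le_norm _).trans_lt hz2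
  · have := DFunLike.congr_fun (congrArg Subtype.val hzy) ⟨t, ht⟩
    rw [← show yb ⟨t, ht⟩ = y t from rfl]
    exact (hΦ z ⟨t, ht⟩).symm.trans this

end GaugeMap

/-! ### Extension along the orbits of `t ↦ qt` -/

section Extension

variable {T G : Type*} [Group T] [Group G] {q : T} {D : Set T}

theorem forall_of_forall_mem (hD : ∀ t, ∃ n : ℤ, q ^ n * t ∈ D) {Q : T → Prop}
    (h0 : ∀ t ∈ D, Q t) (h : ∀ t, Q (q * t) ↔ Q t) (t : T) : Q t := by
  have key : ∀ n : ℤ, ∀ t, Q (q ^ n * t) ↔ Q t := fun n => by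
    induction n using Int.induction_on with
    | zero => simp
    | succ n ih => exact fun t => by rw [zpow_add_one, mul_assoc, ih, h]
    | pred n ih =>
      exact fun t => by
        rw [← h (q ^ _ * t), ← mul_assoc, ← zpow_one_add, add_sub_cancel, ih]
  obtain ⟨n, hn⟩ := hD t
  exact (key n t).1 (h0 _ hn)

/-- The operator `g(t) ↦ c⁻¹ g(qt) R(t)` on functions. -/
def shiftPerm (q : T) (c : G) (R : T → G) : Equiv.Perm (T → G) where
  toFun g t := c⁻¹ * g (q * t) * R t
  invFun g t := c * g (q⁻¹ * t) * (R (q⁻¹ * t))⁻¹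
  left_inv g := funext fun t => by simp [mul_assoc]
  right_inv g := funext fun t => by simp [mul_assoc]

theorem shiftPerm_zpow_congr (q : T) (c : G) (R : T → G) {g g' : T → G} (n : ℤ) :
    ∀ t, g (q ^ n * t) = g' (q ^ n * t) →
      (shiftPerm q c R ^ n) g t = (shiftPerm q c R ^ n) g' t := by
  induction n using Int.induction_on with
  | zero => simp
  | succ n ih =>
    intro t h
    rw [zpow_add_one, mul_assoc] at h
    have := ih _ h
    rw [zpow_add_one, (Commute.refl _).zpow_left _]
    change c⁻¹ * _ * _ = c⁻¹ * _ * _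
    rw [this]
  | pred n ih =>
    intro t h
    rw [zpow_sub_one, mul_assoc] at h
    have := ih _ h
    rw [zpow_sub_one, ((Commute.refl _).zpow_left _).inv_right]
    change c * _ * _ = c * _ * _
    rw [this]

/-- The wanted `f` is a fixed point of `S`, so its value at `t` must be `(S^n f₀)(t)` for any `n`
with `q^n t ∈ D`. The relation on `D` identifies the values for consecutive `n`, and the admissible
`n` form an interval, so the value is well defined. -/
theorem exists_quasiperiodic_extension {R f₀ : T → G} {c : G}
    (hD : ∀ t, ∃ n : ℤ, q ^ n * t ∈ D)
    (hconv : ∀ t, ∀ n m k : ℤ, n ≤ k → k ≤ m → q ^ n * t ∈ D → q ^ m * t ∈ D → q ^ k * t ∈ D)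
    (heq : ∀ t ∈ D, q * t ∈ D → f₀ t = c⁻¹ * f₀ (q * t) * R t) :
    ∃ f : T → G, (∀ t ∈ D, f t = f₀ t) ∧ ∀ t, f t = c⁻¹ * f (q * t) * R t := by
  set S := shiftPerm q c R with hS
  have step : ∀ t, ∀ n : ℤ, q ^ n * t ∈ D → q ^ (n + 1) * t ∈ D →
      (S ^ (n + 1)) f₀ t = (S ^ n) f₀ t := fun t n h1 h2 => by
    rw [zpow_add_one]
    refine shiftPerm_zpow_congr q c R n t ?_
    rw [zpow_add_one, (Commute.refl q).zpow_left, mul_assoc] at h2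
    exact (heq _ h1 h2).symm
  have up : ∀ t, ∀ n : ℤ, ∀ j : ℕ, q ^ n * t ∈ D → q ^ (n + j) * t ∈ D →
      (S ^ (n + j)) f₀ t = (S ^ n) f₀ t := fun t n j h1 => by
    induction j with
    | zero => simp
    | succ j ih =>
      intro h2
      push_cast at h2 ⊢
      have h3 := hconv t n (n + (j + 1)) (n + j) (by omega) (by omega) h1 h2
      rw [← ih h3, ← add_assoc]
      exact step t _ h3 (by rwa [add_assoc])
  have indep : ∀ t, ∀ n m : ℤ, q ^ n * t ∈ D → q ^ m * t ∈ D →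
      (S ^ n) f₀ t = (S ^ m) f₀ t := fun t n m h1 h2 => by
    rcases le_total n m with h | h <;> obtain ⟨j, rfl⟩ := Int.le.dest h
    · exact (up t n j h1 h2).symm
    · exact up t m j h2 h1
  choose N hN using hD
  refine ⟨fun t => (S ^ N t) f₀ t, fun t ht => ?_, fun t => ?_⟩
  · exact indep t (N t) 0 (hN t) (by simpa using ht)
  · change _ = S ((S ^ N (q * t)) f₀) t
    -- The shift by one comes from `q^n (qt) = q^(n+1) t`.
    refine (indep t (N t) (N (q * t) + 1) (hN t) (by
      rw [zpow_add_one, mul_assoc]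
      exact hN _)).trans ?_
    rw [zpow_add_one, (Commute.refl _).zpow_left]
    rfl

end Extension

/-! ### Holomorphy on `ℂ^*` as differentiability -/

section UnitsExt

variable {M : Type*} [NormedAddCommGroup M]

/-- A function on `ℂ^*`, extended by zero. -/
def unitsExt (f : ℂˣ → M) (t : ℂ) : M := if h : t = 0 then 0 else f (Units.mk0 t h)

theorem unitsExt_coe (f : ℂˣ → M) (t : ℂˣ) : unitsExt f t = f t := by
  simp [unitsExt]

theorem unitsExt_eventuallyEq {f : ℂˣ → M} {g : ℂ → M} {S : Set ℂ} (hS : IsOpen S)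
    (h : ∀ t : ℂˣ, (t : ℂ) ∈ S → f t = g t) {t : ℂˣ} (ht : (t : ℂ) ∈ S) :
    unitsExt f =ᶠ[𝓝 (t : ℂ)] g := by
  filter_upwards [hS.mem_nhds ht, isOpen_compl_singleton.mem_nhds t.ne_zero] with s hs hs0
  have := h (Units.mk0 s hs0) hs
  rwa [← unitsExt_coe f] at this

theorem isHolomorphic_iff [NormedSpace ℂ M] [FiniteDimensional ℂ M] {f : ℂˣ → M} :
    IsHolomorphic f ↔ ∀ t : ℂˣ, DifferentiableAt ℂ (unitsExt f) t := by
  constructor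
  · intro hf t
    set b := Module.finBasis ℂ M
    choose F hF hFf using fun i => hf (b.coord i)
    have h1 : DifferentiableAt ℂ (fun s => ∑ i, F i s • b i) (t : ℂ) :=
      DifferentiableAt.fun_sum fun i _ =>
        ((hF i).differentiableAt (isOpen_compl_singleton.mem_nhds t.ne_zero)).smul_const _
    refine h1.congr_of_eventuallyEq (unitsExt_eventuallyEq isOpen_univ (fun s _ => ?_) (mem_univ _))
    simp only [hFf]
    exact (b.sum_repr (f s)).symm
  · intro hf φ
    refine ⟨fun s => φ.toContinuousLinearMap (unitsExt f s), fun s hs => ?_, fun t => ?_⟩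
    · exact (φ.toContinuousLinearMap.differentiableAt.comp s
        (hf (Units.mk0 s hs))).differentiableWithinAt
    · exact congrArg φ (unitsExt_coe f t)

end UnitsExt

section Propagation

variable {M : Type*} [NormedRing M] [NormedAlgebra ℂ M] [CompleteSpace M]

theorem differentiableAt_unitsExt_inv {R : ℂˣ → Mˣ} {t : ℂˣ}
    (hR : DifferentiableAt ℂ (unitsExt fun t => (R t : M)) t) :
    DifferentiableAt ℂ (unitsExt fun t => ((R t)⁻¹ : Mˣ).val) t := by
  have h1 : DifferentiableAt ℂ (Ring.inverse : M → M) (unitsExt (fun t => (R t : M)) t) := by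
    rw [unitsExt_coe]
    exact differentiableAt_inverse (R t).isUnit
  refine (h1.comp (t : ℂ) hR).congr_of_eventuallyEq
    (unitsExt_eventuallyEq isOpen_univ (fun s _ => ?_) (mem_univ _))
  rw [Function.comp_apply, unitsExt_coe, Ring.inverse_unit]

/-- `f(t)` and `f(qt)` determine each other through the factors `c` and `R`, and inversion of units
in a Banach algebra is differentiable. -/
theorem differentiableAt_unitsExt_mul_iff {q : ℂˣ} {f R : ℂˣ → Mˣ} {c : Mˣ}
    (hR : ∀ t : ℂˣ, DifferentiableAt ℂ (unitsExt fun t => (R t : M)) t)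
    (hf : ∀ t, f t = c⁻¹ * f (q * t) * R t) (t : ℂˣ) :
    DifferentiableAt ℂ (unitsExt fun t => (f t : M)) ((q * t : ℂˣ) : ℂ) ↔
      DifferentiableAt ℂ (unitsExt fun t => (f t : M)) t := by
  constructor
  · intro h
    have h1 : DifferentiableAt ℂ (fun s : ℂ => unitsExt (fun t => (f t : M)) (q * s)) t :=
      DifferentiableAt.comp (t : ℂ) (by simpa using h) (by fun_prop)
    refine ((h1.const_mul (c⁻¹ : Mˣ).val).mul (hR t)).congr_of_eventuallyEq
      (unitsExt_eventuallyEq isOpen_univ (fun s _ => ?_) (mem_univ _))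
    simp only [Pi.mul_apply]
    rw [hf s, ← Units.val_mul, unitsExt_coe, unitsExt_coe]
    simp
  · intro h
    have hs : ∀ g : ℂ → M, DifferentiableAt ℂ g t → DifferentiableAt ℂ
        (fun s : ℂ => g (q⁻¹ * s)) ((q * t : ℂˣ) : ℂ) := fun g hg =>
      DifferentiableAt.comp ((q * t : ℂˣ) : ℂ) (by simpa using hg) (by fun_prop)
    refine (((hs _ h).const_mul (c : M)).mul
      (hs _ (differentiableAt_unitsExt_inv (hR t)))).congr_of_eventuallyEq
      (unitsExt_eventuallyEq isOpen_univ (fun s _ => ?_) (mem_univ _))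
    have h2 := hf (q⁻¹ * s)
    have h3 : f s = c * f (q⁻¹ * s) * (R (q⁻¹ * s))⁻¹ := by
      rw [h2, mul_inv_cancel_left]
      simp [mul_assoc]
    simp only [Pi.mul_apply]
    rw [← Units.val_mul, unitsExt_coe, unitsExt_coe, h3]
    simp

end Propagation

/-! ### The annulus and its enlargement as a fundamental domain -/

section Annulus

variable {q : ℂ}

/-- The moduli of the points in the interior of `|q|^{1/2} ≤ |t| ≤ |q|^{-1/2}`. -/
def annulus (q : ℂ) : Set ℝ := {s | 0 < s ∧ ‖q‖ < s ^ 2 ∧ s ^ 2 < ‖q‖⁻¹}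

theorem annulus_subset (q : ℂ) : annulus q ⊆ Ioi 0 := fun _ hs => hs.1

theorem isOpen_annulus (q : ℂ) : IsOpen (annulus q) :=
  (isOpen_lt continuous_const continuous_id).inter
    ((isOpen_lt continuous_const (continuous_pow 2)).inter
      (isOpen_lt (continuous_pow 2) continuous_const))

theorem ordConnected_annulus (q : ℂ) : (annulus q).OrdConnected := by
  refine ⟨fun x hx y hy z hz => ?_⟩
  have hz0 : 0 < z := hx.1.trans_le hz.1
  exact ⟨hz0, hx.2.1.trans_le (pow_le_pow_left₀ hx.1.le hz.1 2),
    (pow_le_pow_left₀ hz0.le hz.2 2).trans_lt hy.2.2⟩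

theorem one_mem_annulus (hq0 : q ≠ 0) (hq1 : ‖q‖ < 1) : (1 : ℝ) ∈ annulus q := by
  refine ⟨one_pos, by simpa using hq1, ?_⟩
  rw [one_pow]
  exact (one_lt_inv₀ (norm_pos_iff.2 hq0)).2 hq1

theorem annulus_bounds (hq0 : q ≠ 0) (hq1 : ‖q‖ < 1) :
    ∀ s ∈ annulus q, ‖q‖ * s ≤ 1 ∧ ‖q‖ ≤ s := fun s ⟨h0, h1, h2⟩ => by
  have hqp : 0 < ‖q‖ := norm_pos_iff.2 hq0
  have h3 : ‖q‖ * s ^ 2 < 1 := by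
    have := mul_lt_mul_of_pos_left h2 hqp
    rwa [mul_inv_cancel₀ hqp.ne'] at this
  constructor <;> rcases le_total s 1 with h | h <;> nlinarith

theorem mem_enlarge_annulus (hq0 : q ≠ 0) (hq1 : ‖q‖ < 1) {s : ℝ} (h : ‖q‖ ≤ s) (h' : s ≤ 1) :
    s ∈ enlarge q (annulus q) :=
  ⟨1, one_mem_annulus hq0 hq1, 1, one_mem_annulus hq0 hq1, h', by rwa [mul_one]⟩

/-- Consistency of the extension: the relation between `f(t)` and `f(qt)` has to be checked only
where the gauge equation has been solved. -/
theorem mem_of_mem_enlarge {J : Set ℝ} (hJ : J.OrdConnected) (hq0 : q ≠ 0) {t : ℂ}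
    (h1 : ‖t‖ ∈ enlarge q J) (h2 : ‖q * t‖ ∈ enlarge q J) : ‖t‖ ∈ J := by
  obtain ⟨s₁, hs₁, -, -, h3, -⟩ := h1
  obtain ⟨-, -, s₂, hs₂, -, h4⟩ := h2
  rw [norm_mul, mul_le_mul_iff_right₀ (norm_pos_iff.2 hq0)] at h4
  exact hJ.out hs₂ hs₁ ⟨h4, h3⟩

theorem ordConnected_enlarge (J : Set ℝ) : (enlarge q J).OrdConnected := by
  refine ⟨?_⟩
  rintro x ⟨-, -, s₂, hs₂, -, h2⟩ y ⟨s₁, hs₁, -, -, h1, -⟩ z hz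
  exact ⟨s₁, hs₁, s₂, hs₂, hz.2.trans h1, h2.trans hz.1⟩

theorem exists_zpow_mul_mem_enlarge {q : ℂˣ} (hq1 : ‖(q : ℂ)‖ < 1) (t : ℂˣ) :
    ∃ n : ℤ, ‖((q ^ n * t : ℂˣ) : ℂ)‖ ∈ enlarge (q : ℂ) (annulus q) := by
  have hqp : 0 < ‖(q : ℂ)‖ := norm_pos_iff.2 q.ne_zero
  obtain ⟨n, h1, h2⟩ := exists_mem_Ico_zpow (norm_pos_iff.2 t.ne_zero) ((one_lt_inv₀ hqp).2 hq1)
  rw [inv_zpow, inv_le_iff_one_le_mul₀' (zpow_pos hqp _)] at h1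
  rw [inv_zpow, ← one_div, lt_div_iff₀ (zpow_pos hqp _), mul_comm] at h2
  refine ⟨n + 1, mem_enlarge_annulus q.ne_zero hq1 ?_ ?_⟩ <;>
    rw [Units.val_mul, Units.val_zpow_eq_zpow_val, norm_mul, norm_zpow]
  · rw [zpow_add_one₀ hqp.ne']
    nlinarith
  · exact h2.le

theorem norm_zpow_mul_mem {q : ℂˣ} (hq1 : ‖(q : ℂ)‖ < 1) {D : Set ℝ} (hD : D.OrdConnected) (t : ℂˣ)
    (n m k : ℤ) (hnk : n ≤ k) (hkm : k ≤ m) (hn : ‖((q ^ n * t : ℂˣ) : ℂ)‖ ∈ D)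
    (hm : ‖((q ^ m * t : ℂˣ) : ℂ)‖ ∈ D) : ‖((q ^ k * t : ℂˣ) : ℂ)‖ ∈ D := by
  have hqp : 0 < ‖(q : ℂ)‖ := norm_pos_iff.2 q.ne_zero
  have key : ∀ i j : ℤ, i ≤ j → ‖((q ^ j * t : ℂˣ) : ℂ)‖ ≤ ‖((q ^ i * t : ℂˣ) : ℂ)‖ :=
    fun i j hij => by
    simp only [Units.val_mul, Units.val_zpow_eq_zpow_val, norm_mul, norm_zpow]
    exact mul_le_mul_of_nonneg_right (zpow_le_zpow_right_of_le_one₀ hqp hq1.le hij) (norm_nonneg _)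
  exact hD.out hm hn ⟨key _ _ hkm, key _ _ hnk⟩

end Annulus

/-! ### Solution of the gauge equation on the annulus -/

section LocalGauge

variable {𝔤 ι : Type*} [LieRing 𝔤] [LieAlgebra ℂ 𝔤] {ν : 𝔤 ≃ₗ⁅ℂ⁆ 𝔤}

theorem conj_ad (y : 𝔤) : ν.toLinearEquiv.conjAlgEquiv ℂ (LieAlgebra.ad ℂ 𝔤 y) =
    LieAlgebra.ad ℂ 𝔤 (ν y) := LinearMap.ext fun z => by
  change ν ⁅y, ν.toLinearEquiv.symm z⁆ = ⁅ν y, z⁆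
  rw [LieEquiv.map_lie]
  congr 1
  exact ν.toLinearEquiv.apply_symm_apply z

theorem conjAlgEquiv_eq_of_comm {φ ψ : Module.End ℂ 𝔤} (h : ∀ y, ψ (ν y) = ν (φ y)) :
    ν.toLinearEquiv.conjAlgEquiv ℂ φ = ψ := LinearMap.ext fun z => by
  change ν (φ (ν.toLinearEquiv.symm z)) = ψ z
  rw [← h]
  exact congrArg ψ (ν.toLinearEquiv.apply_symm_apply z)

theorem exists_norm_lt_of_eventually {E : Type*} [SeminormedAddCommGroup E] {a : E} {p : E → Prop}
    (h : ∀ᶠ z in 𝓝 a, p z) : ∃ ε > 0, ∀ z, ‖z - a‖ < ε → p z := by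
  obtain ⟨ε, hε, h⟩ := Metric.eventually_nhds_iff.1 h
  exact ⟨ε, hε, fun z hz => h (by rwa [dist_eq_norm])⟩

variable [FiniteDimensional ℂ 𝔤] [LieAlgebra.IsKilling ℂ 𝔤] [Finite ι] {H : LieSubalgebra ℂ 𝔤}
  {B : LieAlgebra.Basis ι H} {r : ℕ} {q : ℂˣ}

/-- After division by `x` the equation is `x⁻¹ R(t) = exp(-ad x⁻¹Y(qt)) exp(ad h) exp(ad Y(t))`, and
`x⁻¹` is multiplication by `l⁻¹` in coordinates. `exists_gauge_near` solves its projection to `𝔤`;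
both sides are automorphisms within `ρ` of `1`, hence equal. -/
theorem exists_local_gauge (hν : IsDiagramAutomorphism B ν) (hq1 : ‖(q : ℂ)‖ < 1) {u : 𝔤}
    (hu : u ∈ fixedCartan H ν) (hreg : IsRegular H ν r q u) {ε : ℝ} (hε : 0 < ε) :
    ∃ η > 0, ∀ R : ℂˣ → (Module.End ℂ 𝔤)ˣ, IsTwistedLoop ν r R →
      (∀ t : ℂˣ, ‖(t : ℂ)‖ ∈ annulus q →
        ‖(R t : Module.End ℂ 𝔤) - (eAd u : Module.End ℂ 𝔤)‖ < η) →
      ∃ h ∈ fixedCartan H ν, ‖LieAlgebra.ad ℂ 𝔤 h‖ < ε ∧ ∃ Y : ℂ → 𝔤,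
        DifferentiableOn ℂ (fun t => LieAlgebra.ad ℂ 𝔤 (Y t)) {t | ‖t‖ ∈ enlarge q (annulus q)} ∧
        (∀ t : ℂ, ‖t‖ ∈ enlarge q (annulus q) → Y (e (1 / r) * t) = ν (Y t)) ∧
        (∀ t : ℂ, ‖t‖ ∈ enlarge q (annulus q) → ‖LieAlgebra.ad ℂ 𝔤 (Y t)‖ < ε) ∧
        ∀ t : ℂˣ, ‖(t : ℂ)‖ ∈ annulus q → R t = (expUnit (LieAlgebra.ad ℂ 𝔤 (Y (q * t))))⁻¹ *
          (eAd u * expUnit (LieAlgebra.ad ℂ 𝔤 h)) * expUnit (LieAlgebra.ad ℂ 𝔤 (Y t)) := by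
  obtain ⟨b, w, m, hw, hm⟩ := hν.exists_eigenbasis
  set x : (Module.End ℂ 𝔤)ˣ := eAd u with hx
  set l : Fin (Module.finrank ℂ 𝔤) → ℂ := fun i => Complex.exp (2 * π * I * m i ⟨u, hu⟩) with hl_def
  have hl : ∀ i, (x : Module.End ℂ 𝔤) (b i) = l i • b i := fun i => eAd_eigenvector (hm i ⟨u, hu⟩)
  have hl0 : ∀ i, l i ≠ 0 := fun i => exp_ne_zero _
  have hq0 : (q : ℂ) ≠ 0 := q.ne_zero
  have hres : ∀ i, ∀ k : ℤ, (q : ℂ) ^ k = l i → (e (1 / r) : ℂ) ^ k = w i →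
      k = 0 ∧ b i ∈ fixedCartan H ν := fun i k h1 h2 =>
    hreg.resonant B hu hq1 (b.ne_zero i) (hw i) (hl i) h1 h2
  let s : (Fin (Module.finrank ℂ 𝔤) → ℂ) →ₗ[ℂ] 𝔤 := b.equivFun.symm.toLinearMap
  have hs : ∀ v, s v = ∑ i, v i • b i := fun v => b.equivFun_symm_apply v
  have hxs : ∀ v, (x : Module.End ℂ 𝔤) (s v) = s (l * v) := fun v => by
    rw [hs, hs, map_sum_of_eigen hl]
    rfl
  have hνs : ∀ v, ν (s v) = s (w * v) := fun v => by
    rw [hs, hs]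
    exact map_sum_of_eigen (T := ν.toLinearEquiv.toLinearMap) hw v
  let A : (Fin (Module.finrank ℂ 𝔤) → ℂ) →L[ℂ] Module.End ℂ 𝔤 :=
    LinearMap.toContinuousLinearMap (adLin 𝔤 ∘ₗ s)
  have hA : ∀ v, A v = LieAlgebra.ad ℂ 𝔤 (s v) := fun v => rfl
  let P : Module.End ℂ 𝔤 →L[ℂ] (Fin (Module.finrank ℂ 𝔤) → ℂ) :=
    LinearMap.toContinuousLinearMap (b.equivFun.toLinearMap ∘ₗ adProj 𝔤)
  have hP : ∀ φ, P φ = b.equivFun (adProj 𝔤 φ) := fun φ => rfl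
  let N : Module.End ℂ 𝔤 →ₐ[ℂ] Module.End ℂ 𝔤 := (ν.toLinearEquiv.conjAlgEquiv ℂ).toAlgHom
  have hN : Continuous N := LinearMap.continuous_of_finiteDimensional N.toLinearMap
  have hNφ : ∀ φ ψ : Module.End ℂ 𝔤, (∀ y, ψ (ν y) = ν (φ y)) → N φ = ψ := fun φ ψ h =>
    conjAlgEquiv_eq_of_comm h
  have hPA : ∀ v, P (A v) = v := fun v => by
    rw [hP, hA, adProj_ad]
    exact b.equivFun.apply_symm_apply v
  have hNA : ∀ v, N (A v) = A (w * v) := fun v => by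
    rw [hA, hA, ← hνs]
    exact conj_ad _
  have hPN : ∀ φ, P (N φ) = w * P φ := fun φ => by
    rw [hP, hP, adProj_conj ν (φ := φ) (ψ := N φ) fun y => by
      change ν (φ (ν.toLinearEquiv.symm (ν y))) = _
      congr 2
      exact ν.toLinearEquiv.symm_apply_apply y]
    funext i
    exact repr_map_of_eigen (T := ν.toLinearEquiv.toLinearMap) hw _ i
  obtain ⟨ρ, hρ, hinj⟩ := exists_forall_preservesBracket_eq 𝔤
  obtain ⟨ε₁, hε₁, hb₁⟩ := exists_norm_lt_of_eventually (a := 0) (p := fun v => ‖A v‖ < ε)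
    ((A.continuous.norm.tendsto' 0 0 (by simp)).eventually_lt_const hε)
  have hexp : Continuous (NormedSpace.exp : Module.End ℂ 𝔤 → Module.End ℂ 𝔤) :=
    NormedSpace.exp_continuous
  let Ψ : (Fin (Module.finrank ℂ 𝔤) → ℂ) × (Fin (Module.finrank ℂ 𝔤) → ℂ) ×
    (Fin (Module.finrank ℂ 𝔤) → ℂ) → Module.End ℂ 𝔤 := fun z => NormedSpace.exp (-A (l⁻¹ * z.1)) *
      NormedSpace.exp (A z.2.1) * NormedSpace.exp (A z.2.2)
  have hΨ : Continuous Ψ := by fun_prop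
  obtain ⟨ε₂, hε₂, hb₂⟩ := exists_norm_lt_of_eventually (a := 0) (p := fun z => ‖Ψ z - 1‖ < ρ)
    (((hΨ.sub continuous_const).norm.tendsto' 0 0 (by simp [Ψ])).eventually_lt_const hρ)
  obtain ⟨η₁, hη₁, hIFT⟩ := exists_gauge_near (J := annulus q) (a := e (1 / r)) (w := w) (l := l)
    hq0 hq1 hl0 (ordConnected_annulus _) (annulus_subset _) (isOpen_annulus _)
    (one_mem_annulus hq0 hq1) (annulus_bounds hq0 hq1) (norm_e_one_div r)
    (fun i k h1 h2 => (hres i k h1 h2).1) A P hPA N hN hNA hPN (lt_min hε₁ hε₂)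
  have hc : Continuous fun φ : Module.End ℂ 𝔤 => ((x⁻¹ : (Module.End ℂ 𝔤)ˣ) : Module.End ℂ 𝔤) * φ - 1 :=
    by fun_prop
  obtain ⟨η, hη, hb₃⟩ := exists_norm_lt_of_eventually (a := (x : Module.End ℂ 𝔤))
    (p := fun φ => ‖((x⁻¹ : (Module.End ℂ 𝔤)ˣ) : Module.End ℂ 𝔤) * φ - 1‖ < ρ ∧
      ‖P (((x⁻¹ : (Module.End ℂ 𝔤)ˣ) : Module.End ℂ 𝔤) * φ - 1)‖ < η₁)
    (((hc.norm.tendsto' _ 0 (by simp)).eventually_lt_const hρ).and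
      (((P.continuous.comp hc).norm.tendsto' _ 0 (by simp)).eventually_lt_const hη₁))
  refine ⟨η, hη, fun R hR hRx => ?_⟩
  have hRd := isHolomorphic_iff.1 hR.1
  have hne : ∀ t : ℂ, ‖t‖ ∈ annulus q → t ≠ 0 := fun t ht h0 => by simp [h0, annulus] at ht
  obtain ⟨h, hh, hhε, X, hX, hXa, hXε, hXR⟩ := hIFT
    (fun t => P (((x⁻¹ : (Module.End ℂ 𝔤)ˣ) : Module.End ℂ 𝔤) * unitsExt (fun t => (R t : Module.End ℂ 𝔤)) t - 1))
    (fun t ht => by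
      have := hRd (Units.mk0 t (hne t ht))
      exact (P.differentiableAt.comp t
        ((this.const_mul _).sub_const _)).differentiableWithinAt)
    (fun t ht => by
      lift t to ℂˣ using (hne t ht).isUnit
      rw [← Units.val_mul, unitsExt_coe, unitsExt_coe, ← hPN, map_sub N, map_mul N, map_one N,
        hNφ _ _ (hR.2.2 t), hNφ (x⁻¹ : (Module.End ℂ 𝔤)ˣ) (x⁻¹ : (Module.End ℂ 𝔤)ˣ)]
      intro y
      have := eAd_comm (ν := ν) hu.2 ((x⁻¹ : (Module.End ℂ 𝔤)ˣ).val y)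
      rw [← hx, ← Module.End.mul_apply x.val, Units.mul_inv, Module.End.one_apply] at this
      rw [← this, ← Module.End.mul_apply, Units.inv_mul, Module.End.one_apply])
    (fun t ht => by
      lift t to ℂˣ using (hne t ht).isUnit
      rw [unitsExt_coe]
      exact (hb₃ _ (hRx t ht)).2.le)
  have hsh : s h ∈ fixedCartan H ν := by
    rw [hs]
    refine sum_mem fun i _ => ?_
    by_cases hi : h i = 0
    · rw [hi, zero_smul]
      exact zero_mem _
    -- `l i = w i = 1` is resonance with `k = 0`, so regularity puts `b i` into `𝔥₀`.
    · obtain ⟨h1, h2⟩ := hh i hi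
      exact Submodule.smul_mem _ _ (hres i 0 (by rw [h1, zpow_zero]) (by rw [h2, zpow_zero])).2
  refine ⟨s h, hsh, hb₁ _ (by simpa using hhε.trans_le (min_le_left _ _)), fun t => s (X t),
    A.differentiable.comp_differentiableOn hX, fun t ht => ?_, fun t ht =>
      hb₁ _ (by simpa using (hXε t ht).trans_le (min_le_left _ _)), fun t ht => ?_⟩
  · beta_reduce
    rw [hXa t ht, hνs]
  · have hpb : ∀ y : 𝔤, PreservesBracket (NormedSpace.exp (LieAlgebra.ad ℂ 𝔤 y)) := fun y => by
      rw [← expEnd_eq]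
      exact expEnd_ad_preservesBracket y
    have hxpb : PreservesBracket (x : Module.End ℂ 𝔤) := eAd_preservesBracket u
    have e1 := hXR t ht
    rw [unitsExt_coe] at e1
    have e2 := hinj (Ψ (X (q * t), h, X t))
      (((x⁻¹ : (Module.End ℂ 𝔤)ˣ) : Module.End ℂ 𝔤) * R t) ?_
      (hxpb.inv.mul (.of_mem_adjointGroup (hR.2.1 t))) (hb₂ _ ?_) (hb₃ _ (hRx t ht)).1 ?_
    · rw [mul_assoc, mul_assoc, eq_inv_mul_iff_mul_eq]
      ext1
      rw [Units.val_mul, Units.val_mul, Units.val_mul, coe_expUnit, coe_expUnit, coe_expUnit]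
      have e3 : (R t : Module.End ℂ 𝔤) = x * Ψ (X (q * t), h, X t) := by
        rw [e2, ← mul_assoc, Units.mul_inv, one_mul]
      have e4 : expEnd (LieAlgebra.ad ℂ 𝔤 (s (X (q * t)))) * (x : Module.End ℂ 𝔤) =
          x * expEnd (LieAlgebra.ad ℂ 𝔤 (s (l⁻¹ * X (q * t)))) := LinearMap.ext fun z => by
        refine ((expEnd_ad_conj hxpb _ z).trans ?_).symm
        rw [hxs, ← mul_assoc, show l * l⁻¹ = 1 from funext fun i => mul_inv_cancel₀ (hl0 i), one_mul]
        rfl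
      rw [e3, ← mul_assoc, e4]
      simp only [Ψ, hA, ← expEnd_eq]
      rw [mul_assoc, mul_assoc, ← mul_assoc (expEnd _) (expEnd (-_)), expEnd_mul_expEnd_neg, one_mul]
    · simp only [Ψ, hA, ← map_neg]
      exact ((hpb _).mul (hpb _)).mul (hpb _)
    · rw [sub_zero]
      have m2 := min_le_right ε₁ ε₂
      refine max_lt ((hXε _ (mul_mem_enlarge (annulus_subset _) hq1 ht)).trans_le m2)
        (max_lt (hhε.trans_le m2) ((hXε _ (subset_enlarge (annulus_subset _) hq1 ht)).trans_le m2))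
    · rw [map_sub, map_sub] at e1
      exact b.equivFun.injective (sub_left_injective e1)

end LocalGauge

/-! ### From the annulus to all of `ℂ^*` -/

section GaugeNear

variable {𝔤 ι : Type*} [LieRing 𝔤] [LieAlgebra ℂ 𝔤] [FiniteDimensional ℂ 𝔤] {ν : 𝔤 ≃ₗ⁅ℂ⁆ 𝔤}
  {r : ℕ} {q : ℂˣ}

/-- Conjugation by `ν` on the invertible endomorphisms. -/
def unitsConj (ν : 𝔤 ≃ₗ⁅ℂ⁆ 𝔤) : (Module.End ℂ 𝔤)ˣ →* (Module.End ℂ 𝔤)ˣ :=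
  Units.map (ν.toLinearEquiv.conjAlgEquiv ℂ : Module.End ℂ 𝔤 →* Module.End ℂ 𝔤)

omit [FiniteDimensional ℂ 𝔤] in
theorem unitsConj_eq_iff {φ ψ : (Module.End ℂ 𝔤)ˣ} : unitsConj ν φ = ψ ↔
    ∀ y, (ψ : Module.End ℂ 𝔤) (ν y) = ν ((φ : Module.End ℂ 𝔤) y) := by
  constructor
  · rintro rfl y
    change ν ((φ : Module.End ℂ 𝔤) (ν.toLinearEquiv.symm (ν y))) = _
    congr 2
    exact ν.toLinearEquiv.symm_apply_apply y
  · exact fun h => Units.ext (conjAlgEquiv_eq_of_comm h)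

theorem unitsConj_expUnit_ad (y : 𝔤) : unitsConj ν (expUnit (LieAlgebra.ad ℂ 𝔤 y)) =
    expUnit (LieAlgebra.ad ℂ 𝔤 (ν y)) :=
  unitsConj_eq_iff.2 fun z => (expEnd_ad_conj (φ := ν.toLinearEquiv.toLinearMap)
    (fun a b => LieEquiv.map_lie ν a b) y z).symm

/-- Each defining property holds on the enlarged annulus, where `f = exp (ad Y)`, and passes between
`t` and `qt` because `c` and `R` have it too. -/
theorem isTwistedLoop_of_quasiperiodic (hq1 : ‖(q : ℂ)‖ < 1) {R f : ℂˣ → (Module.End ℂ 𝔤)ˣ}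
    {c : (Module.End ℂ 𝔤)ˣ} (hR : IsTwistedLoop ν r R) (hc : c ∈ adjointGroup 𝔤)
    (hcν : unitsConj ν c = c) {Y : ℂ → 𝔤}
    (hY : DifferentiableOn ℂ (fun t => LieAlgebra.ad ℂ 𝔤 (Y t)) {t | ‖t‖ ∈ enlarge q (annulus q)})
    (hYa : ∀ t : ℂ, ‖t‖ ∈ enlarge q (annulus q) → Y (e (1 / r) * t) = ν (Y t))
    (hfY : ∀ t : ℂˣ, ‖(t : ℂ)‖ ∈ enlarge q (annulus q) →
      f t = expUnit (LieAlgebra.ad ℂ 𝔤 (Y t)))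
    (hf : ∀ t, f t = c⁻¹ * f (q * t) * R t) : IsTwistedLoop ν r f := by
  have hD := exists_zpow_mul_mem_enlarge (q := q) hq1
  refine ⟨isHolomorphic_iff.2 ?_, ?_, ?_⟩
  · refine forall_of_forall_mem hD (D := {t : ℂˣ | ‖(t : ℂ)‖ ∈ enlarge q (annulus q)})
      (fun t ht => ?_) (differentiableAt_unitsExt_mul_iff (isHolomorphic_iff.1 hR.1) hf)
    have hU : IsOpen {t : ℂ | ‖t‖ ∈ enlarge (q : ℂ) (annulus q)} :=
      isOpen_norm_mem (isOpen_enlarge q.ne_zero (isOpen_annulus _))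
    refine ((DifferentiableOn.nexp hY).differentiableAt (hU.mem_nhds ht)).congr_of_eventuallyEq
      (unitsExt_eventuallyEq hU (fun s hs => ?_) ht)
    rw [hfY s hs, coe_expUnit, expEnd_eq]
  · refine forall_of_forall_mem hD (D := {t : ℂˣ | ‖(t : ℂ)‖ ∈ enlarge q (annulus q)})
      (fun t ht => ?_) fun t => ?_
    · rw [hfY t ht]
      exact expUnit_ad_mem_adjointGroup _
    · rw [hf t, Subgroup.mul_mem_cancel_right _ (hR.2.1 t),
        Subgroup.mul_mem_cancel_left _ (inv_mem hc)]
  · suffices h : ∀ t, unitsConj ν (f t) = f (e (1 / r) * t) from fun t => unitsConj_eq_iff.1 (h t)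
    refine forall_of_forall_mem hD (D := {t : ℂˣ | ‖(t : ℂ)‖ ∈ enlarge q (annulus q)})
      (fun t ht => ?_) fun t => ?_
    · have ht' : ‖((e (1 / r) * t : ℂˣ) : ℂ)‖ ∈ enlarge q (annulus q) := by
        rw [Units.val_mul, norm_mul, norm_e_one_div, one_mul]
        exact ht
      rw [hfY t ht, hfY _ ht', Units.val_mul, hYa _ ht, unitsConj_expUnit_ad]
    · rw [hf t, hf (e (1 / r) * t), map_mul, map_mul, map_inv, hcν,
        unitsConj_eq_iff.2 (hR.2.2 t), mul_left_inj, mul_right_inj, mul_left_comm]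

theorem size_lt_of_norm_lt {A : Module.End ℂ 𝔤} {δ : ℝ}
    (h : ‖A‖ < δ / (Module.finrank ℂ 𝔤 + 1)) : size A < δ := by
  rw [lt_div_iff₀ (by positivity)] at h
  linarith [size_le_norm A, norm_nonneg A]

theorem eAd_inv_smul (h : 𝔤) :
    eAd ((2 * π * I : ℂ)⁻¹ • h) = expUnit (LieAlgebra.ad ℂ 𝔤 h) := by
  rw [eAd_eq, smul_inv_smul₀ Complex.two_pi_I_ne_zero]

variable [LieAlgebra.IsKilling ℂ 𝔤] [Finite ι] {H : LieSubalgebra ℂ 𝔤} {B : LieAlgebra.Basis ι H}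

theorem exists_gauge_transform_near (hν : IsDiagramAutomorphism B ν) (hq1 : ‖(q : ℂ)‖ < 1) {u : 𝔤}
    (hu : u ∈ fixedCartan H ν) (hreg : IsRegular H ν r q u) {δ : ℝ} (hδ : 0 < δ) :
    ∃ η : ℝ, 0 < η ∧ ∀ R : ℂˣ → (Module.End ℂ 𝔤)ˣ, IsTwistedLoop ν r R →
      (∀ t : ℂˣ, ‖(q : ℂ)‖ ≤ ‖(t : ℂ)‖ ^ 2 → ‖(t : ℂ)‖ ^ 2 ≤ ‖(q : ℂ)‖⁻¹ →
        size ((R t : Module.End ℂ 𝔤) - (eAd u : Module.End ℂ 𝔤)) < η) →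
      ∃ u' ∈ fixedCartan H ν, size (LieAlgebra.ad ℂ 𝔤 (u' - u)) < δ ∧
        ∃ f : ℂˣ → (Module.End ℂ 𝔤)ˣ, IsTwistedLoop ν r f ∧
          (∀ t : ℂˣ, ‖(q : ℂ)‖ ≤ ‖(t : ℂ)‖ ^ 2 → ‖(t : ℂ)‖ ^ 2 ≤ ‖(q : ℂ)‖⁻¹ →
            size ((f t : Module.End ℂ 𝔤) - 1) < δ) ∧
          ∀ t, R t = (f (q * t))⁻¹ * eAd u' * f t := by
  have hqp : 0 < ‖(q : ℂ)‖ := norm_pos_iff.2 q.ne_zero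
  set δ' := δ / (Module.finrank ℂ 𝔤 + 1) with hδ'
  have hδ'0 : 0 < δ' := by positivity
  have hexp : Continuous (NormedSpace.exp : Module.End ℂ 𝔤 → Module.End ℂ 𝔤) :=
    NormedSpace.exp_continuous
  obtain ⟨ε₁, hε₁, hb₁⟩ := exists_norm_lt_of_eventually (a := (0 : Module.End ℂ 𝔤))
    (p := fun A => ‖NormedSpace.exp A - 1‖ < δ')
    (((hexp.sub continuous_const).norm.tendsto' 0 0 (by simp)).eventually_lt_const hδ'0)
  -- `Ψ` expresses `f(t) = c⁻¹ f(qt) R(t)` and equals `1` at the unperturbed data; it controls `f`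
  -- where `exp (ad Y)` is not available.
  let Ψ : Module.End ℂ 𝔤 × Module.End ℂ 𝔤 × Module.End ℂ 𝔤 → Module.End ℂ 𝔤 := fun z =>
    NormedSpace.exp (-z.1) * ((eAd u)⁻¹ : (Module.End ℂ 𝔤)ˣ).val * NormedSpace.exp z.2.1 * z.2.2
  have hΨ : Continuous Ψ := by fun_prop
  obtain ⟨ε₂, hε₂, hb₂⟩ := exists_norm_lt_of_eventually
    (a := ((0, 0, (eAd u).val) : Module.End ℂ 𝔤 × Module.End ℂ 𝔤 × Module.End ℂ 𝔤))
    (p := fun z => ‖Ψ z - 1‖ < δ')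
    (((hΨ.sub continuous_const).norm.tendsto' _ 0 (by simp [Ψ])).eventually_lt_const hδ'0)
  obtain ⟨η, hη, hloc⟩ := exists_local_gauge hν hq1 hu hreg (lt_min (lt_min hε₁ hε₂) hδ'0)
  refine ⟨min η ε₂, lt_min hη hε₂, fun R hR hRu => ?_⟩
  have hRu' : ∀ t : ℂˣ, ‖(q : ℂ)‖ ≤ ‖(t : ℂ)‖ ^ 2 → ‖(t : ℂ)‖ ^ 2 ≤ ‖(q : ℂ)‖⁻¹ →
      ‖(R t : Module.End ℂ 𝔤) - (eAd u : Module.End ℂ 𝔤)‖ < min η ε₂ := fun t h1 h2 =>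
    (norm_le_size _).trans_lt (hRu t h1 h2)
  obtain ⟨h, hh, hhε, Y, hY, hYa, hYε, hRY⟩ := hloc R hR fun t ht =>
    (hRu' t ht.2.1.le ht.2.2.le).trans_le (min_le_left _ _)
  set c := eAd u * expUnit (LieAlgebra.ad ℂ 𝔤 h) with hc
  have huh : eAd (u + (2 * π * I : ℂ)⁻¹ • h) = c := by
    rw [hc, ← eAd_inv_smul]
    exact Units.ext (eAd_add_of_lie_eq_zero (by
      rw [lie_smul, lie_eq_zero_of_mem_cartan B hu.1 hh.1, smul_zero]))
  have hcG : c ∈ adjointGroup 𝔤 := mul_mem (eAd_mem_adjointGroup u) (expUnit_ad_mem_adjointGroup h)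
  have hcν : unitsConj ν c = c := by
    rw [hc, map_mul, unitsConj_expUnit_ad, hh.2, unitsConj_eq_iff.2 (eAd_comm hu.2)]
  obtain ⟨f, hfY, hf⟩ := exists_quasiperiodic_extension (R := R) (c := c)
    (D := {t : ℂˣ | ‖(t : ℂ)‖ ∈ enlarge q (annulus q)})
    (f₀ := fun t : ℂˣ => expUnit (LieAlgebra.ad ℂ 𝔤 (Y t))) (exists_zpow_mul_mem_enlarge hq1)
    (norm_zpow_mul_mem hq1 (ordConnected_enlarge _)) fun t h1 h2 => by
      rw [hRY t (mem_of_mem_enlarge (ordConnected_annulus _) q.ne_zero h1 h2), Units.val_mul]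
      group
  have hn : ‖(2 * π * I : ℂ)⁻¹‖ ≤ 1 := by
    rw [norm_inv, inv_le_one₀ (norm_pos_iff.2 Complex.two_pi_I_ne_zero)]
    have : ‖(2 * π * I : ℂ)‖ = 2 * π := by simp [abs_of_pos Real.pi_pos]
    rw [this]
    linarith [Real.pi_gt_three]
  refine ⟨u + (2 * π * I : ℂ)⁻¹ • h, add_mem hu (Submodule.smul_mem _ _ hh),
    size_lt_of_norm_lt ?_, f, isTwistedLoop_of_quasiperiodic hq1 hR hcG hcν hY hYa hfY hf,
    fun t h1 h2 => size_lt_of_norm_lt ?_, fun t => ?_⟩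
  · rw [add_sub_cancel_left, map_smul, norm_smul]
    exact (mul_le_of_le_one_left (norm_nonneg _) hn).trans_lt (hhε.trans_le (min_le_right _ _))
  · have m1 : min (min ε₁ ε₂) δ' ≤ ε₁ := (min_le_left _ _).trans (min_le_left _ _)
    have m2 : min (min ε₁ ε₂) δ' ≤ ε₂ := (min_le_left _ _).trans (min_le_right _ _)
    have ht0 : 0 < ‖(t : ℂ)‖ := norm_pos_iff.2 t.ne_zero
    by_cases ht : ‖(t : ℂ)‖ ∈ enlarge (q : ℂ) (annulus q)
    · rw [hfY t ht, coe_expUnit, expEnd_eq]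
      exact hb₁ _ (by simpa using (hYε _ ht).trans_le m1)
    -- The enlarged annulus omits the outer boundary circle of `A`. There `qt` lies in it, and one
    -- step of the quasi-periodicity bounds `f(t) - 1`.
    · have hgt : 1 < ‖(t : ℂ)‖ := by
        by_contra hle
        push Not at hle
        exact ht (mem_enlarge_annulus q.ne_zero hq1 (by nlinarith) hle)
      have h3 : ‖(q : ℂ)‖ * ‖(t : ℂ)‖ ^ 2 ≤ 1 := by
        have := mul_le_mul_of_nonneg_left h2 hqp.le
        rwa [mul_inv_cancel₀ hqp.ne'] at this
      have hqt : ‖((q * t : ℂˣ) : ℂ)‖ ∈ enlarge (q : ℂ) (annulus q) := by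
        rw [Units.val_mul, norm_mul]
        exact mem_enlarge_annulus q.ne_zero hq1 (by nlinarith) (by nlinarith [mul_pos hqp ht0])
      have e1 : (f t : Module.End ℂ 𝔤) = Ψ (LieAlgebra.ad ℂ 𝔤 h,
          LieAlgebra.ad ℂ 𝔤 (Y ((q * t : ℂˣ) : ℂ)), R t) := by
        rw [hf t, hfY _ hqt, hc, mul_inv_rev, coe_expUnit_inv]
        simp only [Units.val_mul, coe_expUnit, expEnd_eq, Ψ]
      rw [e1]
      refine hb₂ _ (max_lt ?_ (max_lt ?_ ?_))
      · simpa using hhε.trans_le m2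
      · simpa using (hYε _ hqt).trans_le m2
      · exact (hRu' t h1 h2).trans_le (min_le_right _ _)
  · rw [huh, hf t]
    group

end GaugeNear

end

end TwistedBundle

/-! ### Assembly of the proposition -/

theorem proposition4p2 {𝔤 ι : Type*} [LieRing 𝔤] [LieAlgebra ℂ 𝔤] [FiniteDimensional ℂ 𝔤]
    [LieAlgebra.IsSimple ℂ 𝔤] [Finite ι] (H : LieSubalgebra ℂ 𝔤) (B : LieAlgebra.Basis ι H)
    (ν : 𝔤 ≃ₗ⁅ℂ⁆ 𝔤) (hν : TwistedBundle.IsDiagramAutomorphism B ν)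
    (r : ℕ) (hr : r = orderOf ν.toLinearEquiv) (τ : ℂ) (hτ : 0 < τ.im)
    (q : ℂˣ) (hq : q = TwistedBundle.e (τ / r)) :
    -- first order, every `u`: deformations of `x` modulo a finite-dimensional space
    (∀ u ∈ TwistedBundle.fixedCartan H ν, ∀ x : Module.End ℂ 𝔤, x = TwistedBundle.eAd u →
      FiniteDimensional ℂ (TwistedBundle.stabilizer ν r q x) ∧
      ∀ δR : ℂˣ → Module.End ℂ 𝔤, TwistedBundle.IsDeformation ν r x δR →
        ∃! δR₀ : ℂˣ → Module.End ℂ 𝔤,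
          (∃ Y ∈ TwistedBundle.stabilizer ν r q x,
            ∀ t, δR₀ t = x * LieAlgebra.ad ℂ 𝔤 (Y t)) ∧
          ∃ X ∈ TwistedBundle.gaugeAlgebra ν r,
            TwistedBundle.IsInfinitesimalGauge q x (fun t => δR t - δR₀ t) X) ∧
    -- regular `u`
    (∀ u ∈ TwistedBundle.fixedCartan H ν, TwistedBundle.IsRegular H ν r q u →
      -- first order: only a constant in the Cartan direction is subtracted
      (∀ x : Module.End ℂ 𝔤, x = TwistedBundle.eAd u →
        ∀ δR : ℂˣ → Module.End ℂ 𝔤, TwistedBundle.IsDeformation ν r x δR →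
          ∃! h : 𝔤, h ∈ TwistedBundle.fixedCartan H ν ∧
            ∃ X ∈ TwistedBundle.gaugeAlgebra ν r,
              TwistedBundle.IsInfinitesimalGauge q x
                (fun t => δR t - x * LieAlgebra.ad ℂ 𝔤 h) X) ∧
      -- near `x`: small gauge transforms of constants `e(u')`, `u' ∈ 𝔥₀` close to `u`
      (∀ δ : ℝ, 0 < δ → ∃ η : ℝ, 0 < η ∧
        ∀ R : ℂˣ → (Module.End ℂ 𝔤)ˣ, TwistedBundle.IsTwistedLoop ν r R →
          (∀ t : ℂˣ, ‖(q : ℂ)‖ ≤ ‖(t : ℂ)‖ ^ 2 → ‖(t : ℂ)‖ ^ 2 ≤ ‖(q : ℂ)‖⁻¹ →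
            TwistedBundle.size ((R t : Module.End ℂ 𝔤) - (TwistedBundle.eAd u : Module.End ℂ 𝔤)) < η) →
          ∃ u' ∈ TwistedBundle.fixedCartan H ν,
            TwistedBundle.size (LieAlgebra.ad ℂ 𝔤 (u' - u)) < δ ∧
            ∃ f : ℂˣ → (Module.End ℂ 𝔤)ˣ, TwistedBundle.IsTwistedLoop ν r f ∧
              (∀ t : ℂˣ, ‖(q : ℂ)‖ ≤ ‖(t : ℂ)‖ ^ 2 → ‖(t : ℂ)‖ ^ 2 ≤ ‖(q : ℂ)‖⁻¹ →
                TwistedBundle.size ((f t : Module.End ℂ 𝔤) - 1) < δ) ∧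
              ∀ t, R t = (f (q * t))⁻¹ * TwistedBundle.eAd u' * f t)) ∧
    -- almost every `u` is regular
    (∀ (n : ℕ) (φ : (Fin n → ℂ) ≃ₗ[ℂ] TwistedBundle.fixedCartan H ν),
      MeasureTheory.volume
        {c : Fin n → ℂ | ¬ TwistedBundle.IsRegular H ν r q (φ c : 𝔤)} = 0) := by
  subst hr hq
  have hq1 := TwistedBundle.norm_e_div_lt_one hτ hν.isOfFinOrder.orderOf_pos
  refine ⟨fun u hu x hx => ?_, fun u hu hreg => ⟨fun x hx δR hδR => ?_, fun δ hδ =>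
    TwistedBundle.exists_gauge_transform_near hν hq1 hu hreg hδ⟩, fun n φ =>
    TwistedBundle.volume_not_isRegular hν φ⟩
  · subst hx
    exact ⟨TwistedBundle.finiteDimensional_stabilizer_eAd hν hq1 hu, fun δR hδR =>
      TwistedBundle.existsUnique_deformation_part hν hq1 hu hδR⟩
  · subst hx
    exact TwistedBundle.existsUnique_cartan_part hν hq1 hu hreg hδR
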